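/- Let $\alpha_1,\alpha_3,\alpha_5>0$ satisfy $\frac{3}{16}<\frac{\alpha_1\alpha_5}{\alpha_3^2}<\frac14$, and put $F(s)=-\alpha_1+\alpha_3 s-\alpha_5 s^2$ and $\rho_0=\frac{\alpha_3+\sqrt{\alpha_3^2-4\alpha_1\alpha_5}}{2\alpha_5}$. Define the odd function $g:\mathbb{R}\to\mathbb{R}$ by $$g(s)=-F\big((\sqrt{\rho_0}-s)^2\big)(\sqrt{\rho_0}-s)\ \ (0\le s\le\sqrt{\rho_0}),\qquad g(s)=0\ \ (s\ge\sqrt{\rho_0}),\qquad g(s)=-g(-s)\ \ (s\le 0).$$ Let $Q\in C^2(\mathbb{R}^2)\cap H^1(\mathbb{R}^2)$ be a ground state, that is, a solution of $-\Delta Q=g(Q)$ on $\mathbb{R}^2$ with $0<Q<\sqrt{\rho_0}$ that is radially symmetric and non-increasing in $|x|$. Then $\partial_{x_1}Q,\partial_{x_2}Q\in H^2(\mathbb{R}^2)$, and the operator $$L_0=-\Delta-g'(Q):H^2(\mathbb{R}^2)\to L^2(\mathbb{R}^2)$$ satisfies $$\ker L_0=\operatorname{span}\{\partial_{x_1}Q,\partial_{x_2}Q\}.$$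 Consequently the stationary bubble $\phi_0=\sqrt{\rho_0}-Q$ of the cubic-quintic nonlinear Schrödinger equation, which solves $\Delta\phi_0+F(\phi_0^2)\phi_0=0$, is non-degenerate: the operator $$A=-\Delta-F(\phi_0^2)-2F'(\phi_0^2)\phi_0^2:H^2(\mathbb{R}^2)\to L^2(\mathbb{R}^2)$$ satisfies $\ker A=\operatorname{span}\{\partial_{x_1}\phi_0,\partial_{x_2}\phi_0\}$. Both statements hold for real-valued functions (with real spans) and for complex-valued functions (with complex spans). -/

import Mathlib

open MeasureTheory InnerProductSpace
open scoped ContDiff ENNReal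

noncomputable section

namespace CubicQuintic

/-! ### Sobolev spaces on the plane through weak derivatives -/

/-- The Euclidean plane. -/
abbrev Plane : Type := EuclideanSpace ℝ (Fin 2)

/-- The classical partial derivative `∂_{x_i} f`. -/
def pderiv (i : Fin 2) (f : Plane → ℝ) (x : Plane) : ℝ :=
  fderiv ℝ f x (EuclideanSpace.single i (1 : ℝ))

/-- `L²(ℝ²; 𝕜)`, with `𝕜 = ℝ` or `𝕜 = ℂ`. -/
abbrev L2 (𝕜 : Type*) [RCLike 𝕜] := Lp 𝕜 2 (volume : Measure Plane)

variable {𝕜 : Type*} [RCLike 𝕜]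

/-- `h` is the weak `i`-th partial derivative of `f`:
`∫ (∂_i φ) f = - ∫ φ h` for every test function `φ ∈ C_c^∞(ℝ²)`. -/
def HasWeakPartial (i : Fin 2) (f h : L2 𝕜) : Prop :=
  ∀ φ : Plane → ℝ, ContDiff ℝ ∞ φ → HasCompactSupport φ →
    ∫ x, pderiv i φ x • f x = - ∫ x, φ x • h x

theorem integrable_test_smul {φ : Plane → ℝ} (hφ : Continuous φ) (hc : HasCompactSupport φ)
    (f : L2 𝕜) : Integrable (fun x => φ x • f x) := by
  have h1 : LocallyIntegrable (f : Plane → 𝕜) volume :=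
    (Lp.memLp f).locallyIntegrable (by norm_num)
  exact h1.integrable_smul_left_of_hasCompactSupport hφ hc

theorem continuous_pderiv {φ : Plane → ℝ} (hφ : ContDiff ℝ ∞ φ) (i : Fin 2) :
    Continuous (pderiv i φ) :=
  (hφ.continuous_fderiv (by simp)).clm_apply continuous_const

theorem hasCompactSupport_pderiv {φ : Plane → ℝ} (hc : HasCompactSupport φ) (i : Fin 2) :
    HasCompactSupport (pderiv i φ) :=
  hc.fderiv_apply (𝕜 := ℝ) _

theorem HasWeakPartial.unique {i : Fin 2} {f h h' : L2 𝕜} (H : HasWeakPartial i f h)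
    (H' : HasWeakPartial i f h') : h = h' := by
  apply Lp.ext
  refine ae_eq_of_integral_contDiff_smul_eq ((Lp.memLp h).locallyIntegrable (by norm_num))
    ((Lp.memLp h').locallyIntegrable (by norm_num)) fun φ hφ hc => ?_
  have := (H φ hφ hc).symm.trans (H' φ hφ hc)
  exact neg_injective this

theorem HasWeakPartial.add {i : Fin 2} {f f' h h' : L2 𝕜} (H : HasWeakPartial i f h)
    (H' : HasWeakPartial i f' h') : HasWeakPartial i (f + f') (h + h') := by
  intro φ hφ hc
  have e1 : ∫ x, pderiv i φ x • (f + f' : L2 𝕜) x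
      = ∫ x, (pderiv i φ x • f x + pderiv i φ x • f' x) := by
    apply integral_congr_ae
    filter_upwards [Lp.coeFn_add f f'] with x hx
    rw [hx, Pi.add_apply, smul_add]
  have e2 : ∫ x, φ x • (h + h' : L2 𝕜) x = ∫ x, (φ x • h x + φ x • h' x) := by
    apply integral_congr_ae
    filter_upwards [Lp.coeFn_add h h'] with x hx
    rw [hx, Pi.add_apply, smul_add]
  have hd := continuous_pderiv hφ i
  have hdc := hasCompactSupport_pderiv hc i
  rw [e1, e2, integral_add (integrable_test_smul hd hdc f) (integrable_test_smul hd hdc f'),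
    integral_add (integrable_test_smul hφ.continuous hc h)
      (integrable_test_smul hφ.continuous hc h'), H φ hφ hc, H' φ hφ hc, neg_add]

theorem HasWeakPartial.smul {i : Fin 2} {f h : L2 𝕜} (c : 𝕜) (H : HasWeakPartial i f h) :
    HasWeakPartial i (c • f) (c • h) := by
  intro φ hφ hc
  have e1 : ∫ x, pderiv i φ x • (c • f : L2 𝕜) x = ∫ x, c • (pderiv i φ x • f x) := by
    apply integral_congr_ae
    filter_upwards [Lp.coeFn_smul c f] with x hx
    rw [hx, Pi.smul_apply, smul_comm]
  have e2 : ∫ x, φ x • (c • h : L2 𝕜) x = ∫ x, c • (φ x • h x) := by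
    apply integral_congr_ae
    filter_upwards [Lp.coeFn_smul c h] with x hx
    rw [hx, Pi.smul_apply, smul_comm]
  rw [e1, e2, integral_smul, integral_smul, H φ hφ hc, smul_neg]

theorem HasWeakPartial.zero (i : Fin 2) : HasWeakPartial i (0 : L2 𝕜) 0 := by
  have e (ψ : Plane → ℝ) : ∫ x, ψ x • (0 : L2 𝕜) x = 0 := by
    rw [integral_eq_zero_of_ae]
    filter_upwards [Lp.coeFn_zero 𝕜 2 (volume : Measure Plane)] with x hx
    rw [hx]; simp
  intro φ _ _
  rw [e, e, neg_zero]

variable (𝕜) in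
/-- The Sobolev space `H¹(ℝ²)`, as a subspace of `L²(ℝ²)`. -/
def H1 : Submodule 𝕜 (L2 𝕜) where
  carrier := {f | ∀ i, ∃ h : L2 𝕜, HasWeakPartial i f h}
  add_mem' := fun hf hg i => ⟨_, (hf i).choose_spec.add (hg i).choose_spec⟩
  zero_mem' := fun i => ⟨0, HasWeakPartial.zero i⟩
  smul_mem' := fun c _ hf i => ⟨_, (hf i).choose_spec.smul c⟩

/-- The weak partial derivative `∂_i : H¹(ℝ²) → L²(ℝ²)`. -/
def weakPartial (i : Fin 2) : H1 𝕜 →ₗ[𝕜] L2 𝕜 where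
  toFun f := (f.2 i).choose
  map_add' f g :=
    ((f + g).2 i).choose_spec.unique ((f.2 i).choose_spec.add (g.2 i).choose_spec)
  map_smul' c f := ((c • f).2 i).choose_spec.unique ((f.2 i).choose_spec.smul c)

theorem weakPartial_spec (i : Fin 2) (f : H1 𝕜) : HasWeakPartial i (f : L2 𝕜) (weakPartial i f) :=
  (f.2 i).choose_spec

variable (𝕜) in
/-- The Sobolev space `H²(ℝ²)`: the functions of `H¹(ℝ²)` whose weak first partial derivatives
lie in `H¹(ℝ²)`. -/
def H2 : Submodule 𝕜 (L2 𝕜) where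
  carrier := {f | ∃ hf : f ∈ H1 𝕜, ∀ i, weakPartial i ⟨f, hf⟩ ∈ H1 𝕜}
  add_mem' := by
    rintro f g ⟨hf, hf'⟩ ⟨hg, hg'⟩
    refine ⟨add_mem hf hg, fun i => ?_⟩
    have := (H1 𝕜).add_mem (hf' i) (hg' i)
    rwa [← map_add] at this
  zero_mem' := ⟨zero_mem _, fun i => by
    have : weakPartial i (0 : H1 𝕜) ∈ H1 𝕜 := by rw [map_zero]; exact zero_mem _
    exact this⟩
  smul_mem' := by
    rintro c f ⟨hf, hf'⟩
    refine ⟨(H1 𝕜).smul_mem c hf, fun i => ?_⟩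
    have := (H1 𝕜).smul_mem c (hf' i)
    rwa [← map_smul] at this

/-- The weak first partial derivative `∂_i : H²(ℝ²) → H¹(ℝ²)`. -/
def weakPartial₂ (i : Fin 2) : H2 𝕜 →ₗ[𝕜] H1 𝕜 where
  toFun f := ⟨weakPartial i ⟨f, f.2.1⟩, f.2.2 i⟩
  map_add' f g := Subtype.ext (map_add (weakPartial i) ⟨(f : L2 𝕜), f.2.1⟩ ⟨(g : L2 𝕜), g.2.1⟩)
  map_smul' c f := Subtype.ext (map_smul (weakPartial i) c ⟨(f : L2 𝕜), f.2.1⟩)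

/-- The Laplacian `Δ = ∂₁∂₁ + ∂₂∂₂ : H²(ℝ²) → L²(ℝ²)`. -/
def weakLaplacian : H2 𝕜 →ₗ[𝕜] L2 𝕜 :=
  ∑ i : Fin 2, (weakPartial i).comp (weakPartial₂ i)

/-- Multiplication `L²(ℝ²) → L²(ℝ²)` by a real potential `V ∈ L^∞(ℝ²)`. -/
def mulPotential (V : Plane → ℝ) (hV : MemLp V ∞ volume) : L2 𝕜 →ₗ[𝕜] L2 𝕜 where
  toFun f := (hV.ofReal (K := 𝕜)).toLp _ • f
  map_add' f g := Lp.add_smul _ f g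
  map_smul' c f := by
    apply Lp.ext
    filter_upwards [Lp.coeFn_lpSMul (r := 2) ((hV.ofReal (K := 𝕜)).toLp _) (c • f),
      Lp.coeFn_lpSMul (r := 2) ((hV.ofReal (K := 𝕜)).toLp _) f, Lp.coeFn_smul c f,
      Lp.coeFn_smul c (((hV.ofReal (K := 𝕜)).toLp _ • f : L2 𝕜))] with x h1 h2 h3 h4
    rw [h1, RingHom.id_apply, h4]
    simp only [Pi.smul_apply, Pi.smul_apply', h2, h3, smul_eq_mul]
    ring

variable (𝕜) in
/-- The Schrödinger operator `-Δ - V : H²(ℝ²) → L²(ℝ²)` with a bounded potential. -/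
def schrodinger (V : Plane → ℝ) (hV : MemLp V ∞ volume) : H2 𝕜 →ₗ[𝕜] L2 𝕜 :=
  -weakLaplacian - (mulPotential V hV).comp (H2 𝕜).subtype

/-! ### The cubic-quintic nonlinearity -/

/-- `F(s) = -α₁ + α₃ s - α₅ s²`. -/
def F (α₁ α₃ α₅ s : ℝ) : ℝ := -α₁ + α₃ * s - α₅ * s ^ 2

/-- `ρ₀ = (α₃ + √(α₃² - 4 α₁ α₅)) / (2 α₅)`, the larger root of `F`. -/
def rho0 (α₁ α₃ α₅ : ℝ) : ℝ := (α₃ + √(α₃ ^ 2 - 4 * α₁ * α₅)) / (2 * α₅)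

/-- The function `g` on `[0, ∞)`. -/
def gPos (α₁ α₃ α₅ s : ℝ) : ℝ :=
  if s ≤ √(rho0 α₁ α₃ α₅) then
    -F α₁ α₃ α₅ ((√(rho0 α₁ α₃ α₅) - s) ^ 2) * (√(rho0 α₁ α₃ α₅) - s)
  else 0

/-- The nonlinearity `g`, extended to `(-∞, 0]` by `g(s) = -g(-s)`. -/
def g (α₁ α₃ α₅ s : ℝ) : ℝ :=
  if 0 ≤ s then gPos α₁ α₃ α₅ s else -gPos α₁ α₃ α₅ (-s)

/-- `Q` is a ground state of `-Δu = g(u)`, `u ∈ H¹(ℝ²)`: a solution with values in `(0, √ρ₀)`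
that is radially symmetric and decreasing. -/
structure IsGroundState (α₁ α₃ α₅ : ℝ) (Q : Plane → ℝ) : Prop where
  contDiff : ContDiff ℝ 2 Q
  equation : ∀ x, -Laplacian.laplacian Q x = g α₁ α₃ α₅ (Q x)
  mem_H1 : ∃ hQ : MemLp Q 2 volume, hQ.toLp Q ∈ H1 ℝ
  range : ∀ x, Q x ∈ Set.Ioo 0 (√(rho0 α₁ α₃ α₅))
  radial_decreasing : ∃ q : ℝ → ℝ, AntitoneOn q (Set.Ici 0) ∧ ∀ x, Q x = q ‖x‖

/-! ### The linearized operators -/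

theorem memLp_top_comp {Q : Plane → ℝ} (hQ : Continuous Q) {a : ℝ}
    (hr : ∀ x, Q x ∈ Set.Ioo 0 a) {W : ℝ → ℝ} (hW : Continuous W) :
    MemLp (fun x => W (Q x)) ∞ volume := by
  obtain ⟨C, hC⟩ := (isCompact_Icc (a := (0 : ℝ)) (b := a)).exists_bound_of_continuousOn
    hW.continuousOn
  exact memLp_top_of_bound (hW.comp hQ).aestronglyMeasurable C
    (Filter.Eventually.of_forall fun x => hC _ (Set.Ioo_subset_Icc_self (hr x)))

theorem contDiff_F (α₁ α₃ α₅ : ℝ) : ContDiff ℝ ∞ (F α₁ α₃ α₅) := by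
  unfold F; fun_prop

theorem deriv_g_eq (α₁ α₃ α₅ : ℝ) {s : ℝ} (hs : s ∈ Set.Ioo 0 (√(rho0 α₁ α₃ α₅))) :
    deriv (g α₁ α₃ α₅) s = deriv (fun s => -F α₁ α₃ α₅ ((√(rho0 α₁ α₃ α₅) - s) ^ 2) *
      (√(rho0 α₁ α₃ α₅) - s)) s := by
  apply Filter.EventuallyEq.deriv_eq
  filter_upwards [Ioo_mem_nhds hs.1 hs.2] with t ht
  simp [g, gPos, ht.1.le, ht.2.le]

/-- The potential `g'(Q)` is bounded. -/
theorem IsGroundState.memLp_deriv_g {α₁ α₃ α₅ : ℝ} {Q : Plane → ℝ}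
    (hQ : IsGroundState α₁ α₃ α₅ Q) : MemLp (fun x => deriv (g α₁ α₃ α₅) (Q x)) ∞ volume := by
  simp only [fun x => deriv_g_eq α₁ α₃ α₅ (hQ.range x)]
  refine memLp_top_comp hQ.contDiff.continuous hQ.range
    (ContDiff.continuous_deriv (n := 1) ?_ le_rfl)
  unfold F; fun_prop

/-- The operator `L₀ = -Δ - g'(Q) : H²(ℝ²) → L²(ℝ²)`. -/
def L0 (𝕜 : Type*) [RCLike 𝕜] {α₁ α₃ α₅ : ℝ} {Q : Plane → ℝ} (hQ : IsGroundState α₁ α₃ α₅ Q) :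
    H2 𝕜 →ₗ[𝕜] L2 𝕜 :=
  schrodinger 𝕜 (fun x => deriv (g α₁ α₃ α₅) (Q x)) hQ.memLp_deriv_g

/-- The stationary bubble `φ₀ = √ρ₀ - Q` given by a ground state `Q`. -/
def bubble (α₁ α₃ α₅ : ℝ) (Q : Plane → ℝ) (x : Plane) : ℝ := √(rho0 α₁ α₃ α₅) - Q x

/-- The potential of the linearization at the bubble is bounded. -/
theorem IsGroundState.memLp_bubble {α₁ α₃ α₅ : ℝ} {Q : Plane → ℝ}
    (hQ : IsGroundState α₁ α₃ α₅ Q) :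
    MemLp (fun x => F α₁ α₃ α₅ (bubble α₁ α₃ α₅ Q x ^ 2) +
      2 * deriv (F α₁ α₃ α₅) (bubble α₁ α₃ α₅ Q x ^ 2) * bubble α₁ α₃ α₅ Q x ^ 2) ∞ volume := by
  have h1 : Continuous (F α₁ α₃ α₅) := (contDiff_F α₁ α₃ α₅).continuous
  have h2 : Continuous (deriv (F α₁ α₃ α₅)) :=
    (contDiff_F α₁ α₃ α₅).continuous_deriv (by simp)
  exact memLp_top_comp hQ.contDiff.continuous hQ.range
    (W := fun s => F α₁ α₃ α₅ ((√(rho0 α₁ α₃ α₅) - s) ^ 2) +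
      2 * deriv (F α₁ α₃ α₅) ((√(rho0 α₁ α₃ α₅) - s) ^ 2) * (√(rho0 α₁ α₃ α₅) - s) ^ 2)
    (by fun_prop)

/-- The operator `A = -Δ - F(φ₀²) - 2 F'(φ₀²) φ₀² : H²(ℝ²) → L²(ℝ²)`, the linearization of the
stationary equation `Δφ + F(φ²)φ = 0` at the bubble `φ₀ = √ρ₀ - Q`. -/
def bubbleOperator (𝕜 : Type*) [RCLike 𝕜] {α₁ α₃ α₅ : ℝ} {Q : Plane → ℝ}
    (hQ : IsGroundState α₁ α₃ α₅ Q) : H2 𝕜 →ₗ[𝕜] L2 𝕜 :=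
  schrodinger 𝕜 (fun x => F α₁ α₃ α₅ (bubble α₁ α₃ α₅ Q x ^ 2) +
    2 * deriv (F α₁ α₃ α₅) (bubble α₁ α₃ α₅ Q x ^ 2) * bubble α₁ α₃ α₅ Q x ^ 2) hQ.memLp_bubble

/-- The kernel of `L : H²(ℝ²) → L²(ℝ²)` is the span of `∂_{x_1} u` and `∂_{x_2} u`
(in particular these classical partial derivatives represent elements of `H²(ℝ²)`). -/
def KernelIsSpanOfPartials {𝕜 : Type*} [RCLike 𝕜] (L : H2 𝕜 →ₗ[𝕜] L2 𝕜) (u : Plane → ℝ) : Prop :=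
  ∃ d : Fin 2 → H2 𝕜,
    (∀ i, ((d i : L2 𝕜) : Plane → 𝕜) =ᵐ[volume] fun x => ((pderiv i u x : ℝ) : 𝕜)) ∧
    LinearMap.ker L = Submodule.span 𝕜 {d 0, d 1}

end CubicQuintic

end

namespace CubicQuintic

open Set Filter Topology

/-! Put `a = √ρ₀`. On `(0, a)` the nonlinearity is a quintic `f` with roots `0, b, a, 2a - b, 2a`
(`exists_g_eq_quintic`). It is negative on `(0, b)` and positive on `(b, a)`, and `s f'(s) / f(s)`
is strictly decreasing on `(b, a)` (`bistable_quintic`). Only these features of `f` enter the kernel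
argument.

Let `q` be the radial profile of `Q` and `p = q'`. The `k`-th angular Fourier coefficient `u` of a
kernel element solves `(r u')' = (k²/r - r f'(q)) u`. Since `f'(0) < 0`, the coefficient is
nonnegative far out, so a square integrable `u` decays (`IsMode.tendsto_atTop`). Differentiating the
equation of `q` shows that `p < 0` is a solution for `k = 1`. For `k = 1` the Wronskian of `u` and
`p` is constant and tends to `0`, so `u` is a multiple of `p` (`IsProfile.exists_eq_mul`). For `k ≥
2` a Sturm comparison with `p` forces `u = 0` (`IsProfile.eq_zero_of_two_le`).

The heart is `k = 0` (`IsProfile.not_pos_near_zero`). Suppose `δ > 0` near the origin. Comparison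
with `p` produces a first zero `r₁`, and comparison with `-r p`, a strict supersolution where `q <
b`, gives `q(r₁) > b`. Let `W` be the Wronskian of `δ` with `r p + λ q`, so that `W' = r δ Θ(q)`
with `Θ(s) = λ (s f'(s) - f(s)) - 2 f(s)`, and choose `λ` with `Θ(q(r₁)) = 0`. Monotonicity of `s
f'/f` makes `Θ(q)` and `δ` change sign together at `r₁`, so `W` decreases strictly from `W(0) = 0`
up to the next zero of `δ`. If there is none, `W` cannot tend to `0` at infinity. A next zero `r₂`
would again have `q(r₂) > b`, and the signs of `W` at `r₁` and `r₂` contradict the monotonicity of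
`r p / q` between them.

To reach these equations, a kernel element is tested with `ψ(|x|²) Y`, where `Y` is a solid
harmonic, in the variables `(ρ, θ)` with `ρ = r²`. Integrating twice shows that each angular moment
is almost everywhere a classical solution (`exists_classical_of_weak`). Cauchy–Schwarz controls it
at the origin, and Parseval on almost every circle reassembles the function
(`ae_eq_zero_of_angular`).

Conversely, radial symmetry gives `∇Q = P x` and `∇P = S x`, where `P` and `S` are radial means of
class `C¹`. Hence `Q` has continuous third derivatives, `∂ᵢQ` solves the linearized equation, and
its derivatives are dominated by `Q` and `∇Q` outside the unit ball, which puts `∂ᵢQ` in `H²`. Real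
and imaginary parts treat both scalar fields at once. Finally `A` and `L₀` have the same potential,
and `∂ᵢφ₀ = -∂ᵢQ`. -/

/-! ### The structure of the nonlinearity -/

/-- The properties of a bistable nonlinearity `f` on `(0, a)`, with sign change at `b`, which the
non-degeneracy argument uses: `f < 0` on `(0, b)`, `f > 0` on `(b, a)`, `s f'(s) - f(s) > 0` on
`(0, b]`, and `s f'(s) / f(s)` is strictly decreasing on `(b, a)`. -/
structure Bistable (f f' : ℝ → ℝ) (a b : ℝ) : Prop where
  b_pos : 0 < b
  b_lt : b < a
  hasDerivAt : ∀ s, HasDerivAt f (f' s) s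
  continuous_deriv : Continuous f'
  map_zero : f 0 = 0
  deriv_zero : f' 0 < 0
  map_b : f b = 0
  neg : ∀ s, 0 < s → s < b → f s < 0
  pos : ∀ s, b < s → s < a → 0 < f s
  superlinear : ∀ s, 0 < s → s ≤ b → f s < s * f' s
  ratio_anti : ∀ s t, b < s → s < t → t < a → t * f' t * f s < s * f' s * f t

/-- The quintic polynomial with roots `0, b, a, 2a - b, 2a`. -/
def quintic (c a b s : ℝ) : ℝ := c * s * (2 * a - s) * (a - s) * (s - b) * (2 * a - b - s)

/-- The derivative of `quintic`. -/
def quinticDeriv (c a b s : ℝ) : ℝ :=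
  c * (2 * a - s) * (a - s) * (s - b) * (2 * a - b - s)
    - c * s * (a - s) * (s - b) * (2 * a - b - s)
    - c * s * (2 * a - s) * (s - b) * (2 * a - b - s)
    + c * s * (2 * a - s) * (a - s) * (2 * a - b - s)
    - c * s * (2 * a - s) * (a - s) * (s - b)

theorem hasDerivAt_quintic (c a b s : ℝ) :
    HasDerivAt (quintic c a b) (quinticDeriv c a b s) s := by
  have h1 : HasDerivAt (fun s : ℝ => c * s) c s := by simpa using (hasDerivAt_id s).const_mul c
  have h2 (d : ℝ) : HasDerivAt (fun s : ℝ => d - s) (-1) s := (hasDerivAt_id s).const_sub d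
  have h3 : HasDerivAt (fun s : ℝ => s - b) 1 s := (hasDerivAt_id s).sub_const b
  convert! (((h1.mul (h2 (2 * a))).mul (h2 a)).mul h3).mul (h2 (2 * a - b)) using 1
  unfold quinticDeriv
  simp only [Pi.mul_apply]
  ring

/-- Logarithmic differentiation: a root `d` contributes `s / (s - d)` to `s f'(s) / f(s)`. -/
theorem mul_quinticDeriv (c : ℝ) {a b s : ℝ} (hb : 0 < b) (hs : b < s) (hsa : s < a) :
    s * quinticDeriv c a b s = quintic c a b s *
      (1 + s / (s - b) - s / (a - s) - s / (2 * a - s) - s / (2 * a - b - s)) := by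
  have h1 : s - b ≠ 0 := by linarith
  have h2 : a - s ≠ 0 := by linarith
  have h3 : 2 * a - s ≠ 0 := by linarith
  have h4 : 2 * a - b - s ≠ 0 := by linarith
  unfold quintic quinticDeriv
  field_simp
  ring

theorem bistable_quintic {c a b : ℝ} (hc : 0 < c) (hb : 0 < b) (hba : b < a) :
    Bistable (quintic c a b) (quinticDeriv c a b) a b where
  b_pos := hb
  b_lt := hba
  hasDerivAt := hasDerivAt_quintic c a b
  continuous_deriv := by unfold quinticDeriv; fun_prop
  map_zero := by simp [quintic]
  deriv_zero := by
    have h1 : 0 < 2 * a - b := by linarith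
    have h2 : 0 < a := by linarith
    have : quinticDeriv c a b 0 = -(c * (2 * a) * a * b * (2 * a - b)) := by
      unfold quinticDeriv; ring
    rw [this]
    have : 0 < c * (2 * a) * a * b * (2 * a - b) := by positivity
    linarith
  map_b := by simp [quintic]
  neg s hs hsb := by
    have h1 : 0 < 2 * a - b - s := by linarith
    have h2 : 0 < a - s := by linarith
    have h3 : 0 < 2 * a - s := by linarith
    have h4 : 0 < b - s := by linarith
    have : 0 < c * s * (2 * a - s) * (a - s) * (b - s) * (2 * a - b - s) := by positivity
    unfold quintic
    linarith
  pos s hs hsa := by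
    have h0 : 0 < s := by linarith
    have h1 : 0 < 2 * a - b - s := by linarith
    have h2 : 0 < a - s := by linarith
    have h3 : 0 < 2 * a - s := by linarith
    have h4 : 0 < s - b := by linarith
    unfold quintic
    positivity
  superlinear s hs hsb := by
    have h1 : 0 < 2 * a - b - s := by linarith
    have h2 : 0 < a - s := by linarith
    have h3 : 0 < 2 * a - s := by linarith
    have h4 : 0 ≤ b - s := by linarith
    -- Writing `f(s) = c s h(s)`, the left side is `c s² h'(s)`. In `h'` the terms from `s - b` and
    -- `2a - b - s` combine through `(2a - b - s) - (s - b) = 2 (a - s)`.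
    have key : s * quinticDeriv c a b s - quintic c a b s = c * s ^ 2 *
        (((a - s) + (2 * a - s)) * ((b - s) * (2 * a - b - s))
          + 2 * (a - s) * ((a - s) * (2 * a - s))) := by
      unfold quintic quinticDeriv; ring
    have : 0 < c * s ^ 2 * (((a - s) + (2 * a - s)) * ((b - s) * (2 * a - b - s))
          + 2 * (a - s) * ((a - s) * (2 * a - s))) := by positivity
    linarith
  ratio_anti s t hbs hst hta := by
    have hpos : ∀ s, b < s → s < a → 0 < quintic c a b s := by
      intro s hs hsa
      have h0 : 0 < s := by linarith
      have h1 : 0 < 2 * a - b - s := by linarith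
      have h2 : 0 < a - s := by linarith
      have h3 : 0 < 2 * a - s := by linarith
      have h4 : 0 < s - b := by linarith
      unfold quintic
      positivity
    have hs := hpos s hbs (hst.trans hta)
    have ht := hpos t (hbs.trans hst) hta
    rw [mul_quinticDeriv c hb hbs (hst.trans hta), mul_quinticDeriv c hb (hbs.trans hst) hta]
    -- Each term of the logarithmic derivative is monotone: `s / (d - s)` increases, while `s / (s -
    -- b)` decreases because `b > 0`.
    have up (d : ℝ) (hd : 0 < d) (htd : t < d) : s / (d - s) < t / (d - t) := by
      rw [div_lt_div_iff₀ (by linarith) (by linarith)]; nlinarith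
    have e1 : t / (t - b) < s / (s - b) := by
      rw [div_lt_div_iff₀ (by linarith) (by linarith)]; nlinarith
    have e2 := up a (by linarith) hta
    have e3 := up (2 * a) (by linarith) (by linarith)
    have e4 := up (2 * a - b) (by linarith) (by linarith)
    have : (1 + t / (t - b) - t / (a - t) - t / (2 * a - t) - t / (2 * a - b - t)) <
      (1 + s / (s - b) - s / (a - s) - s / (2 * a - s) - s / (2 * a - b - s)) := by linarith
    have := mul_lt_mul_of_pos_left this (mul_pos hs ht)
    linarith

/-- On `(0, √ρ₀)` the nonlinearity `g` is a quintic polynomial. -/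
theorem exists_g_eq_quintic {α₁ α₃ α₅ : ℝ} (hα₁ : 0 < α₁) (hα₃ : 0 < α₃) (hα₅ : 0 < α₅)
    (hα : α₁ * α₅ / α₃ ^ 2 < 1 / 4) :
    ∃ b, 0 < b ∧ b < √(rho0 α₁ α₃ α₅) ∧ ∀ s ∈ Ioo 0 (√(rho0 α₁ α₃ α₅)),
      g α₁ α₃ α₅ s = quintic α₅ (√(rho0 α₁ α₃ α₅)) b s := by
  have hD : 0 < α₃ ^ 2 - 4 * α₁ * α₅ := by
    rw [div_lt_iff₀ (by positivity)] at hα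
    linarith
  set D := √(α₃ ^ 2 - 4 * α₁ * α₅) with hDdef
  have hD0 : 0 < D := Real.sqrt_pos.2 hD
  have hD2 : D ^ 2 = α₃ ^ 2 - 4 * α₁ * α₅ := Real.sq_sqrt hD.le
  have hDlt : D < α₃ := by
    have : 0 < 4 * α₁ * α₅ := by positivity
    nlinarith
  set a := √(rho0 α₁ α₃ α₅) with ha
  have hρ0 : rho0 α₁ α₃ α₅ = (α₃ + D) / (2 * α₅) := rfl
  have ha2 : a ^ 2 = (α₃ + D) / (2 * α₅) := by
    rw [ha, Real.sq_sqrt (by rw [hρ0]; positivity), hρ0]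
  have hρ1 : 0 < (α₃ - D) / (2 * α₅) := div_pos (by linarith) (by positivity)
  -- `β²` is the smaller root of `F`, so `F(σ) = -α₅ (σ - a²)(σ - β²)`. Substituting `σ = (a - s)²`
  -- gives the roots `0, 2a, a - β, a + β`, and the factor `a - s` adds `a`. Hence `b = a - β`.
  set β := √((α₃ - D) / (2 * α₅)) with hβ
  have hβ0 : 0 < β := Real.sqrt_pos.2 hρ1
  have hβ2 : β ^ 2 = (α₃ - D) / (2 * α₅) := Real.sq_sqrt hρ1.le
  have hβa : β < a := by
    apply Real.sqrt_lt_sqrt hρ1.le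
    rw [hρ0]
    gcongr
    linarith
  have hsum : α₅ * (a ^ 2 + β ^ 2) = α₃ := by
    rw [ha2, hβ2]; field_simp; ring
  have hprod : α₅ * (a ^ 2 * β ^ 2) = α₁ := by
    rw [ha2, hβ2]; field_simp; linear_combination -hD2
  refine ⟨a - β, by linarith, by linarith, fun s hs => ?_⟩
  simp only [g, gPos, hs.1.le, hs.2.le, if_true, ← ha]
  unfold F quintic
  rw [← hprod, ← hsum]
  ring

theorem deriv_g_eq_quinticDeriv {α₁ α₃ α₅ b : ℝ}
    (h : ∀ s ∈ Ioo 0 (√(rho0 α₁ α₃ α₅)),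
      g α₁ α₃ α₅ s = quintic α₅ (√(rho0 α₁ α₃ α₅)) b s) {s : ℝ}
    (hs : s ∈ Ioo 0 (√(rho0 α₁ α₃ α₅))) :
    deriv (g α₁ α₃ α₅) s = quinticDeriv α₅ (√(rho0 α₁ α₃ α₅)) b s := by
  rw [← (hasDerivAt_quintic _ _ _ s).deriv]
  apply Filter.EventuallyEq.deriv_eq
  filter_upwards [Ioo_mem_nhds hs.1 hs.2] with t ht using h t ht

/-- The potential of the linearization at the bubble is `g'(Q)`. -/
theorem bubble_potential_eq {α₁ α₃ α₅ : ℝ} {Q : Plane → ℝ}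
    (hQ : IsGroundState α₁ α₃ α₅ Q) (x : Plane) :
    F α₁ α₃ α₅ (bubble α₁ α₃ α₅ Q x ^ 2) +
      2 * deriv (F α₁ α₃ α₅) (bubble α₁ α₃ α₅ Q x ^ 2) * bubble α₁ α₃ α₅ Q x ^ 2 =
    deriv (g α₁ α₃ α₅) (Q x) := by
  rw [deriv_g_eq α₁ α₃ α₅ (hQ.range x)]
  set a := √(rho0 α₁ α₃ α₅)
  have h1 : HasDerivAt (fun s => a - s) (-1) (Q x) := (hasDerivAt_id (Q x)).const_sub a
  have hF : HasDerivAt (F α₁ α₃ α₅) (deriv (F α₁ α₃ α₅) ((a - Q x) ^ 2)) ((a - Q x) ^ 2) :=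
    (((contDiff_F α₁ α₃ α₅).differentiable (by simp)) _).hasDerivAt
  have h2 := ((hF.comp (Q x) (h1.pow 2)).neg).mul h1
  have h3 := h2.deriv
  simp only [Function.comp_def, Pi.mul_def, Pi.neg_def, Pi.pow_def] at h3
  rw [h3]
  simp only [bubble]
  push_cast
  ring

/-! ### Monotonicity from derivatives -/

theorem monotoneOn_of_hasDerivAt {D : Set ℝ} (hD : Convex ℝ D) {f f' : ℝ → ℝ}
    (hf : ∀ x ∈ D, HasDerivAt f (f' x) x) (h : ∀ x ∈ D, 0 ≤ f' x) : MonotoneOn f D :=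
  monotoneOn_of_deriv_nonneg hD (fun x hx => (hf x hx).continuousAt.continuousWithinAt)
    (fun x hx => (hf x (interior_subset hx)).differentiableAt.differentiableWithinAt)
    (fun x hx => by rw [(hf x (interior_subset hx)).deriv]; exact h x (interior_subset hx))

theorem antitoneOn_of_hasDerivAt {D : Set ℝ} (hD : Convex ℝ D) {f f' : ℝ → ℝ}
    (hf : ∀ x ∈ D, HasDerivAt f (f' x) x) (h : ∀ x ∈ D, f' x ≤ 0) : AntitoneOn f D :=
  antitoneOn_of_deriv_nonpos hD (fun x hx => (hf x hx).continuousAt.continuousWithinAt)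
    (fun x hx => (hf x (interior_subset hx)).differentiableAt.differentiableWithinAt)
    (fun x hx => by rw [(hf x (interior_subset hx)).deriv]; exact h x (interior_subset hx))

theorem strictMonoOn_of_hasDerivAt {D : Set ℝ} (hD : Convex ℝ D) {f f' : ℝ → ℝ}
    (hf : ∀ x ∈ D, HasDerivAt f (f' x) x) (h : ∀ x ∈ interior D, 0 < f' x) : StrictMonoOn f D :=
  strictMonoOn_of_deriv_pos hD (fun x hx => (hf x hx).continuousAt.continuousWithinAt)
    (fun x hx => by rw [(hf x (interior_subset hx)).deriv]; exact h x hx)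

theorem strictAntiOn_of_hasDerivAt {D : Set ℝ} (hD : Convex ℝ D) {f f' : ℝ → ℝ}
    (hf : ∀ x ∈ D, HasDerivAt f (f' x) x) (h : ∀ x ∈ interior D, f' x < 0) : StrictAntiOn f D :=
  strictAntiOn_of_deriv_neg hD (fun x hx => (hf x hx).continuousAt.continuousWithinAt)
    (fun x hx => by rw [(hf x (interior_subset hx)).deriv]; exact h x hx)

/-- A function which is strictly increasing on `(0, R]` and tends to `0` at `0` is positive. -/
theorem pos_of_strictMonoOn_Ioc {W : ℝ → ℝ} {R : ℝ} (hR : 0 < R)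
    (h : StrictMonoOn W (Ioc 0 R)) (h0 : Tendsto W (𝓝[>] 0) (𝓝 0)) : 0 < W R := by
  have h1 : W (R / 2) < W R := h ⟨by linarith, by linarith⟩ ⟨hR, le_rfl⟩ (by linarith)
  have h2 : 0 ≤ W (R / 2) := by
    refine le_of_tendsto h0 ?_
    filter_upwards [Ioo_mem_nhdsGT (show (0 : ℝ) < R / 2 by linarith)] with x hx
    exact (h ⟨hx.1, by linarith [hx.2]⟩ ⟨by linarith, by linarith⟩ hx.2).le
  linarith

theorem neg_of_strictAntiOn_Ioc {W : ℝ → ℝ} {R : ℝ} (hR : 0 < R)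
    (h : StrictAntiOn W (Ioc 0 R)) (h0 : Tendsto W (𝓝[>] 0) (𝓝 0)) : W R < 0 := by
  have := pos_of_strictMonoOn_Ioc (W := fun r => -W r) hR
    (fun x hx y hy hxy => neg_lt_neg (h hx hy hxy)) (by simpa using h0.neg)
  linarith

/-! ### Linear radial equations -/

/-- `u' = z / r` and `z' = c u` on `(0, ∞)`; that is, `(r u')' = c u` with `z = r u'`. -/
def IsMode (c u z : ℝ → ℝ) : Prop :=
  ∀ r, 0 < r → HasDerivAt u (z r / r) r ∧ HasDerivAt z (c r * u r) r

theorem IsMode.neg {c u z : ℝ → ℝ} (h : IsMode c u z) :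
    IsMode c (fun r => -u r) (fun r => -z r) := fun r hr =>
  ⟨by convert! (h r hr).1.neg using 1; ring, by convert! (h r hr).2.neg using 1; ring⟩

/-- By monotonicity `(x / 2) G(x)` is at most the integral of `G` over `(x/2, x]`, which is bounded
by the tail of a convergent integral. -/
theorem tendsto_id_mul_of_antitoneOn {G : ℝ → ℝ} {R : ℝ} (hG : AntitoneOn G (Ici R))
    (h0 : ∀ x, 0 ≤ G x) (hint : IntegrableOn G (Ioi 0)) :
    Tendsto (fun x => x * G x) atTop (𝓝 0) := by
  have h1 : Tendsto (fun x : ℝ => ∫ t in Ioi (x / 2), G t) atTop (𝓝 0) := by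
    have := (tendsto_setIntegral_of_antitone (μ := volume) (f := G) (s := fun x : ℝ => Ioi (x / 2))
      (fun _ => measurableSet_Ioi) (fun x y hxy => Ioi_subset_Ioi (by linarith))
      ⟨0, by simpa using hint⟩)
    have he : (⋂ x : ℝ, Ioi (x / 2)) = ∅ := by
      ext t
      simp only [mem_iInter, mem_Ioi, mem_empty_iff_false, iff_false, not_forall, not_lt]
      exact ⟨2 * t, by linarith⟩
    simpa [he] using this
  have h2 := h1.const_mul 2
  rw [mul_zero] at h2
  refine tendsto_of_tendsto_of_tendsto_of_le_of_le' tendsto_const_nhds h2 ?_ ?_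
  · filter_upwards [eventually_ge_atTop 0] with x hx using mul_nonneg hx (h0 x)
  · filter_upwards [eventually_ge_atTop (2 * R), eventually_gt_atTop 0] with x hx hx0
    have hI : IntegrableOn G (Ioi (x / 2)) := hint.mono_set (Ioi_subset_Ioi (by linarith))
    have h3 : ∫ t in Ioc (x / 2) x, G x ≤ ∫ t in Ioc (x / 2) x, G t := by
      refine setIntegral_mono_on (by simp) (hI.mono_set Ioc_subset_Ioi_self)
        measurableSet_Ioc fun t ht => ?_
      exact hG (by simp only [mem_Ici]; linarith [ht.1]) (by simp only [mem_Ici]; linarith) ht.2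
    have h4 : ∫ t in Ioc (x / 2) x, G t ≤ ∫ t in Ioi (x / 2), G t :=
      setIntegral_mono_set hI (ae_of_all _ fun t => h0 t)
        (LE.le.eventuallyLE Ioc_subset_Ioi_self)
    have h5 : ∫ t in Ioc (x / 2) x, G x = (x / 2) * G x := by
      rw [setIntegral_const, measureReal_def, Real.volume_Ioc,
        ENNReal.toReal_ofReal (by linarith), smul_eq_mul]
      ring
    linarith

/-- Square integrable solutions of `(r u')' = c u` with `c ≥ 0` near infinity decay. -/
theorem IsMode.tendsto_atTop {c u z : ℝ → ℝ} (h : IsMode c u z)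
    (hc : ∀ᶠ r in atTop, 0 ≤ c r) (hint : IntegrableOn (fun ρ => u (√ρ) ^ 2) (Ioi 0)) :
    Tendsto (fun r => r * u r) atTop (𝓝 0) ∧ Tendsto z atTop (𝓝 0) := by
  obtain ⟨R, hR0, hR⟩ : ∃ R > 0, ∀ r ≥ R, 0 ≤ c r := by
    obtain ⟨R, hR⟩ := eventually_atTop.1 hc
    exact ⟨max R 1, by positivity, fun r hr => hR r ((le_max_left _ _).trans hr)⟩
  have hpos : ∀ r ∈ Ici R, 0 < r := fun r hr => hR0.trans_le hr
  have hu2 : ∀ r ∈ Ici R, HasDerivAt (fun r => u r ^ 2) (2 * (u r * z r) / r) r := fun r hr => by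
    convert! (h r (hpos r hr)).1.pow 2 using 1
    push_cast
    ring
  have hz2 : ∀ r ∈ Ici R, HasDerivAt (fun r => z r ^ 2) (2 * c r * (u r * z r)) r := fun r hr => by
    convert! (h r (hpos r hr)).2.pow 2 using 1
    push_cast
    ring
  -- `(u z)' = z² / r + c u²`, and `2 u z / r` is the derivative of `u²`. So the sign of `u z`
  -- decides whether `u²` grows.
  have hy : MonotoneOn (fun r => u r * z r) (Ici R) := by
    refine monotoneOn_of_hasDerivAt (convex_Ici R)
      (fun r hr => (h r (hpos r hr)).1.mul (h r (hpos r hr)).2) fun r hr => ?_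
    have h1 : 0 ≤ z r ^ 2 / r := div_nonneg (sq_nonneg _) (hpos r hr).le
    have h2 : 0 ≤ c r * u r ^ 2 := mul_nonneg (hR r hr) (sq_nonneg _)
    calc (0 : ℝ) ≤ z r ^ 2 / r + c r * u r ^ 2 := add_nonneg h1 h2
      _ = _ := by ring
  -- Once positive, `u z` stays positive. Then `u²` is bounded below by a positive constant near
  -- infinity, against integrability.
  have hyneg : ∀ r ∈ Ici R, u r * z r ≤ 0 := by
    intro r1 hr1
    by_contra! hcon
    have hm : MonotoneOn (fun r => u r ^ 2) (Ici r1) := by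
      refine monotoneOn_of_hasDerivAt (convex_Ici r1)
        (fun r hr => hu2 r (Ici_subset_Ici.2 hr1 hr)) fun r hr => ?_
      have hr' : r ∈ Ici R := Ici_subset_Ici.2 hr1 hr
      have : u r1 * z r1 ≤ u r * z r := hy hr1 hr' hr
      exact div_nonneg (by linarith) (hpos r hr').le
    have hu1 : u r1 ≠ 0 := by
      rintro h0
      simp [h0] at hcon
    have hbig : IntegrableOn (fun _ : ℝ => u r1 ^ 2) (Ioi (r1 ^ 2)) := by
      refine Integrable.mono' (hint.mono_set (Ioi_subset_Ioi (sq_nonneg r1)))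
        (by fun_prop) ?_
      refine (ae_restrict_iff' measurableSet_Ioi).2 (ae_of_all _ fun ρ hρ => ?_)
      rw [Real.norm_of_nonneg (sq_nonneg _)]
      exact hm self_mem_Ici (Real.le_sqrt_of_sq_le (le_of_lt hρ))
        (Real.le_sqrt_of_sq_le (le_of_lt hρ))
    rw [integrableOn_const_iff] at hbig
    simp [hu1] at hbig
  have hua : AntitoneOn (fun r => u r ^ 2) (Ici R) :=
    antitoneOn_of_hasDerivAt (convex_Ici R) hu2 fun r hr =>
      div_nonpos_of_nonpos_of_nonneg (by linarith [hyneg r hr]) (hpos r hr).le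
  have hza : AntitoneOn (fun r => z r ^ 2) (Ici R) :=
    antitoneOn_of_hasDerivAt (convex_Ici R) hz2 fun r hr =>
      mul_nonpos_of_nonneg_of_nonpos (by linarith [hR r hr]) (hyneg r hr)
  have hru : Tendsto (fun r => r * u r) atTop (𝓝 0) := by
    have hG : AntitoneOn (fun ρ => u (√ρ) ^ 2) (Ici (R ^ 2)) := fun x hx y hy hxy =>
      hua (Real.le_sqrt_of_sq_le hx) (Real.le_sqrt_of_sq_le hy) (Real.sqrt_le_sqrt hxy)
    have h1 := (tendsto_id_mul_of_antitoneOn hG (fun x => sq_nonneg _) hint).comp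
      (tendsto_pow_atTop (α := ℝ) two_ne_zero)
    have h2 : Tendsto (fun r => (r * u r) ^ 2) atTop (𝓝 0) := by
      refine h1.congr' ?_
      filter_upwards [eventually_ge_atTop 0] with r hr
      simp only [Function.comp_apply, Real.sqrt_sq hr]
      ring
    have h3 := (Real.continuous_sqrt.tendsto 0).comp h2
    rw [Real.sqrt_zero] at h3
    rw [tendsto_zero_iff_abs_tendsto_zero]
    exact h3.congr fun r => Real.sqrt_sq_eq_abs _
  have hu : Tendsto u atTop (𝓝 0) := by
    have := hru.mul tendsto_inv_atTop_zero
    rw [zero_mul] at this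
    refine this.congr' ?_
    filter_upwards [eventually_gt_atTop 0] with r hr
    field_simp
  refine ⟨hru, ?_⟩
  -- The mean value theorem on `[r, 2r]` gives a point `ξ` with `|z(ξ)| ≤ 2 |u(2r) - u(r)|`, and
  -- `z²` is decreasing, so the same bound holds for `z(2r)`.
  have hz : Tendsto (fun r => 2 * |u (2 * r) - u r|) atTop (𝓝 0) := by
    have h2 : Tendsto (fun r : ℝ => 2 * r) atTop atTop :=
      tendsto_id.const_mul_atTop (by norm_num)
    simpa using (((hu.comp h2).sub hu).abs).const_mul 2
  have hz' : Tendsto (fun r => z (2 * r)) atTop (𝓝 0) := by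
    refine squeeze_zero_norm' ?_ hz
    filter_upwards [eventually_ge_atTop R] with r hr
    have hr0 := hpos r hr
    obtain ⟨ξ, hξ, he⟩ := exists_hasDerivAt_eq_slope u (fun r => z r / r)
      (show r < 2 * r by linarith)
      (fun x hx => (h x (hr0.trans_le hx.1)).1.continuousAt.continuousWithinAt)
      (fun x hx => (h x (hr0.trans hx.1)).1)
    have hξ0 : 0 < ξ := hr0.trans hξ.1
    have h3 : z (2 * r) ^ 2 ≤ z ξ ^ 2 :=
      hza (hr.trans hξ.1.le) (show R ≤ 2 * r by linarith) hξ.2.le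
    have h4 : |z (2 * r)| ≤ |z ξ| := sq_le_sq.1 h3
    rw [Real.norm_eq_abs]
    refine h4.trans ?_
    have h5 : z ξ = ξ / r * (u (2 * r) - u r) := by
      rw [div_eq_iff hξ0.ne'] at he
      rw [he]
      have : 2 * r - r = r := by ring
      rw [this]
      ring
    rw [h5, abs_mul, abs_of_pos (div_pos hξ0 hr0)]
    gcongr
    rw [div_le_iff₀ hr0]
    exact hξ.2.le
  have := hz'.comp (tendsto_id.atTop_div_const (show (0 : ℝ) < 2 by norm_num))
  refine this.congr fun r => ?_
  simp only [Function.comp_apply, id]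
  congr 1
  ring

/-- Uniqueness for the Cauchy problem. -/
theorem IsMode.eq_zero {c u z : ℝ → ℝ} (h : IsMode c u z) (hc : ContinuousOn c (Ioi 0))
    {r₀ : ℝ} (hr₀ : 0 < r₀) (hu : u r₀ = 0) (hz : z r₀ = 0) {r : ℝ} (hr : 0 < r) :
    u r = 0 ∧ z r = 0 := by
  set m := min r r₀ with hm
  set M := max r r₀ with hM
  have hm0 : 0 < m := lt_min hr hr₀
  have hpos : ∀ x ∈ Icc m M, 0 < x := fun x hx => hm0.trans_le hx.1
  obtain ⟨C, hC⟩ := (isCompact_Icc (a := m) (b := M)).exists_bound_of_continuousOn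
    (f := fun x => |x⁻¹ + c x|)
    ((ContinuousOn.add (continuousOn_inv₀.mono fun x hx => (hpos x hx).ne')
      (hc.mono fun x hx => hpos x hx)).abs)
  simp only [Real.norm_eq_abs, abs_abs] at hC
  -- Gronwall's argument: the derivative of `u² + z²` is at most `C (u² + z²)` in absolute value.
  -- The weights `exp (-C x)` and `exp (C x)` then propagate the zero forwards and backwards from
  -- `r₀`.
  have hd : ∀ x ∈ Icc m M, HasDerivAt (fun x => u x ^ 2 + z x ^ 2)
      (2 * ((x⁻¹ + c x) * (u x * z x))) x := fun x hx => by
    convert! ((h x (hpos x hx)).1.pow 2).add ((h x (hpos x hx)).2.pow 2) using 1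
    push_cast
    ring
  have hb : ∀ x ∈ Icc m M, |2 * ((x⁻¹ + c x) * (u x * z x))| ≤ C * (u x ^ 2 + z x ^ 2) := by
    intro x hx
    have h1 : 2 * |u x * z x| ≤ u x ^ 2 + z x ^ 2 := by
      rw [abs_mul]
      nlinarith [sq_nonneg (|u x| - |z x|), sq_abs (u x), sq_abs (z x)]
    calc |2 * ((x⁻¹ + c x) * (u x * z x))| = |x⁻¹ + c x| * (2 * |u x * z x|) := by
          rw [abs_mul, abs_mul, abs_of_pos (by norm_num : (0 : ℝ) < 2)]; ring
      _ ≤ C * (u x ^ 2 + z x ^ 2) := by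
          gcongr
          · exact (abs_nonneg _).trans (hC x hx)
          · exact hC x hx
  have hE (K x : ℝ) : HasDerivAt (fun x => Real.exp (K * x)) (Real.exp (K * x) * K) x := by
    simpa using ((hasDerivAt_id x).const_mul K).exp
  have h1 : AntitoneOn (fun x => (u x ^ 2 + z x ^ 2) * Real.exp (-C * x)) (Icc m M) :=
    antitoneOn_of_hasDerivAt (convex_Icc _ _) (fun x hx => (hd x hx).mul (hE (-C) x))
      fun x hx => by
        have := (abs_le.1 (hb x hx)).2
        nlinarith [Real.exp_pos (-C * x)]
  have h2 : MonotoneOn (fun x => (u x ^ 2 + z x ^ 2) * Real.exp (C * x)) (Icc m M) :=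
    monotoneOn_of_hasDerivAt (convex_Icc _ _) (fun x hx => (hd x hx).mul (hE C x))
      fun x hx => by
        have := (abs_le.1 (hb x hx)).1
        nlinarith [Real.exp_pos (C * x)]
  have hrI : r ∈ Icc m M := ⟨min_le_left _ _, le_max_left _ _⟩
  have hr₀I : r₀ ∈ Icc m M := ⟨min_le_right _ _, le_max_right _ _⟩
  have key : u r ^ 2 + z r ^ 2 ≤ 0 := by
    rcases le_total r₀ r with hle | hle
    · have := h1 hr₀I hrI hle
      simp only [hu, hz] at this
      have he := Real.exp_pos (-C * r)
      by_contra! hcon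
      have := mul_pos hcon he
      simp at *
      linarith
    · have := h2 hrI hr₀I hle
      simp only [hu, hz] at this
      have he := Real.exp_pos (C * r)
      by_contra! hcon
      have := mul_pos hcon he
      simp at *
      linarith
  constructor
  · nlinarith [sq_nonneg (u r), sq_nonneg (z r)]
  · nlinarith [sq_nonneg (u r), sq_nonneg (z r)]

/-- A Sturm comparison principle: if `W' = -β η` with `β > 0` and `η W ≤ 0`, then `W²` is
increasing, so that `η = 0` if `W` vanishes at infinity. -/
theorem comparison_eq_zero {η W β : ℝ → ℝ} {A : ℝ}
    (hW : ∀ r, A < r → HasDerivAt W (-(β r * η r)) r)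
    (hβ : ∀ r, A < r → 0 < β r)
    (hE : ∀ r, A < r → η r * W r ≤ 0) (hlim : Tendsto W atTop (𝓝 0)) :
    ∀ r, A < r → η r = 0 := by
  -- `(W²)' = -2 β η W ≥ 0`. A nondecreasing square with limit `0` vanishes identically, and then `β
  -- η = -W' = 0`.
  have hm : MonotoneOn (fun r => W r ^ 2) (Ioi A) := by
    refine monotoneOn_of_hasDerivAt (convex_Ioi A) (fun r hr => (hW r hr).pow 2) fun r hr => ?_
    have := mul_nonneg (hβ r hr).le (neg_nonneg.2 (hE r hr))
    push_cast
    nlinarith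
  have hW0 : ∀ r, A < r → W r = 0 := by
    intro r hr
    have h1 : W r ^ 2 ≤ 0 := by
      refine ge_of_tendsto (by simpa using hlim.pow 2) ?_
      filter_upwards [eventually_ge_atTop r] with s hs
      exact hm hr (lt_of_lt_of_le hr hs) hs
    nlinarith [sq_nonneg (W r)]
  intro r hr
  have h1 : HasDerivAt W 0 r := by
    refine (hasDerivAt_const r (0 : ℝ)).congr_of_eventuallyEq ?_
    filter_upwards [Ioi_mem_nhds hr] with s hs using hW0 s hs
  have := (hW r hr).unique h1
  have hb := hβ r hr
  have : β r * η r = 0 := by linarith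
  rcases mul_eq_zero.1 this with h | h
  · exact absurd h hb.ne'
  · exact h

/-- If `η' = -α W` and `W' = -β η` with `α, β > 0` and `W → 0` at `0`, then `η W ≤ 0`. -/
theorem comparison_nonpos_of_tendsto_zero {η W α β : ℝ → ℝ}
    (hη : ∀ r, 0 < r → HasDerivAt η (-(α r * W r)) r)
    (hW : ∀ r, 0 < r → HasDerivAt W (-(β r * η r)) r)
    (hα : ∀ r, 0 < r → 0 < α r) (hβ : ∀ r, 0 < r → 0 < β r)
    (h0 : Tendsto W (𝓝[>] 0) (𝓝 0)) :
    ∀ r, 0 < r → η r * W r ≤ 0 := by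
  intro r hr
  by_contra! hcon
  have hE : AntitoneOn (fun r => η r * W r) (Ioi 0) := by
    refine antitoneOn_of_hasDerivAt (convex_Ioi 0) (fun r hr => (hη r hr).mul (hW r hr))
      fun r hr => ?_
    have h1 := mul_nonneg (hα r hr).le (sq_nonneg (W r))
    have h2 := mul_nonneg (hβ r hr).le (sq_nonneg (η r))
    nlinarith
  -- Since `η W` decreases, positivity at `r` gives positivity on all of `(0, r]`, where `W²` is
  -- then nonincreasing. As `W` starts from `0` at the origin, this forces `W r = 0`.
  have hm : AntitoneOn (fun r => W r ^ 2) (Ioc 0 r) := by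
    refine antitoneOn_of_hasDerivAt (convex_Ioc 0 r) (fun s hs => (hW s hs.1).pow 2) fun s hs => ?_
    have := hE hs.1 hr hs.2
    have := mul_nonneg (hβ s hs.1).le (hcon.le.trans this)
    push_cast
    nlinarith
  have h1 : W r ^ 2 ≤ 0 := by
    refine ge_of_tendsto (by simpa using h0.pow 2) ?_
    filter_upwards [Ioc_mem_nhdsGT hr] with s hs
    exact hm hs ⟨hr, le_rfl⟩ hs.2
  have : W r = 0 := by nlinarith [sq_nonneg (W r)]
  simp [this] at hcon

/-! ### Radial profiles of ground states -/

/-- `q` is the profile of a square integrable, radially decreasing solution of `-Δu = f(u)`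
in the plane with `0 < u < a`, and `p = q'`. -/
structure IsProfile (f f' : ℝ → ℝ) (a b : ℝ) (q p : ℝ → ℝ) : Prop where
  bistable : Bistable f f' a b
  range : ∀ r, 0 < r → q r ∈ Ioo 0 a
  hasDerivAt_q : ∀ r, 0 < r → HasDerivAt q (p r) r
  hasDerivAt_p : ∀ r, 0 < r → HasDerivAt p (-p r / r - f (q r)) r
  p_nonpos : ∀ r, 0 < r → p r ≤ 0
  p_bound : ∃ C, ∀ r, 0 < r → r ≤ 1 → |p r| ≤ C * r
  integrableOn : IntegrableOn (fun ρ => q (√ρ) ^ 2) (Ioi 0)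

/-- The coefficient `k²/r - r f'(q)` of the linearized equation at angular momentum `k`. -/
noncomputable def modeCoeff (f' q : ℝ → ℝ) (k : ℕ) (r : ℝ) : ℝ := k ^ 2 / r - r * f' (q r)

/-- `r p'(r)`, expressed through the equation. -/
def profileZ (f q p : ℝ → ℝ) (r : ℝ) : ℝ := -p r - r * f (q r)

section Profile

variable {f f' q p : ℝ → ℝ} {a b : ℝ}

theorem IsProfile.hasDerivAt_fq (h : IsProfile f f' a b q p) {r : ℝ} (hr : 0 < r) :
    HasDerivAt (fun r => f (q r)) (f' (q r) * p r) r :=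
  (h.bistable.hasDerivAt (q r)).comp r (h.hasDerivAt_q r hr)

/-- Differentiating `q'' + q'/r + f(q) = 0` in `r` produces the term `1/r²` of angular momentum one.
This reflects translation invariance: `∂₁Q = q'(r) cos θ`. -/
theorem IsProfile.isMode_p (h : IsProfile f f' a b q p) :
    IsMode (modeCoeff f' q 1) p (profileZ f q p) := fun r hr => by
  constructor
  · convert! h.hasDerivAt_p r hr using 1
    simp only [profileZ]
    field_simp
  · convert! (h.hasDerivAt_p r hr).neg.sub ((hasDerivAt_id r).mul (h.hasDerivAt_fq hr)) using 1
    simp only [modeCoeff, id]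
    field_simp
    push_cast
    ring

theorem IsProfile.continuousOn_modeCoeff (h : IsProfile f f' a b q p) (k : ℕ) :
    ContinuousOn (modeCoeff f' q k) (Ioi 0) := by
  have hq : ContinuousOn q (Ioi 0) := fun r hr =>
    (h.hasDerivAt_q r hr).continuousAt.continuousWithinAt
  refine ContinuousOn.sub (continuousOn_const.div continuousOn_id fun r hr => ne_of_gt hr)
    (continuousOn_id.mul (h.bistable.continuous_deriv.comp_continuousOn hq))

theorem IsProfile.q_antitone (h : IsProfile f f' a b q p) : AntitoneOn q (Ioi 0) :=
  antitoneOn_of_hasDerivAt (convex_Ioi 0) h.hasDerivAt_q h.p_nonpos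

theorem IsProfile.tendsto_id_mul_q (h : IsProfile f f' a b q p) :
    Tendsto (fun r => r * q r) atTop (𝓝 0) := by
  have hG : AntitoneOn (fun ρ => q (√ρ) ^ 2) (Ici 1) := fun x hx y hy hxy => by
    have hx0 : 0 < √x := Real.sqrt_pos.2 (lt_of_lt_of_le one_pos hx)
    have hy0 : 0 < √y := Real.sqrt_pos.2 (lt_of_lt_of_le one_pos hy)
    have := h.q_antitone hx0 hy0 (Real.sqrt_le_sqrt hxy)
    have := (h.range _ hy0).1
    simp only
    gcongr
  have h1 := (tendsto_id_mul_of_antitoneOn hG (fun x => sq_nonneg _) h.integrableOn).comp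
    (tendsto_pow_atTop (α := ℝ) two_ne_zero)
  have h2 : Tendsto (fun r => (r * q r) ^ 2) atTop (𝓝 0) := by
    refine h1.congr' ?_
    filter_upwards [eventually_ge_atTop 0] with r hr
    simp only [Function.comp_apply, Real.sqrt_sq hr]
    ring
  have h3 := (Real.continuous_sqrt.tendsto 0).comp h2
  rw [Real.sqrt_zero] at h3
  rw [tendsto_zero_iff_abs_tendsto_zero]
  exact h3.congr fun r => Real.sqrt_sq_eq_abs _

theorem tendsto_zero_of_id_mul {u : ℝ → ℝ} (h : Tendsto (fun r => r * u r) atTop (𝓝 0)) :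
    Tendsto u atTop (𝓝 0) := by
  have := h.mul tendsto_inv_atTop_zero
  rw [zero_mul] at this
  refine this.congr' ?_
  filter_upwards [eventually_gt_atTop 0] with r hr
  field_simp

theorem IsProfile.tendsto_q (h : IsProfile f f' a b q p) : Tendsto q atTop (𝓝 0) :=
  tendsto_zero_of_id_mul h.tendsto_id_mul_q

/-- A zero of `p ≤ 0` is a maximum, so `p` and `r p'` vanish there together. Uniqueness for the
linear equation gives `p = 0` everywhere, and a constant positive `q` does not decay. -/
theorem IsProfile.p_neg (h : IsProfile f f' a b q p) {r : ℝ} (hr : 0 < r) : p r < 0 := by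
  refine lt_of_le_of_ne (h.p_nonpos r hr) fun h0 => ?_
  have hmax : IsLocalMax p r := by
    filter_upwards [Ioi_mem_nhds hr] with s hs
    rw [h0]
    exact h.p_nonpos s hs
  have hz : profileZ f q p r = 0 := by
    have := hmax.hasDerivAt_eq_zero (h.isMode_p r hr).1
    rwa [div_eq_zero_iff, or_iff_left hr.ne'] at this
  have hp : ∀ s, 0 < s → p s = 0 := fun s hs =>
    (h.isMode_p.eq_zero (h.continuousOn_modeCoeff 1) hr h0 hz hs).1
  have hm : MonotoneOn q (Ioi 0) :=
    monotoneOn_of_hasDerivAt (convex_Ioi 0) h.hasDerivAt_q fun s hs => (hp s hs).ge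
  have : q r ≤ 0 := by
    refine ge_of_tendsto h.tendsto_q ?_
    filter_upwards [eventually_ge_atTop r] with s hs
    exact hm hr (lt_of_lt_of_le hr hs) hs
  linarith [(h.range r hr).1]

theorem IsProfile.q_strictAnti (h : IsProfile f f' a b q p) : StrictAntiOn q (Ioi 0) :=
  strictAntiOn_of_hasDerivAt (convex_Ioi 0) h.hasDerivAt_q
    fun _ hr => h.p_neg (interior_subset hr)

/-- At infinity `f'(q)` tends to `f'(0) < 0`. -/
theorem IsProfile.eventually_modeCoeff_nonneg (h : IsProfile f f' a b q p) (k : ℕ) :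
    ∀ᶠ r in atTop, 0 ≤ modeCoeff f' q k r := by
  have h1 : Tendsto (fun r => f' (q r)) atTop (𝓝 (f' 0)) :=
    (h.bistable.continuous_deriv.tendsto 0).comp h.tendsto_q
  filter_upwards [h1.eventually (gt_mem_nhds h.bistable.deriv_zero), eventually_gt_atTop 0]
    with r hr hr0
  have h2 : 0 ≤ r * -f' (q r) := mul_nonneg hr0.le (by linarith)
  have h3 : (0 : ℝ) ≤ k ^ 2 / r := by positivity
  unfold modeCoeff
  linarith

/-- The nonlinear equation is read as a linear one for `q`, with coefficient `-r f(q) / q`. It is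
nonnegative once `q < b`, so the decay lemma applies with `z = r p`. -/
theorem IsProfile.tendsto_id_mul_p (h : IsProfile f f' a b q p) :
    Tendsto (fun r => r * p r) atTop (𝓝 0) := by
  have hm : IsMode (fun r => -(r * f (q r)) / q r) q (fun r => r * p r) := fun r hr => by
    constructor
    · convert! h.hasDerivAt_q r hr using 1
      field_simp
    · convert! (hasDerivAt_id r).mul (h.hasDerivAt_p r hr) using 1
      have := (h.range r hr).1.ne'
      simp only [id]
      field_simp
      ring
  refine (hm.tendsto_atTop ?_ h.integrableOn).2
  filter_upwards [h.tendsto_q.eventually (gt_mem_nhds h.bistable.b_pos), eventually_gt_atTop 0]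
    with r hr hr0
  have hq := (h.range r hr0).1
  have := h.bistable.neg _ hq hr
  refine div_nonneg ?_ hq.le
  have := mul_nonneg hr0.le (neg_nonneg.2 this.le)
  linarith

theorem IsProfile.tendsto_id_mul_fq (h : IsProfile f f' a b q p) :
    Tendsto (fun r => r * f (q r)) atTop (𝓝 0) := by
  have h1 : (fun r => f (q r)) =O[atTop] q := by
    have := (h.bistable.hasDerivAt 0).isBigO_sub
    simp only [h.bistable.map_zero, sub_zero] at this
    exact this.comp_tendsto h.tendsto_q
  exact (((Asymptotics.isBigO_refl (fun r : ℝ => r) atTop).mul h1).trans_tendsto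
    h.tendsto_id_mul_q)

theorem IsProfile.tendsto_profileZ (h : IsProfile f f' a b q p) :
    Tendsto (profileZ f q p) atTop (𝓝 0) := by
  simpa [profileZ] using!
    (tendsto_zero_of_id_mul h.tendsto_id_mul_p).neg.sub h.tendsto_id_mul_fq

theorem IsProfile.exists_bound_fq (h : IsProfile f f' a b q p) :
    ∃ C, ∀ r, 0 < r → |f (q r)| ≤ C := by
  obtain ⟨C, hC⟩ := (isCompact_Icc (a := (0 : ℝ)) (b := a)).exists_bound_of_continuousOn (f := f)
    (fun s _ => (h.bistable.hasDerivAt s).continuousAt.continuousWithinAt)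
  exact ⟨C, fun r hr => hC _ (Ioo_subset_Icc_self (h.range r hr))⟩

theorem IsProfile.exists_bound_profileZ (h : IsProfile f f' a b q p) :
    ∃ C, ∀ r, 0 < r → r ≤ 1 → |profileZ f q p r| ≤ C * r := by
  obtain ⟨C, hC⟩ := h.p_bound
  obtain ⟨D, hD⟩ := h.exists_bound_fq
  refine ⟨C + D, fun r hr hr1 => ?_⟩
  calc |profileZ f q p r| ≤ |-p r| + |r * f (q r)| := abs_sub _ _
    _ ≤ C * r + r * D := by
        rw [abs_neg, abs_mul, abs_of_pos hr]
        gcongr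
        · exact hC r hr hr1
        · exact hD r hr
    _ = (C + D) * r := by ring

/-- This makes Wronskians vanish at the origin: `p` and `profileZ` are `O(r)`, while a mode is only
known to satisfy `r u → 0` and `r z → 0`. -/
theorem tendsto_mul_of_bound {u v : ℝ → ℝ} {C : ℝ} (hu : ∀ r, 0 < r → r ≤ 1 → |u r| ≤ C * r)
    (hv : Tendsto (fun r => r * v r) (𝓝[>] 0) (𝓝 0)) :
    Tendsto (fun r => u r * v r) (𝓝[>] 0) (𝓝 0) := by
  have h1 : Tendsto (fun r => C * |r * v r|) (𝓝[>] 0) (𝓝 0) := by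
    simpa using hv.abs.const_mul C
  refine squeeze_zero_norm' ?_ h1
  filter_upwards [Ioc_mem_nhdsGT (zero_lt_one (α := ℝ))] with r hr
  rw [Real.norm_eq_abs, abs_mul, abs_mul, abs_of_pos hr.1, ← mul_assoc]
  gcongr
  exact hu r hr.1 hr.2

/-! ### Non-radial modes -/

/-- The coefficients at angular momenta `k` and `1` differ by `(k² - 1) / r`; the potential terms
cancel. -/
theorem IsProfile.hasDerivAt_wronskian (h : IsProfile f f' a b q p) {k : ℕ} {u z : ℝ → ℝ}
    (hm : IsMode (modeCoeff f' q k) u z) {r : ℝ} (hr : 0 < r) :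
    HasDerivAt (fun r => p r * z r - profileZ f q p r * u r)
      ((k ^ 2 - 1) / r * p r * u r) r := by
  have h1 := h.isMode_p r hr
  have h2 := hm r hr
  convert! (h1.1.mul h2.2).sub (h1.2.mul h2.1) using 1
  simp only [modeCoeff]
  field_simp
  push_cast
  ring

/-- The quotient rule gives the Wronskian over `r p²`. Dividing by `-p > 0` produces the sign
pattern `η' = -α W` of the comparison lemmas. -/
theorem IsProfile.hasDerivAt_div (h : IsProfile f f' a b q p) {c u z : ℝ → ℝ}
    (hm : IsMode c u z) {r : ℝ} (hr : 0 < r) :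
    HasDerivAt (fun r => u r / -p r)
      (-(1 / (r * p r ^ 2) * (p r * z r - profileZ f q p r * u r))) r := by
  have hp := (h.p_neg hr).ne
  convert! (hm r hr).1.div (h.isMode_p r hr).1.neg (neg_ne_zero.2 hp) using 1
  simp only [Pi.neg_apply]
  field_simp
  ring

theorem IsProfile.tendsto_wronskian_atTop (h : IsProfile f f' a b q p) {u z : ℝ → ℝ}
    (hu : Tendsto (fun r => r * u r) atTop (𝓝 0)) (hz : Tendsto z atTop (𝓝 0)) :
    Tendsto (fun r => p r * z r - profileZ f q p r * u r) atTop (𝓝 0) := by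
  simpa using ((tendsto_zero_of_id_mul h.tendsto_id_mul_p).mul hz).sub
    (h.tendsto_profileZ.mul (tendsto_zero_of_id_mul hu))

/-- There are no bound states at angular momentum `k ≥ 2`. -/
theorem IsProfile.eq_zero_of_two_le (h : IsProfile f f' a b q p) {k : ℕ} (hk : 2 ≤ k)
    {u z : ℝ → ℝ} (hm : IsMode (modeCoeff f' q k) u z)
    (hint : IntegrableOn (fun ρ => u (√ρ) ^ 2) (Ioi 0))
    (hu0 : Tendsto (fun r => r * u r) (𝓝[>] 0) (𝓝 0))
    (hz0 : Tendsto (fun r => r * z r) (𝓝[>] 0) (𝓝 0)) {r : ℝ} (hr : 0 < r) : u r = 0 := by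
  obtain ⟨hu, hz⟩ := hm.tendsto_atTop (h.eventually_modeCoeff_nonneg k) hint
  have hk1 : (0 : ℝ) < k ^ 2 - 1 := by
    have : (2 : ℝ) ≤ k := by exact_mod_cast hk
    nlinarith
  have hη : ∀ r, 0 < r → HasDerivAt (fun r => u r / -p r)
      (-(1 / (r * p r ^ 2) * (p r * z r - profileZ f q p r * u r))) r :=
    fun r hr => h.hasDerivAt_div hm hr
  -- With `η = u / (-p)` the pair satisfies `η' = -α W` and `W' = -β η`, where `β = (k² - 1) p² / r`
  -- is positive exactly because `k ≥ 2`.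
  have hW : ∀ r, 0 < r → HasDerivAt (fun r => p r * z r - profileZ f q p r * u r)
      (-((k ^ 2 - 1) / r * p r ^ 2 * (u r / -p r))) r := fun r hr => by
    convert! h.hasDerivAt_wronskian hm hr using 1
    have := (h.p_neg hr).ne
    field_simp
  have hα : ∀ r, 0 < r → 0 < 1 / (r * p r ^ 2) := fun r hr => by
    have := (h.p_neg hr).ne
    positivity
  have hβ : ∀ r, 0 < r → 0 < (k ^ 2 - 1) / r * p r ^ 2 := fun r hr => by
    have := (h.p_neg hr).ne
    positivity
  have h0 : Tendsto (fun r => p r * z r - profileZ f q p r * u r) (𝓝[>] 0) (𝓝 0) := by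
    obtain ⟨C, hC⟩ := h.p_bound
    obtain ⟨D, hD⟩ := h.exists_bound_profileZ
    simpa using (tendsto_mul_of_bound hC hz0).sub (tendsto_mul_of_bound hD hu0)
  have := comparison_eq_zero hW hβ (comparison_nonpos_of_tendsto_zero hη hW hα hβ h0)
    (h.tendsto_wronskian_atTop hu hz) r hr
  have hp := (h.p_neg hr).ne
  rcases div_eq_zero_iff.1 this with h | h
  · exact h
  · exact absurd (neg_eq_zero.1 h) hp

/-- The bound states at angular momentum `1` are the multiples of `q'`. -/
theorem IsProfile.exists_eq_mul (h : IsProfile f f' a b q p) {u z : ℝ → ℝ}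
    (hm : IsMode (modeCoeff f' q 1) u z)
    (hint : IntegrableOn (fun ρ => u (√ρ) ^ 2) (Ioi 0)) :
    ∃ c, ∀ r, 0 < r → u r = c * p r := by
  obtain ⟨hu, hz⟩ := hm.tendsto_atTop (h.eventually_modeCoeff_nonneg 1) hint
  have hconst {F : ℝ → ℝ} (hF : ∀ r, 0 < r → HasDerivAt F 0 r) {x y : ℝ} (hx : 0 < x)
      (hy : 0 < y) : F x = F y :=
    isOpen_Ioi.is_const_of_deriv_eq_zero isPreconnected_Ioi
      (fun r hr => (hF r hr).differentiableAt.differentiableWithinAt)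
      (fun r hr => (hF r hr).deriv) hx hy
  -- For `k = 1` the Wronskian is constant and tends to `0`, so `u / p` is constant.
  have hW : ∀ r, 0 < r → p r * z r - profileZ f q p r * u r = 0 := fun r hr => by
    have h1 : Tendsto (fun r => p r * z r - profileZ f q p r * u r) atTop
        (𝓝 (p r * z r - profileZ f q p r * u r)) := by
      refine tendsto_const_nhds.congr' ?_
      filter_upwards [eventually_gt_atTop 0] with s hs
      refine hconst (F := fun r => p r * z r - profileZ f q p r * u r) (fun r hr => ?_) hr hs
      convert! h.hasDerivAt_wronskian hm hr using 1
      simp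
    exact tendsto_nhds_unique h1 (h.tendsto_wronskian_atTop hu hz)
  refine ⟨-(u 1 / -p 1), fun r hr => ?_⟩
  have := hconst (F := fun r => u r / -p r) (fun r hr => by
    convert! h.hasDerivAt_div hm hr using 1
    rw [hW r hr]
    simp) hr one_pos
  rw [← this]
  have := (h.p_neg hr).ne
  field_simp

end Profile

/-! ### Radial non-degeneracy -/

/-- The infimum of the closed zero set is a zero. The intermediate value theorem excludes a change
of sign before it. -/
theorem exists_first_zero {δ : ℝ → ℝ} {A : ℝ} (hc : ContinuousOn δ (Ici A)) (hA : 0 < δ A)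
    (hz : ∃ r, A ≤ r ∧ δ r = 0) :
    ∃ r, A < r ∧ δ r = 0 ∧ ∀ s, A ≤ s → s < r → 0 < δ s := by
  obtain ⟨t, hAt, ht⟩ := hz
  set S := Ici A ∩ δ ⁻¹' {0} with hS
  have hcl : IsClosed S := hc.preimage_isClosed_of_isClosed isClosed_Ici isClosed_singleton
  have hbd : BddBelow S := ⟨A, fun x hx => hx.1⟩
  have hmem : sInf S ∈ S := hcl.csInf_mem ⟨t, hAt, ht⟩ hbd
  have hlt : A < sInf S := lt_of_le_of_ne hmem.1 fun he => by
    have := hmem.2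
    rw [← he] at this
    exact hA.ne' this
  refine ⟨sInf S, hlt, hmem.2, fun s hs hsr => ?_⟩
  by_contra! hneg
  obtain ⟨x, hx, hx0⟩ := intermediate_value_Icc' hs (hc.mono Icc_subset_Ici_self)
    ⟨hneg, hA.le⟩
  exact absurd (csInf_le hbd (⟨hx.1, hx0⟩ : x ∈ S)) (by linarith [hx.2])

theorem deriv_nonpos_of_pos_left {δ : ℝ → ℝ} {d A r : ℝ} (hd : HasDerivAt δ d r) (hA : A < r)
    (h0 : δ r = 0) (hpos : ∀ s, A < s → s < r → 0 < δ s) : d ≤ 0 := by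
  have h1 := (hasDerivWithinAt_iff_tendsto_slope' (s := Iio r) (by simp)).1
    hd.hasDerivWithinAt
  refine le_of_tendsto h1 ?_
  filter_upwards [Ioo_mem_nhdsLT hA] with s hs
  rw [slope_def_field, h0]
  exact div_nonpos_of_nonneg_of_nonpos (by linarith [hpos s hs.1 hs.2]) (by linarith [hs.2])

theorem eventually_neg_of_deriv_neg {δ : ℝ → ℝ} {d r : ℝ} (hd : HasDerivAt δ d r)
    (h0 : δ r = 0) (hneg : d < 0) : ∃ A, r < A ∧ ∀ s, r < s → s ≤ A → δ s < 0 := by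
  have h1 := (hasDerivWithinAt_iff_tendsto_slope' (s := Ioi r) (by simp)).1
    hd.hasDerivWithinAt
  obtain ⟨A, hA, h⟩ := (mem_nhdsGT_iff_exists_Ioc_subset).1 (h1.eventually (gt_mem_nhds hneg))
  refine ⟨A, hA, fun s hs hsA => ?_⟩
  have := h ⟨hs, hsA⟩
  rw [mem_ofPred_eq, slope_def_field, h0, sub_zero, div_lt_iff₀ (by linarith)] at this
  linarith

section Profile

variable {f f' q p : ℝ → ℝ} {a b : ℝ}

theorem modeCoeff_zero (f' q : ℝ → ℝ) (r : ℝ) : modeCoeff f' q 0 r = -(r * f' (q r)) := by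
  simp [modeCoeff]

/-- The Wronskian with `q`. -/
theorem IsProfile.hasDerivAt_wronskian_q (h : IsProfile f f' a b q p) {δ z : ℝ → ℝ}
    (hm : IsMode (modeCoeff f' q 0) δ z) {r : ℝ} (hr : 0 < r) :
    HasDerivAt (fun r => r * p r * δ r - q r * z r)
      (r * δ r * (q r * f' (q r) - f (q r))) r := by
  have h2 := hm r hr
  convert! (((hasDerivAt_id r).mul (h.hasDerivAt_p r hr)).mul h2.1).sub
    ((h.hasDerivAt_q r hr).mul h2.2) using 1
  simp only [modeCoeff_zero, id, Pi.mul_apply]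
  field_simp
  ring

/-- The Wronskian with the generator `r q'` of dilations. -/
theorem IsProfile.hasDerivAt_wronskian_dilation (h : IsProfile f f' a b q p) {δ z : ℝ → ℝ}
    (hm : IsMode (modeCoeff f' q 0) δ z) {r : ℝ} (hr : 0 < r) :
    HasDerivAt (fun r => -(r ^ 2 * f (q r)) * δ r - r * p r * z r)
      (r * δ r * (-2 * f (q r))) r := by
  -- The `z`-component of `r p` is `r (r p)' = -r² f(q)`, by the equation of the profile.
  have h2 := hm r hr
  convert! ((((hasDerivAt_id r).pow 2).mul (h.hasDerivAt_fq hr)).neg.mul h2.1).sub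
    (((hasDerivAt_id r).mul (h.hasDerivAt_p r hr)).mul h2.2) using 1
  simp only [modeCoeff_zero, id, Pi.mul_apply, Pi.neg_apply, Pi.pow_apply]
  field_simp
  push_cast
  ring

theorem IsProfile.tendsto_wronskian_q (h : IsProfile f f' a b q p) {δ z : ℝ → ℝ}
    (hu : Tendsto (fun r => r * δ r) atTop (𝓝 0)) (hz : Tendsto z atTop (𝓝 0)) :
    Tendsto (fun r => r * p r * δ r - q r * z r) atTop (𝓝 0) := by
  simpa using (h.tendsto_id_mul_p.mul (tendsto_zero_of_id_mul hu)).sub (h.tendsto_q.mul hz)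

theorem IsProfile.tendsto_wronskian_dilation (h : IsProfile f f' a b q p) {δ z : ℝ → ℝ}
    (hu : Tendsto (fun r => r * δ r) atTop (𝓝 0)) (hz : Tendsto z atTop (𝓝 0)) :
    Tendsto (fun r => -(r ^ 2 * f (q r)) * δ r - r * p r * z r) atTop (𝓝 0) := by
  have := (h.tendsto_id_mul_fq.neg.mul hu).sub (h.tendsto_id_mul_p.mul hz)
  simp only [neg_zero, mul_zero, sub_zero] at this
  refine this.congr fun r => ?_
  ring

/-- A decaying solution of the linearized radial equation which vanishes at a point where
`q ≤ b` vanishes from there on: `-r q'` is a strict supersolution. -/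
theorem IsProfile.eq_zero_of_zero_of_le (h : IsProfile f f' a b q p) {δ z : ℝ → ℝ}
    (hm : IsMode (modeCoeff f' q 0) δ z)
    (hu : Tendsto (fun r => r * δ r) atTop (𝓝 0)) (hz : Tendsto z atTop (𝓝 0))
    {r₁ : ℝ} (hr₁ : 0 < r₁) (h0 : δ r₁ = 0) (hq : q r₁ ≤ b) :
    z r₁ = 0 := by
  -- The sign is chosen so that `η = δ / (-r p)` satisfies `η' = -α W` and `W' = -β η` with `β = 2
  -- r² f(q) p`. This is nonnegative where `q ≤ b`, since `f(q) ≤ 0` and `p < 0`.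
  set W : ℝ → ℝ := fun r => -(-(r ^ 2 * f (q r)) * δ r - r * p r * z r) with hWdef
  have hfneg : ∀ r, r₁ ≤ r → f (q r) ≤ 0 := fun r hr => by
    have hr0 := hr₁.trans_le hr
    rcases (h.q_antitone hr₁ hr0 hr).trans hq |>.lt_or_eq with hlt | heq
    · exact (h.bistable.neg _ (h.range r hr0).1 hlt).le
    · rw [heq, h.bistable.map_b]
  have hη : ∀ r, 0 < r → HasDerivAt (fun r => δ r / -(r * p r))
      (-(1 / (r * (r * p r) ^ 2) * W r)) r := fun r hr => by
    have hp := (h.p_neg hr).ne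
    convert! (hm r hr).1.div ((hasDerivAt_id r).mul (h.hasDerivAt_p r hr)).neg
      (neg_ne_zero.2 (mul_ne_zero hr.ne' hp)) using 1
    simp only [Pi.neg_apply, Pi.mul_apply, id, hWdef]
    field_simp
    ring
  have hW : ∀ r, 0 < r → HasDerivAt W
      (-(2 * r ^ 2 * (f (q r) * p r) * (δ r / -(r * p r)))) r := fun r hr => by
    have hp := (h.p_neg hr).ne
    convert! (h.hasDerivAt_wronskian_dilation hm hr).neg using 1
    field_simp
  -- `η W` is decreasing and starts from `0` at `r₁`, because `δ r₁ = 0`.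
  have hE : ∀ r, r₁ ≤ r → δ r / -(r * p r) * W r ≤ 0 := fun r hr => by
    have : AntitoneOn (fun r => δ r / -(r * p r) * W r) (Ici r₁) := by
      refine antitoneOn_of_hasDerivAt (convex_Ici _)
        (fun r hr => (hη r (hr₁.trans_le hr)).mul (hW r (hr₁.trans_le hr))) fun r hr => ?_
      have hr0 := hr₁.trans_le hr
      have h1 : 0 ≤ 1 / (r * (r * p r) ^ 2) * W r ^ 2 := by positivity
      have h2 : 0 ≤ 2 * r ^ 2 * (f (q r) * p r) * (δ r / -(r * p r)) ^ 2 := by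
        have := mul_nonneg_of_nonpos_of_nonpos (hfneg r hr) (h.p_neg hr0).le
        positivity
      nlinarith
    have := this self_mem_Ici hr hr
    simpa [h0] using this
  have hδ : ∀ r, r₁ < r → δ r = 0 := fun r hr => by
    have := comparison_eq_zero (A := r₁) (fun r hr => hW r (hr₁.trans hr)) (fun r hr => ?_)
      (fun r hr => hE r (le_of_lt hr)) ?_ r hr
    · rcases div_eq_zero_iff.1 this with h1 | h1
      · exact h1
      · exact absurd h1 (neg_ne_zero.2 (mul_ne_zero (hr₁.trans hr).ne' (h.p_neg (hr₁.trans hr)).ne))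
    · have hr0 := hr₁.trans hr
      have := mul_pos_of_neg_of_neg (h.bistable.neg _ (h.range r hr0).1
        ((h.q_strictAnti hr₁ hr0 hr).trans_le hq)) (h.p_neg hr0)
      positivity
    · simpa [hWdef] using (h.tendsto_wronskian_dilation hu hz).neg
  -- `δ` vanishes on `[r₁, ∞)`, so its right derivative `z r₁ / r₁` is zero.
  have hd := ((hm r₁ hr₁).1.hasDerivWithinAt (s := Ici r₁))
  have hd0 : HasDerivWithinAt δ 0 (Ici r₁) r₁ := by
    refine (hasDerivWithinAt_const r₁ (Ici r₁) (0 : ℝ)).congr (fun r hr => ?_) h0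
    rcases (show r₁ ≤ r from hr).eq_or_lt with rfl | hlt
    · exact h0
    · exact hδ r hlt
  have := (uniqueDiffOn_Ici r₁ r₁ self_mem_Ici).eq_deriv _ hd hd0
  rwa [div_eq_zero_iff, or_iff_left hr₁.ne'] at this

/-- The radial kernel is trivial: there is no decaying solution `δ`, regular at `0`, of the
linearized radial equation that is positive near `0`. -/
theorem IsProfile.not_pos_near_zero (h : IsProfile f f' a b q p) {δ z : ℝ → ℝ}
    (hm : IsMode (modeCoeff f' q 0) δ z)
    (hu : Tendsto (fun r => r * δ r) atTop (𝓝 0)) (hz : Tendsto z atTop (𝓝 0))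
    {C : ℝ} (hbd : ∀ r, 0 < r → r ≤ 1 → |δ r| ≤ C) (hz0 : Tendsto z (𝓝[>] 0) (𝓝 0))
    {r₀ : ℝ} (hr₀ : 0 < r₀) (hpos : ∀ r, 0 < r → r ≤ r₀ → 0 < δ r) : False := by
  have hrδ : Tendsto (fun r => r * δ r) (𝓝[>] 0) (𝓝 0) := by
    have h1 : Tendsto (fun r => C * r) (𝓝[>] 0) (𝓝 0) :=
      ((continuous_const.mul continuous_id).tendsto' 0 0 (by simp)).mono_left nhdsWithin_le_nhds
    refine squeeze_zero_norm' ?_ h1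
    filter_upwards [Ioc_mem_nhdsGT (zero_lt_one (α := ℝ))] with r hr
    rw [Real.norm_eq_abs, abs_mul, abs_of_pos hr.1, mul_comm]
    have := hbd r hr.1 hr.2
    have := hr.1
    gcongr
  have hid : Tendsto (fun r : ℝ => r) (𝓝[>] 0) (𝓝 0) := tendsto_id.mono_left nhdsWithin_le_nhds
  have hrz : Tendsto (fun r => r * z r) (𝓝[>] 0) (𝓝 0) := by simpa using hid.mul hz0
  obtain ⟨Cp, hCp⟩ := h.p_bound
  obtain ⟨Dp, hDp⟩ := h.exists_bound_profileZ
  obtain ⟨Cf, hCf⟩ := h.exists_bound_fq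
  have hWp0 : Tendsto (fun r => p r * z r - profileZ f q p r * δ r) (𝓝[>] 0) (𝓝 0) := by
    simpa using (tendsto_mul_of_bound hCp hrz).sub (tendsto_mul_of_bound hDp hrδ)
  have hpδ := tendsto_mul_of_bound hCp hrδ
  have hpz := tendsto_mul_of_bound hCp hrz
  have hqz : Tendsto (fun r => q r * z r) (𝓝[>] 0) (𝓝 0) := by
    refine squeeze_zero_norm' ?_ (by simpa using (hz0.abs.const_mul a))
    filter_upwards [self_mem_nhdsWithin] with r hr
    have := h.range r hr
    rw [Real.norm_eq_abs, abs_mul, abs_of_pos this.1]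
    gcongr
    exact this.2.le
  have hfδ : Tendsto (fun r => r * f (q r) * δ r) (𝓝[>] 0) (𝓝 0) := by
    refine tendsto_mul_of_bound (C := Cf) (fun r hr _ => ?_) hrδ
    rw [abs_mul, abs_of_pos hr, mul_comm]
    gcongr
    exact hCf r hr
  have hWq0 : Tendsto (fun r => r * p r * δ r - q r * z r) (𝓝[>] 0) (𝓝 0) := by
    have := (hid.mul hpδ).sub hqz
    simp only [mul_zero, sub_zero] at this
    exact this.congr fun r => by ring
  have hWs0 : Tendsto (fun r => -(r ^ 2 * f (q r)) * δ r - r * p r * z r) (𝓝[>] 0) (𝓝 0) := by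
    have := ((hid.mul hfδ).neg).sub (hid.mul hpz)
    simp only [mul_zero, sub_zero, neg_zero] at this
    exact this.congr fun r => by ring
  have hcont : ∀ A, 0 < A → ContinuousOn δ (Ici A) := fun A hA r hr =>
    (hm r (hA.trans_le hr)).1.continuousAt.continuousWithinAt
  have hWp : ∀ r, 0 < r → HasDerivAt (fun r => p r * z r - profileZ f q p r * δ r)
      (-(1 / r * p r * δ r)) r := fun r hr => by
    convert! h.hasDerivAt_wronskian hm hr using 1
    push_cast
    ring
  -- the first zero
  have hex : ∃ r, r₀ ≤ r ∧ δ r = 0 := by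
    by_contra! hne
    have hall : ∀ r, 0 < r → 0 < δ r := by
      intro r hr
      rcases le_or_gt r r₀ with hle | hlt
      · exact hpos r hr hle
      · by_contra! hneg
        obtain ⟨x, hx, hx0⟩ := intermediate_value_Icc' hlt.le
          ((hcont r₀ hr₀).mono Icc_subset_Ici_self) ⟨hneg, (hpos r₀ hr₀ le_rfl).le⟩
        exact hne x hx.1 hx0
    -- If `δ` had no zero, its Wronskian with `p` would increase strictly although its limits at `0`
    -- and at infinity are both `0`.
    have hmono : StrictMonoOn (fun r => p r * z r - profileZ f q p r * δ r) (Ioi 0) :=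
      strictMonoOn_of_hasDerivAt (convex_Ioi 0) hWp fun r hr => by
        have hr : 0 < r := interior_subset hr
        have := mul_pos (mul_pos (one_div_pos.2 hr) (neg_pos.2 (h.p_neg hr))) (hall r hr)
        linarith
    have h1 := pos_of_strictMonoOn_Ioc one_pos (hmono.mono Ioc_subset_Ioi_self) hWp0
    have h2 := ge_of_tendsto (h.tendsto_wronskian_atTop hu hz)
      (b := p 1 * z 1 - profileZ f q p 1 * δ 1) (by
        filter_upwards [eventually_ge_atTop 1] with s hs
        exact hmono.monotoneOn (mem_Ioi.2 one_pos) (mem_Ioi.2 (one_pos.trans_le hs)) hs)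
    linarith
  obtain ⟨r₁, hr01, hδ1, hpos1⟩ := exists_first_zero (hcont r₀ hr₀) (hpos r₀ hr₀ le_rfl) hex
  have hr₁ : 0 < r₁ := hr₀.trans hr01
  replace hpos1 : ∀ r, 0 < r → r < r₁ → 0 < δ r := fun r hr hr1 =>
    (le_total r r₀).elim (hpos r hr) fun hle => hpos1 r hle hr1
  have hz1 : z r₁ ≤ 0 := by
    have := deriv_nonpos_of_pos_left (hm r₁ hr₁).1 hr₁ hδ1 hpos1
    rw [div_le_iff₀ hr₁, zero_mul] at this
    exact this
  -- The same Wronskian is positive at `r₁`, where it reduces to `p r₁ * z r₁`.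
  have hz1ne : z r₁ ≠ 0 := by
    have hmono : StrictMonoOn (fun r => p r * z r - profileZ f q p r * δ r) (Ioc 0 r₁) :=
      strictMonoOn_of_hasDerivAt (convex_Ioc 0 r₁) (fun r hr => hWp r hr.1) fun r hr => by
        rw [interior_Ioc] at hr
        have := mul_pos (mul_pos (one_div_pos.2 hr.1) (neg_pos.2 (h.p_neg hr.1)))
          (hpos1 r hr.1 hr.2)
        linarith
    have h1 := pos_of_strictMonoOn_Ioc hr₁ hmono hWp0
    intro h0
    simp [h0, hδ1] at h1
  have hz1neg : z r₁ < 0 := lt_of_le_of_ne hz1 hz1ne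
  have hqb : b < q r₁ := by
    by_contra! hle
    exact hz1ne (h.eq_zero_of_zero_of_le hm hu hz hr₁ hδ1 hle)
  have hqa := (h.range r₁ hr₁).2
  have hq1 := (h.range r₁ hr₁).1
  have hf1 := h.bistable.pos _ hqb hqa
  -- Otherwise `s f' - f` would be negative at all values above `q r₁`, because `s f'/f` decreases.
  -- The Wronskian with `q` would then be negative at `r₁`, where it equals `-q r₁ * z r₁ > 0`.
  have hK : 0 < q r₁ * f' (q r₁) - f (q r₁) := by
    by_contra! hle
    have hanti : StrictAntiOn (fun r => r * p r * δ r - q r * z r) (Ioc 0 r₁) :=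
      strictAntiOn_of_hasDerivAt (convex_Ioc 0 r₁)
        (fun r hr => h.hasDerivAt_wronskian_q hm hr.1) fun r hr => by
        rw [interior_Ioc] at hr
        have hlt := h.q_strictAnti hr.1 hr₁ hr.2
        have h1 := h.bistable.ratio_anti _ _ hqb hlt (h.range r hr.1).2
        have h2 := h.bistable.pos _ (hqb.trans hlt) (h.range r hr.1).2
        refine mul_neg_of_pos_of_neg (mul_pos hr.1 (hpos1 r hr.1 hr.2)) ?_
        have h3 : (q r * f' (q r) - f (q r)) * f (q r₁) < 0 := by
          have := mul_nonpos_of_nonpos_of_nonneg hle h2.le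
          linarith
        by_contra! hcon
        linarith [mul_nonneg hcon hf1.le]
    have h1 := neg_of_strictAntiOn_Ioc hr₁ hanti hWq0
    simp only [hδ1, mul_zero, zero_sub] at h1
    linarith [mul_pos_of_neg_of_neg hz1neg (neg_neg_of_pos hq1)]
  -- This is the value for which `Θ` vanishes at `q r₁`. Then `Θ(s) f(q r₁) = λ (s f'(s) f(q r₁) - q
  -- r₁ f'(q r₁) f(s))`, whose sign on `(b, a)` comes from the monotonicity of `s f'/f`. Below `b`
  -- superlinearity gives `Θ > 0` directly.
  set lam := 2 * f (q r₁) / (q r₁ * f' (q r₁) - f (q r₁)) with hlam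
  have hlam0 : 0 < lam := by positivity
  have hlamE : lam * (q r₁ * f' (q r₁) - f (q r₁)) = 2 * f (q r₁) := by
    rw [hlam]; field_simp
  set Θ : ℝ → ℝ := fun s => lam * (s * f' s - f s) - 2 * f s with hΘ
  have hΘneg : ∀ s, q r₁ < s → s < a → Θ s < 0 := fun s hs hsa => by
    have h1 := h.bistable.ratio_anti _ _ hqb hs hsa
    have h3 : Θ s * f (q r₁) < 0 := by
      have e : Θ s * f (q r₁) = lam * (s * f' s * f (q r₁) - q r₁ * f' (q r₁) * f s)
        + f s * (lam * (q r₁ * f' (q r₁) - f (q r₁)) - 2 * f (q r₁)) := by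
        simp only [hΘ]; ring
      rw [e, hlamE, sub_self, mul_zero, add_zero]
      exact mul_neg_of_pos_of_neg hlam0 (by linarith)
    by_contra! hcon
    linarith [mul_nonneg hcon hf1.le]
  have hΘpos : ∀ s, 0 < s → s < q r₁ → 0 < Θ s := fun s hs hsa => by
    rcases le_or_gt s b with hsb | hsb
    · have h1 := mul_pos hlam0 (sub_pos.2 (h.bistable.superlinear s hs hsb))
      have h2 : f s ≤ 0 := by
        rcases hsb.lt_or_eq with hlt | heq
        · exact (h.bistable.neg s hs hlt).le
        · rw [heq, h.bistable.map_b]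
      simp only [hΘ]
      linarith
    · have h1 := h.bistable.ratio_anti _ _ hsb hsa hqa
      have h3 : 0 < Θ s * f (q r₁) := by
        have e : Θ s * f (q r₁) = lam * (s * f' s * f (q r₁) - q r₁ * f' (q r₁) * f s)
          + f s * (lam * (q r₁ * f' (q r₁) - f (q r₁)) - 2 * f (q r₁)) := by
          simp only [hΘ]; ring
        rw [e, hlamE, sub_self, mul_zero, add_zero]
        exact mul_pos hlam0 (by linarith)
      exact pos_of_mul_pos_left h3 hf1.le
  -- The Wronskian of `δ` with `r p + λ q`. At a zero of `δ` only the product of `r p + λ q` with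
  -- `z` survives.
  set W : ℝ → ℝ := fun r => (-(r ^ 2 * f (q r)) * δ r - r * p r * z r)
    + lam * (r * p r * δ r - q r * z r) with hWdef
  have hW : ∀ r, 0 < r → HasDerivAt W (r * δ r * Θ (q r)) r := fun r hr => by
    convert! (h.hasDerivAt_wronskian_dilation hm hr).add
      ((h.hasDerivAt_wronskian_q hm hr).const_mul lam) using 1
    simp only [hΘ]
    ring
  have hWval : ∀ r, δ r = 0 → W r = -((r * p r + lam * q r) * z r) := fun r hr => by
    simp only [hWdef, hr]
    ring
  have hW1 : W r₁ < 0 := by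
    have hanti : StrictAntiOn W (Ioc 0 r₁) :=
      strictAntiOn_of_hasDerivAt (convex_Ioc 0 r₁) (fun r hr => hW r hr.1) fun r hr => by
        rw [interior_Ioc] at hr
        exact mul_neg_of_pos_of_neg (mul_pos hr.1 (hpos1 r hr.1 hr.2))
          (hΘneg _ (h.q_strictAnti hr.1 hr₁ hr.2) (h.range r hr.1).2)
    exact neg_of_strictAntiOn_Ioc hr₁ hanti (by
      have := hWs0.add (hWq0.const_mul lam)
      rwa [mul_zero, add_zero] at this)
  have hw1 : r₁ * p r₁ + lam * q r₁ < 0 := by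
    rw [hWval r₁ hδ1] at hW1
    by_contra! hcon
    linarith [mul_nonneg hcon (neg_nonneg.2 hz1)]
  obtain ⟨A, hA, hAneg⟩ := eventually_neg_of_deriv_neg (hm r₁ hr₁).1 hδ1
    (div_neg_of_neg_of_pos hz1neg hr₁)
  have hA0 : 0 < A := hr₁.trans hA
  by_cases hex2 : ∃ r, A ≤ r ∧ δ r = 0
  · -- a second zero
    obtain ⟨r₂, hAr2, hδ2, hneg2⟩ := exists_first_zero (δ := fun r => -δ r) (hcont A hA0).neg
      (neg_pos.2 (hAneg A hA le_rfl)) (by simpa using hex2)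
    replace hδ2 : δ r₂ = 0 := by simpa using hδ2
    have hr12 : r₁ < r₂ := hA.trans hAr2
    have hr₂ : 0 < r₂ := hr₁.trans hr12
    replace hneg2 : ∀ r, r₁ < r → r < r₂ → δ r < 0 := fun r hr hr2 =>
      (le_total r A).elim (hAneg r hr) fun hle => neg_pos.1 (hneg2 r hle hr2)
    have hz2 : 0 ≤ z r₂ := by
      have := deriv_nonpos_of_pos_left (hm r₂ hr₂).1.neg hr12 (by simpa using hδ2)
        (fun s hs hs2 => neg_pos.2 (hneg2 s hs hs2))
      have : 0 ≤ z r₂ / r₂ := by linarith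
      rwa [le_div_iff₀ hr₂, zero_mul] at this
    -- Past `r₁` both `δ` and `Θ(q)` have changed sign, so `W' = r δ Θ(q)` is still negative.
    have hanti : StrictAntiOn W (Icc r₁ r₂) :=
      strictAntiOn_of_hasDerivAt (convex_Icc r₁ r₂) (fun r hr => hW r (hr₁.trans_le hr.1))
        fun r hr => by
        rw [interior_Icc] at hr
        have hr0 := hr₁.trans hr.1
        exact mul_neg_of_neg_of_pos (mul_neg_of_pos_of_neg hr0 (hneg2 r hr.1 hr.2))
          (hΘpos _ (h.range r hr0).1 (h.q_strictAnti hr₁ hr0 hr.1))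
    have hW2 : W r₂ < 0 := (hanti (left_mem_Icc.2 hr12.le) (right_mem_Icc.2 hr12.le) hr12).trans hW1
    rw [hWval r₂ hδ2] at hW2
    have hqb2 : b < q r₂ := by
      by_contra! hle
      rw [h.eq_zero_of_zero_of_le hm hu hz hr₂ hδ2 hle] at hW2
      simp at hW2
    have hw2 : 0 < r₂ * p r₂ + lam * q r₂ := by
      by_contra! hcon
      linarith [mul_nonneg (neg_nonneg.2 hcon) hz2]
    -- As `f(q) > 0` on the interval, `(r p)' = -r f(q) < 0`, hence `(r p / q)' ≤ 0`. But `r p / q`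
    -- is below `-λ` at `r₁` and above it at `r₂`.
    have hqd : AntitoneOn (fun r => r * p r / q r) (Icc r₁ r₂) := by
      refine antitoneOn_of_hasDerivAt (convex_Icc r₁ r₂) (fun r hr =>
        ((hasDerivAt_id r).mul (h.hasDerivAt_p r (hr₁.trans_le hr.1))).div
          (h.hasDerivAt_q r (hr₁.trans_le hr.1)) (h.range r (hr₁.trans_le hr.1)).1.ne')
        fun r hr => ?_
      have hr0 := hr₁.trans_le hr.1
      have hqr := h.range r hr0
      have hfr := h.bistable.pos _ (hqb2.trans_le (h.q_antitone hr0 hr₂ hr.2)) hqr.2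
      refine div_nonpos_of_nonpos_of_nonneg ?_ (sq_nonneg _)
      simp only [id, Pi.mul_apply]
      have e : (1 * p r + r * (-p r / r - f (q r))) * q r - r * p r * p r
        = -(r * f (q r) * q r + r * p r ^ 2) := by
        field_simp
        ring
      rw [e, neg_nonpos]
      have := hqr.1
      positivity
    have h1 := hqd (left_mem_Icc.2 hr12.le) (right_mem_Icc.2 hr12.le) hr12.le
    have hq2 := (h.range r₂ hr₂).1
    simp only at h1
    rw [div_le_div_iff₀ hq2 hq1] at h1
    have h2 := mul_pos hw2 hq1
    have h3 := mul_pos (neg_pos.2 hw1) hq2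
    linarith
  · -- no further zero
    push Not at hex2
    have hneg2 : ∀ r, r₁ < r → δ r < 0 := fun r hr => by
      rcases le_total r A with hle | hle
      · exact hAneg r hr hle
      · by_contra! hcon
        obtain ⟨x, hx, hx0⟩ := intermediate_value_Icc hle
          ((hcont A hA0).mono Icc_subset_Ici_self) ⟨(hAneg A hA le_rfl).le, hcon⟩
        exact hex2 x hx.1 hx0
    have hanti : StrictAntiOn W (Ici r₁) :=
      strictAntiOn_of_hasDerivAt (convex_Ici r₁) (fun r hr => hW r (hr₁.trans_le hr))
        fun r hr => by
        rw [interior_Ici] at hr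
        have hr0 : 0 < r := hr₁.trans hr
        exact mul_neg_of_neg_of_pos (mul_neg_of_pos_of_neg hr0 (hneg2 r hr))
          (hΘpos _ (h.range r hr0).1 (h.q_strictAnti hr₁ hr0 hr))
    -- Strict decrease from `W r₁ < 0` is incompatible with the limit `0`.
    have hWinf : Tendsto W atTop (𝓝 0) := by
      have := (h.tendsto_wronskian_dilation hu hz).add
        ((h.tendsto_wronskian_q hu hz).const_mul lam)
      rwa [mul_zero, add_zero] at this
    have := le_of_tendsto hWinf (b := W r₁) (by
      filter_upwards [eventually_ge_atTop r₁] with s hs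
      exact hanti.antitoneOn self_mem_Ici hs hs)
    linarith

/-- The radial kernel is trivial. -/
theorem IsProfile.not_ne_zero_near_zero (h : IsProfile f f' a b q p) {δ z : ℝ → ℝ}
    (hm : IsMode (modeCoeff f' q 0) δ z) (hint : IntegrableOn (fun ρ => δ (√ρ) ^ 2) (Ioi 0))
    {C : ℝ} (hbd : ∀ r, 0 < r → r ≤ 1 → |δ r| ≤ C) (hz0 : Tendsto z (𝓝[>] 0) (𝓝 0))
    {r₀ : ℝ} (hr₀ : 0 < r₀) (hne : ∀ r, 0 < r → r ≤ r₀ → δ r ≠ 0) : False := by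
  obtain ⟨hu, hz⟩ := hm.tendsto_atTop (h.eventually_modeCoeff_nonneg 0) hint
  have hcont : ContinuousOn δ (Ioc 0 r₀) := fun r hr =>
    (hm r hr.1).1.continuousAt.continuousWithinAt
  have hsign : ∀ r, 0 < r → r ≤ r₀ → 0 < δ r * δ r₀ := fun r hr hle => by
    by_contra! hcon
    have hsub : Icc r r₀ ⊆ Ioc 0 r₀ := fun s hs => ⟨hr.trans_le hs.1, hs.2⟩
    obtain ⟨x, hx, hx0⟩ := intermediate_value_Icc hle
      ((hcont.mono hsub).mul continuousOn_const : ContinuousOn (fun s => δ s * δ r₀) _)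
      ⟨hcon, mul_self_nonneg (δ r₀)⟩
    rcases mul_eq_zero.1 hx0 with h1 | h1
    · exact hne x (hsub hx).1 hx.2 h1
    · exact hne r₀ hr₀ le_rfl h1
  rcases (hne r₀ hr₀ le_rfl).lt_or_gt with hneg | hpos
  · refine h.not_pos_near_zero hm.neg (by simpa using hu.neg) (by simpa using hz.neg) (C := C)
      (by simpa using hbd) (by simpa using hz0.neg) hr₀ fun r hr hle => ?_
    exact neg_pos.2 (neg_of_mul_pos_left (hsign r hr hle) hneg.le)
  · exact h.not_pos_near_zero hm hu hz hbd hz0 hr₀ fun r hr hle =>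
      pos_of_mul_pos_left (hsign r hr hle) hpos.le

end Profile

/-! ### Polar coordinates `(ρ, θ)` with `ρ = r²` -/

/-- The point with squared radius `ρ` and angle `θ`. -/
noncomputable def polar (y : ℝ × ℝ) : Plane :=
  !₂[√y.1 * Real.cos y.2, √y.1 * Real.sin y.2]

@[simp] theorem polar_apply_zero (y : ℝ × ℝ) : polar y 0 = √y.1 * Real.cos y.2 := rfl

@[simp] theorem polar_apply_one (y : ℝ × ℝ) : polar y 1 = √y.1 * Real.sin y.2 := rfl

theorem plane_norm_sq (x : Plane) : ‖x‖ ^ 2 = x 0 ^ 2 + x 1 ^ 2 := by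
  rw [EuclideanSpace.norm_sq_eq, Fin.sum_univ_two, Real.norm_eq_abs, Real.norm_eq_abs, sq_abs,
    sq_abs]

theorem norm_sq_polar {ρ : ℝ} (hρ : 0 ≤ ρ) (θ : ℝ) : ‖polar (ρ, θ)‖ ^ 2 = ρ := by
  rw [plane_norm_sq]
  simp only [polar_apply_zero, polar_apply_one, mul_pow, Real.sq_sqrt hρ]
  rw [← mul_add, Real.cos_sq_add_sin_sq, mul_one]

theorem norm_polar {ρ : ℝ} (hρ : 0 ≤ ρ) (θ : ℝ) : ‖polar (ρ, θ)‖ = √ρ := by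
  rw [← Real.sqrt_sq (norm_nonneg (polar (ρ, θ))), norm_sq_polar hρ]

theorem continuous_polar : Continuous polar := by
  unfold polar
  refine (PiLp.continuous_toLp 2 _).comp (continuous_pi fun i => ?_)
  fin_cases i <;> simp <;> fun_prop

/-- Lebesgue measure on the angles `(-π, π]`. -/
noncomputable abbrev angleMeasure : Measure ℝ := volume.restrict (Ioc (-Real.pi) Real.pi)

/-- Lebesgue measure on `(0, ∞) × (-π, π]`. -/
noncomputable abbrev polarMeasure : Measure (ℝ × ℝ) :=
  (volume.restrict (Ioi 0)).prod angleMeasure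

/-- With `ρ = r²` the area element `r dr dθ` becomes `dρ dθ / 2`. The density is constant, which
explains the factor `2` and lets all later arguments use an unweighted product measure. -/
theorem measurePreserving_polar :
    MeasurePreserving polar polarMeasure ((2 : ℝ≥0∞) • (volume : Measure Plane)) := by
  refine ⟨continuous_polar.measurable, Measure.ext_of_lintegral _ fun f hf => ?_⟩
  rw [lintegral_map hf continuous_polar.measurable, lintegral_smul_measure, smul_eq_mul]
  have hm := Complex.orthonormalBasisOneI.repr.measurePreserving
  have hfT : Measurable fun z : ℂ => f (Complex.orthonormalBasisOneI.repr z) :=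
    hf.comp hm.measurable
  rw [← hm.lintegral_comp hf, ← Complex.lintegral_comp_polarCoord_symm,
    lintegral_prod (fun y => f (polar y)) (hf.comp continuous_polar.measurable).aemeasurable]
  have himg : (fun r : ℝ => r ^ 2) '' Ioi 0 = Ioi 0 := by
    ext ρ
    simp only [mem_image, mem_Ioi]
    exact ⟨fun ⟨r, hr, h⟩ => h ▸ pow_pos hr 2, fun h => ⟨√ρ, Real.sqrt_pos.2 h, Real.sq_sqrt h.le⟩⟩
  -- The change of variables `ρ = r²` on the half-line supplies the Jacobian `2 r`, to be matched
  -- with the weight `r` of the usual polar coordinates.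
  have h1 := lintegral_image_eq_lintegral_abs_deriv_mul (measurableSet_Ioi (a := (0 : ℝ)))
    (f := fun r => r ^ 2) (f' := fun r => 2 * r)
    (fun x _ => by simpa using (hasDerivAt_pow 2 x).hasDerivWithinAt)
    (fun x hx y hy h => (pow_left_inj₀ (le_of_lt hx) (le_of_lt hy) two_ne_zero).1 h)
    (fun ρ => ∫⁻ θ in Ioc (-Real.pi) Real.pi, f (polar (ρ, θ)))
  rw [himg] at h1
  rw [h1, polarCoord_target, Measure.volume_eq_prod, ← Measure.prod_restrict,
    lintegral_prod]
  · rw [← lintegral_const_mul' _ _ (by simp)]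
    refine setLIntegral_congr_fun measurableSet_Ioi fun r hr => ?_
    have hr : 0 < r := hr
    simp only
    rw [abs_of_pos (by positivity), ENNReal.ofReal_mul (by norm_num), mul_assoc]
    congr 1
    · simp
    rw [← lintegral_const_mul' _ _ (by simp), restrict_Ioo_eq_restrict_Ioc]
    refine lintegral_congr fun θ => ?_
    rw [smul_eq_mul]
    congr 2
    ext i
    fin_cases i <;> simp [Real.sqrt_sq hr.le, -Complex.ofReal_cos, -Complex.ofReal_sin]
  · have : Measurable fun y : ℝ × ℝ => Complex.polarCoord.symm y := by
      have : (fun y : ℝ × ℝ => Complex.polarCoord.symm y)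
          = fun y => (y.1 : ℂ) * (Real.cos y.2 + Real.sin y.2 * Complex.I) := by
        ext y; rw [Complex.polarCoord_symm_apply]
      rw [this]
      exact Continuous.measurable (by fun_prop)
    exact ((measurable_fst.ennreal_ofReal).smul (hfT.comp this)).aemeasurable

theorem ae_polar {s : Plane → Prop} (h : ∀ᵐ x, s x) : ∀ᵐ y ∂polarMeasure, s (polar y) :=
  measurePreserving_polar.quasiMeasurePreserving.ae (Measure.ae_smul_measure h 2)

theorem ae_of_ae_polar {s : Plane → Prop} (hs : MeasurableSet {x | s x})
    (h : ∀ᵐ y ∂polarMeasure, s (polar y)) : ∀ᵐ x, s x := by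
  have h1 : ∀ᵐ x ∂(Measure.map polar polarMeasure), s x :=
    (ae_map_iff continuous_polar.measurable.aemeasurable hs).2 h
  rw [measurePreserving_polar.map_eq] at h1
  rw [ae_iff] at h1 ⊢
  simpa using h1

theorem integrable_comp_polar {F : Plane → ℝ} (hF : Integrable F) :
    Integrable (fun y => F (polar y)) polarMeasure :=
  (measurePreserving_polar.integrable_comp (hF.smul_measure (by simp)).aestronglyMeasurable).2
    (hF.smul_measure (by simp))

theorem memLp_comp_polar {F : Plane → ℝ} (hF : MemLp F 2 volume) :
    MemLp (fun y => F (polar y)) 2 polarMeasure :=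
  (hF.smul_measure (by simp)).comp_measurePreserving measurePreserving_polar

theorem integral_comp_polar {F : Plane → ℝ} (hF : Integrable F) :
    ∫ ρ in Ioi 0, ∫ θ in Ioc (-Real.pi) Real.pi, F (polar (ρ, θ)) = 2 * ∫ x, F x := by
  rw [← integral_prod (fun y => F (polar y)) (integrable_comp_polar hF)]
  have h := integral_map (μ := polarMeasure) continuous_polar.measurable.aemeasurable (f := F)
    (by rw [measurePreserving_polar.map_eq]; exact (hF.smul_measure (by simp)).aestronglyMeasurable)
  rw [← h, measurePreserving_polar.map_eq, integral_smul_measure]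
  simp

/-! ### Completeness of the trigonometric system -/

/-- A square integrable function on `(-π, π]`, all whose Fourier coefficients vanish, is zero. -/
theorem ae_eq_zero_of_fourier {h : ℝ → ℝ} (hh : MemLp h 2 angleMeasure)
    (hcos : ∀ k : ℕ, ∫ θ in Ioc (-Real.pi) Real.pi, h θ * Real.cos (k * θ) = 0)
    (hsin : ∀ k : ℕ, ∫ θ in Ioc (-Real.pi) Real.pi, h θ * Real.sin (k * θ) = 0) :
    h =ᵐ[angleMeasure] 0 := by
  have hT : Fact (0 < 2 * Real.pi) := ⟨by positivity⟩
  have hI : Ioc (-Real.pi) (-Real.pi + 2 * Real.pi) = Ioc (-Real.pi) Real.pi := by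
    congr 1; ring
  have hlt : -Real.pi < -Real.pi + 2 * Real.pi := by linarith [Real.pi_pos]
  have hC : MemLp (fun θ => (h θ : ℂ)) 2 angleMeasure := hh.ofReal
  have hint : Integrable h angleMeasure := hh.integrable (by norm_num)
  have hzero : ∀ n : ℤ, fourierCoeffOn hlt (fun θ => (h θ : ℂ)) n = 0 := by
    intro n
    rw [fourierCoeffOn_eq_integral]
    have : ∫ x in (-Real.pi)..(-Real.pi + 2 * Real.pi),
        fourier (-n) (x : AddCircle (-Real.pi + 2 * Real.pi - -Real.pi)) • (h x : ℂ) = 0 := by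
      rw [intervalIntegral.integral_of_le hlt.le, hI]
      have hpt : ∀ x : ℝ, fourier (-n) (x : AddCircle (-Real.pi + 2 * Real.pi - -Real.pi)) •
          (h x : ℂ) = ((h x * Real.cos (n * x) : ℝ) : ℂ)
            - ((h x * Real.sin (n * x) : ℝ) : ℂ) * Complex.I := by
        intro x
        rw [fourier_coe_apply]
        have : 2 * (Real.pi : ℂ) * Complex.I * ((-n : ℤ) : ℂ) * (x : ℂ) /
            ((-Real.pi + 2 * Real.pi - -Real.pi : ℝ) : ℂ) = ((-(n * x) : ℝ) : ℂ) * Complex.I := by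
          have : (Real.pi : ℂ) ≠ 0 := by exact_mod_cast Real.pi_ne_zero
          push_cast
          field_simp
          ring
        rw [this, Complex.exp_mul_I, ← Complex.ofReal_cos, ← Complex.ofReal_sin, Real.cos_neg,
          Real.sin_neg, smul_eq_mul]
        push_cast
        ring
      simp only [hpt]
      have hic : Integrable (fun x => h x * Real.cos (n * x)) angleMeasure :=
        hint.mul_bdd (c := 1) (by fun_prop) (ae_of_all _ fun x => Real.abs_cos_le_one _)
      have his : Integrable (fun x => h x * Real.sin (n * x)) angleMeasure :=
        hint.mul_bdd (c := 1) (by fun_prop) (ae_of_all _ fun x => Real.abs_sin_le_one _)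
      have ec : ∫ x in Ioc (-Real.pi) Real.pi, h x * Real.cos (n * x) = 0 := by
        rcases Int.natAbs_eq n with hn | hn
        · rw [hn]; simpa using hcos n.natAbs
        · rw [hn]; simpa [Real.cos_neg] using hcos n.natAbs
      have es : ∫ x in Ioc (-Real.pi) Real.pi, h x * Real.sin (n * x) = 0 := by
        rcases Int.natAbs_eq n with hn | hn
        · rw [hn]; simpa using hsin n.natAbs
        · rw [hn]
          have := hsin n.natAbs
          simp only [Int.cast_neg, Int.cast_natCast, neg_mul, Real.sin_neg, mul_neg,
            integral_neg, this, neg_zero]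
      rw [integral_sub hic.ofReal (his.ofReal.mul_const _), integral_mul_const, integral_complex_ofReal,
        integral_complex_ofReal, ec, es]
      simp
    rw [this, smul_zero]
  -- Parseval: all coefficients vanish, hence so does the integral of `h²`.
  have hsum := hasSum_sq_fourierCoeffOn hlt (f := fun θ => (h θ : ℂ)) (by rw [hI]; exact hC)
  simp only [hzero] at hsum
  have h0 : _ = (0 : ℝ) := hsum.unique (by simp [hasSum_zero])
  rw [intervalIntegral.integral_of_le hlt.le, hI] at h0
  have h1 : ∫ x in Ioc (-Real.pi) Real.pi, h x ^ 2 = 0 := by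
    have hpi := Real.pi_pos.ne'
    simpa [hpi] using h0
  have h2 := (integral_eq_zero_iff_of_nonneg (fun x => sq_nonneg (h x)) hh.integrable_sq).1 h1
  filter_upwards [h2] with x hx
  simpa using hx

/-- A square integrable function on the plane, all whose angular Fourier coefficients vanish,
is zero. -/
theorem ae_eq_zero_of_angular {v : Plane → ℝ} (hv : MemLp v 2 volume)
    (hcos : ∀ k : ℕ, ∀ᵐ ρ ∂(volume.restrict (Ioi (0 : ℝ))),
      ∫ θ in Ioc (-Real.pi) Real.pi, v (polar (ρ, θ)) * Real.cos (k * θ) = 0)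
    (hsin : ∀ k : ℕ, ∀ᵐ ρ ∂(volume.restrict (Ioi (0 : ℝ))),
      ∫ θ in Ioc (-Real.pi) Real.pi, v (polar (ρ, θ)) * Real.sin (k * θ) = 0) :
    v =ᵐ[volume] 0 := by
  have hv' := memLp_comp_polar hv
  have hsq := hv'.integrable_sq
  have hkey : ∀ᵐ ρ ∂(volume.restrict (Ioi (0 : ℝ))),
      (fun θ => v (polar (ρ, θ))) =ᵐ[angleMeasure] 0 := by
    filter_upwards [ae_all_iff.2 hcos, ae_all_iff.2 hsin, hsq.prod_right_ae,
      hv'.aestronglyMeasurable.prodMk_left] with ρ h1 h2 h3 h4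
    exact ae_eq_zero_of_fourier ((memLp_two_iff_integrable_sq h4).2 h3) h1 h2
  -- Passing from almost every circle to almost every point needs a measurable zero set, hence a
  -- measurable representative of `v`.
  obtain ⟨w, hw, hvw⟩ := hv.aestronglyMeasurable
  have hvw' := ae_polar hvw
  have hw0 : ∀ᵐ y ∂polarMeasure, w (polar y) = 0 := by
    rw [Measure.ae_prod_iff_ae_ae (p := fun y => w (polar y) = 0) (measurableSet_eq_fun
      (hw.measurable.comp continuous_polar.measurable) measurable_const)]
    filter_upwards [hkey, Measure.ae_ae_of_ae_prod hvw'] with ρ h1 h2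
    filter_upwards [h1, h2] with θ h3 h4
    rw [← h4]; exact h3
  have := ae_of_ae_polar (s := fun x => w x = 0) (measurableSet_eq_fun hw.measurable
    measurable_const) hw0
  filter_upwards [hvw, this] with x h1 h2
  rw [h1, h2]; rfl

/-! ### Regularity of weak solutions of the radial equations -/

/-- Cauchy–Schwarz, obtained from the nonnegativity of the variance `∫ (f - mean)²`. -/
theorem sq_integral_le {α : Type*} [MeasurableSpace α] {μ : Measure α} [IsFiniteMeasure μ]
    {f : α → ℝ} (hf : Integrable f μ) (hf2 : Integrable (fun x => f x ^ 2) μ) :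
    (∫ x, f x ∂μ) ^ 2 ≤ μ.real univ * ∫ x, f x ^ 2 ∂μ := by
  rcases eq_or_ne (μ.real univ) 0 with h0 | h0
  · have : μ = 0 := by
      rw [measureReal_def, ENNReal.toReal_eq_zero_iff] at h0
      exact Measure.measure_univ_eq_zero.1 (h0.resolve_right (measure_ne_top _ _))
    simp [this]
  · have hA : 0 < μ.real univ := lt_of_le_of_ne measureReal_nonneg h0.symm
    set A := μ.real univ
    set I := ∫ x, f x ∂μ
    have h1 : 0 ≤ ∫ x, (f x - I / A) ^ 2 ∂μ := integral_nonneg fun x => sq_nonneg _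
    have h2 : ∫ x, (f x - I / A) ^ 2 ∂μ = ∫ x, f x ^ 2 ∂μ - 2 * (I / A) * I + (I / A) ^ 2 * A := by
      have : ∀ x, (f x - I / A) ^ 2 = f x ^ 2 - 2 * (I / A) * f x + (I / A) ^ 2 := fun x => by ring
      simp only [this]
      have h3 : Integrable (fun x => f x ^ 2 - 2 * (I / A) * f x) μ := hf2.sub (hf.const_mul _)
      rw [integral_add h3 (integrable_const _),
        integral_sub hf2 (hf.const_mul _), integral_const_mul, integral_const, smul_eq_mul,
        mul_comm (μ.real univ)]
    rw [h2] at h1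
    have h3 : (I / A) ^ 2 * A = I ^ 2 / A := by field_simp
    have h4 : 2 * (I / A) * I = 2 * (I ^ 2 / A) := by field_simp
    rw [h3, h4] at h1
    have h5 : I ^ 2 / A ≤ ∫ x, f x ^ 2 ∂μ := by linarith
    rwa [div_le_iff₀ hA, mul_comm] at h5

/-- Integration by parts for a merely integrable `k`, whose primitive is absolutely continuous. The
boundary terms vanish since the primitive is `0` at `0` and `φ` is `0` at `B`. -/
theorem integral_mul_eq_neg_primitive {k φ : ℝ → ℝ} {B : ℝ}
    (hk : IntervalIntegrable k volume 0 B) (hφ : ContDiff ℝ 1 φ) (hB : φ B = 0) :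
    ∫ x in (0 : ℝ)..B, k x * φ x = -∫ x in (0 : ℝ)..B, (∫ t in (0 : ℝ)..x, k t) * deriv φ x := by
  have h1 := hk.absolutelyContinuousOnInterval_intervalIntegral (c := 0) (by simp)
  have h2 : AbsolutelyContinuousOnInterval φ 0 B :=
    ContDiffOn.absolutelyContinuousOnInterval hφ.contDiffOn
  rw [h1.integral_mul_deriv_eq_deriv_mul h2, hB]
  simp only [mul_zero, intervalIntegral.integral_same, zero_mul, sub_zero, zero_sub, neg_neg]
  apply intervalIntegral.integral_congr_ae
  filter_upwards [hk.ae_hasDerivAt_integral] with x hx hxB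
  rw [(hx (uIoc_subset_uIcc hxB) 0 (by simp)).deriv]

theorem contDiff_primitive {η : ℝ → ℝ} (hη : ContDiff ℝ ∞ η) (B : ℝ) :
    ContDiff ℝ ∞ (fun x => ∫ t in B..x, η t) ∧ deriv (fun x => ∫ t in B..x, η t) = η := by
  have h1 : ∀ x, HasDerivAt (fun x => ∫ t in B..x, η t) (η x) x := fun x =>
    intervalIntegral.integral_hasDerivAt_right (hη.continuous.intervalIntegrable _ _)
      (hη.continuous.stronglyMeasurableAtFilter _ _) hη.continuous.continuousAt
  have h2 : deriv (fun x => ∫ t in B..x, η t) = η := funext fun x => (h1 x).deriv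
  refine ⟨contDiff_infty_iff_deriv.2 ⟨fun x => (h1 x).differentiableAt, ?_⟩, h2⟩
  rw [h2]; exact hη

theorem intervalIntegral_eq_zero_of_ge {η : ℝ → ℝ} {B x : ℝ} (h : ∀ y, B ≤ y → η y = 0)
    (hx : B ≤ x) : ∫ t in B..x, η t = 0 := by
  rw [intervalIntegral.integral_congr (g := fun _ => 0)]
  · simp
  · intro y hy
    rw [uIcc_of_le hx] at hy
    exact h y hy.1

/-- The integrated form of the weak equation `∫ m (4ρψ'' + 4κψ') + hψ = 0` on `(0, ∞)`, tested
with all `ψ ∈ C_c^∞(ℝ)`. -/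
theorem ae_eq_primitive_of_weak {m h : ℝ → ℝ} {κ : ℝ}
    (hm : ∀ R, IntegrableOn m (Ioc 0 R)) (hh : ∀ R, IntegrableOn h (Ioc 0 R))
    (hw : ∀ ψ : ℝ → ℝ, ContDiff ℝ ∞ ψ → HasCompactSupport ψ →
      ∫ ρ in Ioi 0, (m ρ * (4 * ρ * deriv (deriv ψ) ρ + 4 * κ * deriv ψ ρ) + h ρ * ψ ρ) = 0) :
    ∀ᵐ ρ, ρ ∈ Ioi (0 : ℝ) →
      4 * ρ * m ρ - ∫ s in (0 : ℝ)..ρ, (4 * κ * m s - ∫ t in (0 : ℝ)..s, h t) = 0 := by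
  set N : ℝ → ℝ := fun s => ∫ t in (0 : ℝ)..s, h t with hN
  have hmI : ∀ B, 0 ≤ B → IntervalIntegrable m volume 0 B := fun B hB =>
    (intervalIntegrable_iff_integrableOn_Ioc_of_le hB).2 (hm B)
  have hhI : ∀ B, 0 ≤ B → IntervalIntegrable h volume 0 B := fun B hB =>
    (intervalIntegrable_iff_integrableOn_Ioc_of_le hB).2 (hh B)
  have hNI : ∀ B, 0 ≤ B → IntervalIntegrable N volume 0 B := fun B hB =>
    ((hhI B hB).absolutelyContinuousOnInterval_intervalIntegral
      (c := 0) (by simp)).continuousOn.intervalIntegrable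
  have hMI : ∀ B, 0 ≤ B → IntervalIntegrable (fun s => 4 * κ * m s - N s) volume 0 B :=
    fun B hB => ((hmI B hB).const_mul (4 * κ)).sub (hNI B hB)
  have hMc : ∀ B, 0 ≤ B → ContinuousOn (fun ρ => ∫ s in (0 : ℝ)..ρ, (4 * κ * m s - N s))
      (uIcc 0 B) := fun B hB =>
    ((hMI B hB).absolutelyContinuousOnInterval_intervalIntegral (c := 0) (by simp)).continuousOn
  refine isOpen_Ioi.ae_eq_zero_of_integral_contDiff_smul_eq_zero ?_ fun η hη hηc hηs => ?_
  · rw [locallyIntegrableOn_iff (isOpen_Ioi.isLocallyClosed)]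
    intro K hK hKc
    obtain ⟨B, hB0, hB⟩ : ∃ B, 0 ≤ B ∧ K ⊆ Ioc 0 B := by
      obtain ⟨B, hB⟩ := hKc.bddAbove
      exact ⟨max B 0, le_max_right _ _, fun x hx => ⟨hK hx, (hB hx).trans (le_max_left _ _)⟩⟩
    refine IntegrableOn.mono_set ?_ hB
    rw [← intervalIntegrable_iff_integrableOn_Ioc_of_le hB0]
    exact ((hmI B hB0).continuousOn_mul (by fun_prop)).sub ((hMc B hB0).intervalIntegrable)
  obtain ⟨B, hB0, hB⟩ : ∃ B, 0 < B ∧ ∀ y, B ≤ y → η y = 0 := by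
    obtain ⟨B, hB⟩ := hηc.isCompact.bddAbove
    refine ⟨max B 0 + 1, by positivity, fun y hy => ?_⟩
    by_contra hne
    have := hB (subset_tsupport _ hne)
    linarith [le_max_left B 0]
  -- Given a test function `η` supported in `(0, ∞)`, the weak equation is tested with a `ψ` such
  -- that `ψ'' = η` there. Taking both primitives from `B` makes `ψ` vanish beyond `B`.
  obtain ⟨hη1, hdη1⟩ := contDiff_primitive hη B
  set η₁ : ℝ → ℝ := fun x => ∫ t in B..x, η t with hη₁
  obtain ⟨hψ0, hdψ0⟩ := contDiff_primitive hη1 B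
  set ψ₀ : ℝ → ℝ := fun x => ∫ t in B..x, η₁ t with hψ₀
  have hη1B : ∀ y, B ≤ y → η₁ y = 0 := fun y hy => intervalIntegral_eq_zero_of_ge hB hy
  have hψ0B : ∀ y, B ≤ y → ψ₀ y = 0 := fun y hy => intervalIntegral_eq_zero_of_ge hη1B hy
  -- The cutoff equals `1` for `x ≥ -1` and `0` for `x ≤ -2`, so it is invisible on `(0, ∞)`. Since
  -- `ψ` need not vanish at `0`, the integrated equation has no free constants of integration, and
  -- regularity at the origin is built in.
  set ψ : ℝ → ℝ := fun x => Real.smoothTransition (x + 2) * ψ₀ x with hψ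
  have hψsm : ContDiff ℝ ∞ ψ :=
    (Real.smoothTransition.contDiff.comp (contDiff_id.add contDiff_const)).mul hψ0
  have hψcs : HasCompactSupport ψ := by
    refine HasCompactSupport.intro (isCompact_Icc (a := -2) (b := B)) fun x hx => ?_
    rw [mem_Icc, not_and_or, not_le, not_le] at hx
    rcases hx with hx | hx
    · simp only [hψ, Real.smoothTransition.zero_of_nonpos (show x + 2 ≤ 0 by linarith), zero_mul]
    · simp only [hψ, hψ0B x hx.le, mul_zero]
  have heq : ∀ x, -1 < x → ψ x = ψ₀ x := fun x hx => by
    simp only [hψ, Real.smoothTransition.one_of_one_le (show 1 ≤ x + 2 by linarith), one_mul]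
  have hd1 : ∀ x, -1 < x → deriv ψ x = η₁ x := fun x hx => by
    rw [← hdψ0]
    apply Filter.EventuallyEq.deriv_eq
    filter_upwards [Ioi_mem_nhds hx] with y hy using heq y hy
  have hd2 : ∀ x, -1 < x → deriv (deriv ψ) x = η x := fun x hx => by
    rw [← hdη1]
    apply Filter.EventuallyEq.deriv_eq
    filter_upwards [Ioi_mem_nhds hx] with y hy using hd1 y hy
  have h1 := hw ψ hψsm hψcs
  have h2 : ∫ ρ in Ioi 0, (m ρ * (4 * ρ * deriv (deriv ψ) ρ + 4 * κ * deriv ψ ρ) + h ρ * ψ ρ)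
      = ∫ ρ in (0 : ℝ)..B, (m ρ * (4 * ρ * η ρ + 4 * κ * η₁ ρ) + h ρ * ψ₀ ρ) := by
    rw [intervalIntegral.integral_of_le hB0.le]
    rw [setIntegral_eq_of_subset_of_forall_sdiff_eq_zero measurableSet_Ioi
      (show Ioc 0 B ⊆ Ioi 0 from Ioc_subset_Ioi_self)]
    · refine setIntegral_congr_fun measurableSet_Ioc fun x hx => ?_
      have : -1 < x := by linarith [hx.1]
      simp only [heq x this, hd1 x this, hd2 x this]
    · intro x hx
      have hx0 : 0 < x := hx.1
      have hxB : B ≤ x := by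
        by_contra! hlt
        exact hx.2 ⟨hx0, hlt.le⟩
      have : -1 < x := by linarith
      simp [heq x this, hd1 x this, hd2 x this, hB x hxB, hη1B x hxB, hψ0B x hxB]
  rw [h2] at h1
  have i1 : IntervalIntegrable (fun ρ => 4 * ρ * m ρ * η ρ) volume 0 B :=
    ((hmI B hB0.le).continuousOn_mul (by fun_prop)).mul_continuousOn hη.continuous.continuousOn
  have i2 : IntervalIntegrable (fun ρ => 4 * κ * m ρ * η₁ ρ) volume 0 B :=
    ((hmI B hB0.le).const_mul _).mul_continuousOn hη1.continuous.continuousOn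
  have i3 : IntervalIntegrable (fun ρ => h ρ * ψ₀ ρ) volume 0 B :=
    (hhI B hB0.le).mul_continuousOn hψ0.continuous.continuousOn
  have i4 : IntervalIntegrable (fun ρ => N ρ * η₁ ρ) volume 0 B :=
    (hNI B hB0.le).mul_continuousOn hη1.continuous.continuousOn
  have i5 : IntervalIntegrable (fun ρ => (∫ s in (0 : ℝ)..ρ, (4 * κ * m s - N s)) * η ρ)
      volume 0 B :=
    ((hMc B hB0.le).mul hη.continuous.continuousOn).intervalIntegrable
  have e1 : ∫ ρ in (0 : ℝ)..B, (m ρ * (4 * ρ * η ρ + 4 * κ * η₁ ρ) + h ρ * ψ₀ ρ)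
      = (∫ ρ in (0 : ℝ)..B, 4 * ρ * m ρ * η ρ) + (∫ ρ in (0 : ℝ)..B, 4 * κ * m ρ * η₁ ρ)
        + ∫ ρ in (0 : ℝ)..B, h ρ * ψ₀ ρ := by
    rw [← intervalIntegral.integral_add i1 i2, ← intervalIntegral.integral_add (i1.add i2) i3]
    refine intervalIntegral.integral_congr fun x _ => ?_
    ring
  -- Two integrations by parts move the primitives from the test function back to `h` and to `4 κ m
  -- - N`, leaving everything tested against `η`.
  have e2 := integral_mul_eq_neg_primitive (hhI B hB0.le) (hψ0.of_le (by simp)) (hψ0B B le_rfl)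
  rw [hdψ0] at e2
  have e3 := integral_mul_eq_neg_primitive (hMI B hB0.le) (hη1.of_le (by simp)) (hη1B B le_rfl)
  rw [hdη1] at e3
  have e4 : ∫ x in (0 : ℝ)..B, (4 * κ * m x - N x) * η₁ x
      = (∫ ρ in (0 : ℝ)..B, 4 * κ * m ρ * η₁ ρ) - ∫ ρ in (0 : ℝ)..B, N ρ * η₁ ρ := by
    rw [← intervalIntegral.integral_sub i2 i4]
    refine intervalIntegral.integral_congr fun x _ => ?_
    ring
  have hfin : ∫ ρ in (0 : ℝ)..B, (4 * ρ * m ρ - ∫ s in (0 : ℝ)..ρ, (4 * κ * m s - N s)) * η ρ = 0 := by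
    have : ∫ ρ in (0 : ℝ)..B, (4 * ρ * m ρ - ∫ s in (0 : ℝ)..ρ, (4 * κ * m s - N s)) * η ρ
      = (∫ ρ in (0 : ℝ)..B, 4 * ρ * m ρ * η ρ)
        - ∫ ρ in (0 : ℝ)..B, (∫ s in (0 : ℝ)..ρ, (4 * κ * m s - N s)) * η ρ := by
      rw [← intervalIntegral.integral_sub i1 i5]
      refine intervalIntegral.integral_congr fun x _ => ?_
      ring
    rw [this]
    rw [e1] at h1
    linarith
  rw [intervalIntegral.integral_of_le hB0.le] at hfin
  refine Eq.trans ?_ hfin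
  rw [← setIntegral_univ, setIntegral_eq_of_subset_of_forall_sdiff_eq_zero MeasurableSet.univ
      (subset_univ (Ioc (0 : ℝ) B))]
  · refine setIntegral_congr_fun measurableSet_Ioc fun x hx => ?_
    simp only [smul_eq_mul]
    ring
  · intro x hx
    have : η x = 0 := by
      by_cases hx0 : 0 < x
      · refine hB x ?_
        by_contra! hlt
        exact hx.2 ⟨hx0, hlt.le⟩
      · exact image_eq_zero_of_notMem_tsupport fun hmem => hx0 (hηs hmem)
    simp [this]

/-- The radial regularity theorem: the angular moment `m` of a weak solution agrees almost
everywhere with a classical solution `w`. -/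
theorem exists_classical_of_weak {m V : ℝ → ℝ} {k : ℕ} (hV : Continuous V)
    {C : ℝ} (hVC : ∀ x, |V x| ≤ C) (hm : ∀ R, IntegrableOn m (Ioc 0 R))
    (hw : ∀ ψ : ℝ → ℝ, ContDiff ℝ ∞ ψ → HasCompactSupport ψ →
      ∫ ρ in Ioi 0, (m ρ * (4 * ρ * deriv (deriv ψ) ρ + 4 * (k + 1) * deriv ψ ρ)
        + V ρ * m ρ * ψ ρ) = 0) :
    ∃ w N : ℝ → ℝ, (∀ᵐ ρ ∂(volume.restrict (Ioi (0 : ℝ))), m ρ = w ρ) ∧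
      (∀ ρ, 0 < ρ → N ρ = ∫ t in (0 : ℝ)..ρ, V t * m t) ∧
      (∀ ρ, 0 < ρ → 4 * ρ * w ρ = ∫ s in (0 : ℝ)..ρ, (4 * (k + 1) * m s - N s)) ∧
      (∀ ρ, 0 < ρ → HasDerivAt w ((4 * k * w ρ - N ρ) / (4 * ρ)) ρ) ∧
      (∀ ρ, 0 < ρ → HasDerivAt N (V ρ * w ρ) ρ) := by
  have hh : ∀ R, IntegrableOn (fun t => V t * m t) (Ioc 0 R) := fun R =>
    (hm R).bdd_mul (c := C) hV.aestronglyMeasurable (ae_of_all _ hVC)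
  have hae := ae_eq_primitive_of_weak hm hh hw
  set N : ℝ → ℝ := fun s => ∫ t in (0 : ℝ)..s, V t * m t with hN
  set M : ℝ → ℝ := fun ρ => ∫ s in (0 : ℝ)..ρ, (4 * (k + 1) * m s - N s) with hM
  set w : ℝ → ℝ := fun ρ => M ρ / (4 * ρ) with hwdef
  have hmI : ∀ B, 0 ≤ B → IntervalIntegrable m volume 0 B := fun B hB =>
    (intervalIntegrable_iff_integrableOn_Ioc_of_le hB).2 (hm B)
  have hhI : ∀ B, 0 ≤ B → IntervalIntegrable (fun t => V t * m t) volume 0 B := fun B hB =>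
    (intervalIntegrable_iff_integrableOn_Ioc_of_le hB).2 (hh B)
  have hNc : ∀ B, 0 ≤ B → ContinuousOn N (uIcc 0 B) := fun B hB =>
    ((hhI B hB).absolutelyContinuousOnInterval_intervalIntegral (c := 0) (by simp)).continuousOn
  have hMI : ∀ B, 0 ≤ B → IntervalIntegrable (fun s => 4 * (k + 1) * m s - N s) volume 0 B :=
    fun B hB => ((hmI B hB).const_mul (4 * (k + 1))).sub (hNc B hB).intervalIntegrable
  have hMc : ∀ B, 0 ≤ B → ContinuousOn M (uIcc 0 B) := fun B hB =>
    ((hMI B hB).absolutelyContinuousOnInterval_intervalIntegral (c := 0) (by simp)).continuousOn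
  have hat {G : ℝ → ℝ} (hG : ∀ B, 0 ≤ B → ContinuousOn G (uIcc 0 B)) {x : ℝ} (hx : 0 < x) :
      ContinuousAt G x := by
    refine (hG (x + 1) (by linarith)).continuousAt ?_
    rw [uIcc_of_le (by linarith)]
    exact Icc_mem_nhds hx (by linarith)
  have hmw : ∀ᵐ ρ, ρ ∈ Ioi (0 : ℝ) → m ρ = w ρ := by
    filter_upwards [hae] with ρ h hρ
    have hρ' : (0 : ℝ) < ρ := hρ
    have h1 := h hρ
    simp only [hwdef]
    rw [eq_div_iff (by positivity)]
    linarith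
  have hwc : ∀ x, 0 < x → ContinuousAt w x := fun x hx =>
    (hat hMc hx).div (by fun_prop) (by positivity)
  -- Bootstrap: under the integral sign `m` may be replaced by its continuous version `w`, and then
  -- the fundamental theorem of calculus applies at every point.
  have hderiv {G G' : ℝ → ℝ} (hG : ∀ B, 0 ≤ B → IntervalIntegrable G volume 0 B)
      (hGG : ∀ᵐ ρ, ρ ∈ Ioi (0 : ℝ) → G ρ = G' ρ) (hG' : ∀ x, 0 < x → ContinuousAt G' x)
      {x : ℝ} (hx : 0 < x) : HasDerivAt (fun ρ => ∫ s in (0 : ℝ)..ρ, G s) (G' x) x := by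
    have e : ∀ᶠ ρ in 𝓝 x, (∫ s in (0 : ℝ)..ρ, G s) = ∫ s in (0 : ℝ)..ρ, G' s := by
      filter_upwards [Ioi_mem_nhds hx] with ρ hρ
      apply intervalIntegral.integral_congr_ae
      filter_upwards [hGG] with y hy hy'
      rw [uIoc_of_le (le_of_lt hρ)] at hy'
      exact hy hy'.1
    refine HasDerivAt.congr_of_eventuallyEq ?_ e
    refine intervalIntegral.integral_hasDerivAt_right ?_ ?_ (hG' x hx)
    · refine (hG x hx.le).congr_ae ?_
      rw [uIoc_of_le hx.le]
      refine (ae_restrict_iff' measurableSet_Ioc).2 ?_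
      filter_upwards [hGG] with y hy hy' using hy hy'.1
    · exact ContinuousOn.stronglyMeasurableAtFilter isOpen_Ioi
        (fun y hy => (hG' y hy).continuousWithinAt) x hx
  refine ⟨w, N, (ae_restrict_iff' measurableSet_Ioi).2 hmw, fun ρ _ => rfl, fun ρ hρ => ?_,
    fun ρ hρ => ?_, fun ρ hρ => ?_⟩
  · simp only [hwdef]
    field_simp
    rfl
  · have h1 : HasDerivAt M (4 * (k + 1) * w ρ - N ρ) ρ := by
      refine hderiv (G' := fun s => 4 * (k + 1) * w s - N s) hMI ?_ (fun x hx => ?_) hρ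
      · filter_upwards [hmw] with y hy hy'
        rw [hy hy']
      · exact ((hwc x hx).const_mul _).sub (hat hNc hx)
    have h2 : HasDerivAt (fun ρ : ℝ => 4 * ρ) 4 ρ := by
      simpa using (hasDerivAt_id ρ).const_mul (4 : ℝ)
    convert! h1.div h2 (by positivity) using 1
    have : M ρ = 4 * ρ * w ρ := by
      simp only [hwdef]; field_simp
    rw [this]
    field_simp
    ring
  · refine hderiv (G' := fun s => V s * w s) hhI ?_ (fun x hx => ?_) hρ
    · filter_upwards [hmw] with y hy hy'
      rw [hy hy']
    · exact hV.continuousAt.mul (hwc x hx)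

/-! ### Solid harmonics and the angular modes of a weak solution -/

theorem pderiv_add {f g : Plane → ℝ} {x : Plane} (hf : DifferentiableAt ℝ f x)
    (hg : DifferentiableAt ℝ g x) (i : Fin 2) :
    pderiv i (fun x => f x + g x) x = pderiv i f x + pderiv i g x := by
  simp only [pderiv]
  rw [fderiv_fun_add hf hg]; rfl

theorem pderiv_mul {f g : Plane → ℝ} {x : Plane} (hf : DifferentiableAt ℝ f x)
    (hg : DifferentiableAt ℝ g x) (i : Fin 2) :
    pderiv i (fun x => f x * g x) x = f x * pderiv i g x + pderiv i f x * g x := by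
  simp only [pderiv]
  rw [fderiv_fun_mul hf hg]
  simp [mul_comm]

theorem pderiv_const_mul {f : Plane → ℝ} {x : Plane} (hf : DifferentiableAt ℝ f x) (c : ℝ)
    (i : Fin 2) : pderiv i (fun x => c * f x) x = c * pderiv i f x := by
  simp only [pderiv]
  rw [fderiv_const_mul hf]
  simp

theorem pderiv_neg (f : Plane → ℝ) (x : Plane) (i : Fin 2) :
    pderiv i (fun x => -f x) x = -pderiv i f x := by
  simp only [pderiv]
  rw [fderiv_fun_neg]; rfl

theorem pderiv_comp {h : ℝ → ℝ} {h' : ℝ} {f : Plane → ℝ} {x : Plane} (hh : HasDerivAt h h' (f x))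
    (hf : DifferentiableAt ℝ f x) (i : Fin 2) :
    pderiv i (fun x => h (f x)) x = h' * pderiv i f x := by
  have h1 : HasFDerivAt (fun x => h (f x)) (h' • fderiv ℝ f x) x :=
    hh.comp_hasFDerivAt x hf.hasFDerivAt
  simp [pderiv, h1.fderiv]

theorem differentiable_coord (i : Fin 2) : Differentiable ℝ (fun x : Plane => x i) := by fun_prop

theorem pderiv_coord (i j : Fin 2) (x : Plane) :
    pderiv i (fun x : Plane => x j) x = if i = j then 1 else 0 := by
  have h : HasFDerivAt (fun x : Plane => x j)
      (EuclideanSpace.proj j : Plane →L[ℝ] ℝ) x :=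
    (EuclideanSpace.proj j : Plane →L[ℝ] ℝ).hasFDerivAt
  simp only [pderiv, h.fderiv]
  fin_cases i <;> fin_cases j <;> simp

theorem contDiff_pderiv {f : Plane → ℝ} {m n : WithTop ℕ∞} (hf : ContDiff ℝ n f) (hmn : m + 1 ≤ n)
    (i : Fin 2) : ContDiff ℝ m (pderiv i f) :=
  (hf.fderiv_right hmn).clm_apply contDiff_const

/-- The squared norm `x ↦ |x|²`. -/
def normSq (x : Plane) : ℝ := x 0 ^ 2 + x 1 ^ 2

theorem normSq_eq (x : Plane) : normSq x = ‖x‖ ^ 2 := (plane_norm_sq x).symm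

theorem contDiff_normSq {n : WithTop ℕ∞} : ContDiff ℝ n normSq := by
  unfold normSq; fun_prop

theorem pderiv_normSq (i : Fin 2) (x : Plane) : pderiv i normSq x = 2 * x i := by
  have h (j : Fin 2) : pderiv i (fun x : Plane => x j ^ 2) x
      = 2 * x j * if i = j then 1 else 0 := by
    rw [pderiv_comp (h := fun t => t ^ 2) (h' := 2 * x j) (by simpa using hasDerivAt_pow 2 (x j))
      (differentiable_coord j x), pderiv_coord]
  unfold normSq
  rw [pderiv_add (by fun_prop) (by fun_prop), h, h]
  fin_cases i <;> simp

theorem normSq_polar {ρ : ℝ} (hρ : 0 ≤ ρ) (θ : ℝ) : normSq (polar (ρ, θ)) = ρ := by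
  rw [normSq_eq, norm_sq_polar hρ]

/-- The Laplacian as the sum of the second partial derivatives. -/
noncomputable def lap (f : Plane → ℝ) (x : Plane) : ℝ := ∑ i, pderiv i (pderiv i f) x

/-- `Y` is a smooth harmonic function, homogeneous of degree `k`, with angular part `y`. -/
structure IsSolidHarmonic (k : ℕ) (Y : Plane → ℝ) (y : ℝ → ℝ) : Prop where
  contDiff : ContDiff ℝ ∞ Y
  lap_eq_zero : ∀ x, lap Y x = 0
  euler : ∀ x, x 0 * pderiv 0 Y x + x 1 * pderiv 1 Y x = k * Y x
  polar_eq : ∀ ρ θ, Y (polar (ρ, θ)) = √ρ ^ k * y θ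
  continuous_angular : Continuous y
  abs_le_one : ∀ θ, |y θ| ≤ 1

/-- The point `x` as a complex number. -/
noncomputable def toComplex (x : Plane) : ℂ := x 0 + x 1 * Complex.I

theorem contDiff_toComplex {n : WithTop ℕ∞} : ContDiff ℝ n toComplex := by
  unfold toComplex
  have (i : Fin 2) : ContDiff ℝ n (fun x : Plane => ((x i : ℝ) : ℂ)) :=
    Complex.ofRealCLM.contDiff.comp (by fun_prop)
  exact (this 0).add ((this 1).mul contDiff_const)

/-- Along the `i`-th coordinate line `toComplex` moves with velocity `1` or `I`, so the partial
derivative is the real part of a complex chain rule. -/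
theorem pderiv_re_mul_pow (e : ℂ) (k : ℕ) (i : Fin 2) (x : Plane) :
    pderiv i (fun x => (e * toComplex x ^ k).re) x
      = (e * k * ![1, Complex.I] i * toComplex x ^ (k - 1)).re := by
  have h1 : HasDerivAt (fun t : ℝ => toComplex (x + t • EuclideanSpace.single i (1 : ℝ)))
      (![1, Complex.I] i) 0 := by
    have hc : (fun t : ℝ => toComplex (x + t • EuclideanSpace.single i (1 : ℝ)))
        = fun t : ℝ => toComplex x + (t : ℂ) * ![1, Complex.I] i := by
      funext t
      fin_cases i <;> simp [toComplex] <;> ring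
    rw [hc]
    have := (Complex.ofRealCLM.hasDerivAt (x := (0 : ℝ))).mul_const (![1, Complex.I] i)
    simpa using this.const_add (toComplex x)
  have h2 := ((h1.pow k).const_mul e)
  have h3 := Complex.reCLM.hasFDerivAt.comp_hasDerivAt (0 : ℝ) h2
  have hd : DifferentiableAt ℝ (fun x => (e * toComplex x ^ k).re) x := by
    have : ContDiff ℝ 1 (fun x => (e * toComplex x ^ k).re) :=
      Complex.reCLM.contDiff.comp (contDiff_const.mul (contDiff_toComplex.pow k))
    exact (this.differentiable (by simp)) x
  have h4 := hd.hasFDerivAt.hasLineDerivAt (EuclideanSpace.single i (1 : ℝ))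
  simp only [pderiv]
  refine (h4 : HasDerivAt _ _ _).unique ?_
  have h5 : HasDerivAt (fun t : ℝ => (e * toComplex (x + t • EuclideanSpace.single i (1 : ℝ)) ^ k).re)
      (e * (k * toComplex (x + (0 : ℝ) • EuclideanSpace.single i (1 : ℝ)) ^ (k - 1)
        * ![1, Complex.I] i)).re 0 := h3
  rw [zero_smul, add_zero] at h5
  have h6 : e * (k * toComplex x ^ (k - 1) * ![1, Complex.I] i)
      = e * k * ![1, Complex.I] i * toComplex x ^ (k - 1) := by ring
  rwa [h6] at h5

/-- Harmonicity is `1² + I² = 0`, since each partial derivative multiplies by `1` or `I`. Taking `e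
= 1` and `e = -I` yields the cosine and sine harmonics. -/
theorem isSolidHarmonic_re (e : ℂ) (k : ℕ) (y : ℝ → ℝ) (hy : Continuous y)
    (hy1 : ∀ θ, |y θ| ≤ 1)
    (h : ∀ θ : ℝ, (e * (Real.cos θ + Real.sin θ * Complex.I) ^ k).re = y θ) :
    IsSolidHarmonic k (fun x => (e * toComplex x ^ k).re) y where
  contDiff := Complex.reCLM.contDiff.comp (contDiff_const.mul (contDiff_toComplex.pow k))
  lap_eq_zero x := by
    simp only [lap, Fin.sum_univ_two]
    have hp (i : Fin 2) : pderiv i (fun x => (e * toComplex x ^ k).re)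
        = fun x => ((e * k * ![1, Complex.I] i) * toComplex x ^ (k - 1)).re :=
      funext fun x => pderiv_re_mul_pow e k i x
    rw [hp, hp, pderiv_re_mul_pow, pderiv_re_mul_pow, ← Complex.add_re]
    have : e * k * ![1, Complex.I] 0 * ((k - 1 : ℕ) : ℂ) * ![1, Complex.I] 0
        * toComplex x ^ (k - 1 - 1)
        + e * k * ![1, Complex.I] 1 * ((k - 1 : ℕ) : ℂ) * ![1, Complex.I] 1
        * toComplex x ^ (k - 1 - 1) = 0 := by
      simp only [Matrix.cons_val_zero, Matrix.cons_val_one, mul_one]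
      linear_combination (e * k * ((k - 1 : ℕ) : ℂ) * toComplex x ^ (k - 1 - 1)) * Complex.I_mul_I
    rw [this, Complex.zero_re]
  euler x := by
    rw [pderiv_re_mul_pow, pderiv_re_mul_pow]
    rcases Nat.eq_zero_or_pos k with rfl | hk
    · simp
    · have hz : toComplex x ^ k = toComplex x * toComplex x ^ (k - 1) := by
        rw [← pow_succ', Nat.sub_add_cancel hk]
      have : (x 0 : ℂ) * (e * k * ![1, Complex.I] 0 * toComplex x ^ (k - 1))
          + (x 1 : ℂ) * (e * k * ![1, Complex.I] 1 * toComplex x ^ (k - 1))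
          = (k : ℂ) * (e * toComplex x ^ k) := by
        rw [hz]
        nth_rewrite 3 [toComplex]
        simp only [Matrix.cons_val_zero, Matrix.cons_val_one]
        ring
      have h2 := congrArg Complex.re this
      rw [Complex.add_re, Complex.re_ofReal_mul, Complex.re_ofReal_mul] at h2
      rw [h2, ← Complex.ofReal_natCast, Complex.re_ofReal_mul]
  polar_eq ρ θ := by
    have : toComplex (polar (ρ, θ)) = (√ρ : ℂ) * (Real.cos θ + Real.sin θ * Complex.I) := by
      simp only [toComplex, polar_apply_zero, polar_apply_one]
      push_cast
      ring
    rw [this, mul_pow, ← h θ, mul_left_comm, ← Complex.ofReal_pow, Complex.re_ofReal_mul]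
  continuous_angular := hy
  abs_le_one := hy1

theorem cos_add_sin_pow (k : ℕ) (θ : ℝ) :
    ((Real.cos θ : ℂ) + Real.sin θ * Complex.I) ^ k
      = Real.cos (k * θ) + Real.sin (k * θ) * Complex.I := by
  push_cast
  rw [Complex.cos_add_sin_mul_I_pow]

theorem exists_solidHarmonic_cos (k : ℕ) :
    ∃ Y, IsSolidHarmonic k Y (fun θ => Real.cos (k * θ)) :=
  ⟨_, isSolidHarmonic_re 1 k _ (by fun_prop) (fun _ => Real.abs_cos_le_one _) fun θ => by
    rw [cos_add_sin_pow, one_mul, Complex.add_re, Complex.ofReal_re, Complex.re_ofReal_mul]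
    simp⟩

theorem exists_solidHarmonic_sin (k : ℕ) :
    ∃ Y, IsSolidHarmonic k Y (fun θ => Real.sin (k * θ)) :=
  ⟨_, isSolidHarmonic_re (-Complex.I) k _ (by fun_prop) (fun _ => Real.abs_sin_le_one _) fun θ => by
    rw [cos_add_sin_pow]
    have : -Complex.I * (Real.cos (k * θ) + Real.sin (k * θ) * Complex.I)
        = (Real.sin (k * θ) : ℂ) + ((-Real.cos (k * θ) : ℝ) : ℂ) * Complex.I := by
      push_cast
      linear_combination (-(Complex.sin (k * θ))) * Complex.I_mul_I
    rw [this, Complex.add_re, Complex.ofReal_re, Complex.re_ofReal_mul]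
    simp⟩

theorem pderiv_radial_mul {ψ : ℝ → ℝ} (hψ : ContDiff ℝ ∞ ψ) {Y : Plane → ℝ}
    (hY : ContDiff ℝ ∞ Y) (i : Fin 2) (x : Plane) :
    pderiv i (fun x => ψ (normSq x) * Y x) x
      = ψ (normSq x) * pderiv i Y x + 2 * (x i * (deriv ψ (normSq x) * Y x)) := by
  have h1 : HasDerivAt ψ (deriv ψ (normSq x)) (normSq x) :=
    ((hψ.differentiable (by simp)) _).hasDerivAt
  have h2 : DifferentiableAt ℝ normSq x := (contDiff_normSq.differentiable (n := 1) (by simp)) x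
  have h3 : DifferentiableAt ℝ (fun x => ψ (normSq x)) x := h1.differentiableAt.comp x h2
  rw [pderiv_mul h3 ((hY.differentiable (by simp)) x),
    pderiv_comp h1 h2, pderiv_normSq]
  ring

/-- `ψ ΔY` vanishes, and Euler's identity turns the cross term `4 ψ' x · ∇Y` into `4 k ψ' Y`. -/
theorem IsSolidHarmonic.lap_radial_mul {k : ℕ} {Y : Plane → ℝ} {y : ℝ → ℝ}
    (hY : IsSolidHarmonic k Y y) {ψ : ℝ → ℝ} (hψ : ContDiff ℝ ∞ ψ) (x : Plane) :
    lap (fun x => ψ (normSq x) * Y x) x = Y x * (4 * normSq x * deriv (deriv ψ) (normSq x)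
      + 4 * (k + 1) * deriv ψ (normSq x)) := by
  have hψ' : ContDiff ℝ ∞ (deriv ψ) := (contDiff_infty_iff_deriv.1 hψ).2
  have hYi (i : Fin 2) : ContDiff ℝ ∞ (pderiv i Y) := contDiff_pderiv hY.contDiff (by simp) i
  have hd {φ : ℝ → ℝ} (hφ : ContDiff ℝ ∞ φ) {Z : Plane → ℝ} (hZ : ContDiff ℝ ∞ Z) :
      ContDiff ℝ ∞ (fun x => φ (normSq x) * Z x) := (hφ.comp contDiff_normSq).mul hZ
  have hdiff {Z : Plane → ℝ} (hZ : ContDiff ℝ ∞ Z) : DifferentiableAt ℝ Z x :=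
    (hZ.differentiable (by simp)) x
  have h2 (i : Fin 2) : pderiv i (pderiv i (fun x => ψ (normSq x) * Y x)) x
      = ψ (normSq x) * pderiv i (pderiv i Y) x + 4 * deriv ψ (normSq x) * (x i * pderiv i Y x)
        + 2 * deriv ψ (normSq x) * Y x + 4 * x i ^ 2 * deriv (deriv ψ) (normSq x) * Y x := by
    have e : pderiv i (fun x => ψ (normSq x) * Y x) = fun x =>
        ψ (normSq x) * pderiv i Y x + 2 * (x i * (deriv ψ (normSq x) * Y x)) :=
      funext fun x => pderiv_radial_mul hψ hY.contDiff i x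
    have hxi : ContDiff ℝ ∞ (fun x : Plane => x i) := by fun_prop
    have hm := hxi.mul (hd hψ' hY.contDiff)
    rw [e, pderiv_add (hdiff (hd hψ (hYi i))) (hdiff (contDiff_const.mul hm)),
      pderiv_radial_mul hψ (hYi i), pderiv_const_mul (hdiff hm),
      pderiv_mul (hdiff hxi) (hdiff (hd hψ' hY.contDiff)), pderiv_radial_mul hψ' hY.contDiff,
      pderiv_coord]
    simp only [if_true]
    ring
  have h0 := hY.lap_eq_zero x
  have h1 := hY.euler x
  simp only [lap, Fin.sum_univ_two] at h0 ⊢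
  rw [h2, h2]
  have h3 : normSq x = x 0 ^ 2 + x 1 ^ 2 := rfl
  linear_combination ψ (normSq x) * h0 + 4 * deriv ψ (normSq x) * h1
    - 4 * deriv (deriv ψ) (normSq x) * Y x * h3

/-- `v` is a distributional solution of `Δv + V(|x|²) v = 0`. -/
def IsWeakSol (V : ℝ → ℝ) (v : Plane → ℝ) : Prop :=
  ∀ φ : Plane → ℝ, ContDiff ℝ ∞ φ → HasCompactSupport φ →
    ∫ x, v x * (lap φ x + V (normSq x) * φ x) = 0

theorem hasCompactSupport_lap {φ : Plane → ℝ} (hc : HasCompactSupport φ) :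
    HasCompactSupport (lap φ) := by
  have h (i : Fin 2) : HasCompactSupport (pderiv i (pderiv i φ)) :=
    hasCompactSupport_pderiv (hasCompactSupport_pderiv hc i) i
  have : lap φ = pderiv 0 (pderiv 0 φ) + pderiv 1 (pderiv 1 φ) := by
    ext x; simp [lap, Fin.sum_univ_two]
  rw [this]
  exact (h 0).add (h 1)

theorem continuous_lap {φ : Plane → ℝ} (hφ : ContDiff ℝ ∞ φ) : Continuous (lap φ) := by
  unfold lap
  exact continuous_finsetSum _ fun i _ =>
    continuous_pderiv (contDiff_pderiv hφ (by simp) i) i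

theorem integrable_mul_test {v : Plane → ℝ} (hv : MemLp v 2 volume) {φ : Plane → ℝ}
    (hφ : Continuous φ) (hc : HasCompactSupport φ) : Integrable (fun x => v x * φ x) := by
  have h1 : LocallyIntegrable v volume := hv.locallyIntegrable (by norm_num)
  simpa [mul_comm] using h1.integrable_smul_left_of_hasCompactSupport hφ hc

/-- The angular moment of `v` against `y`. -/
noncomputable def moment (v : Plane → ℝ) (y : ℝ → ℝ) (ρ : ℝ) : ℝ :=
  ∫ θ in Ioc (-Real.pi) Real.pi, v (polar (ρ, θ)) * y θ

theorem IsSolidHarmonic.integrable_polar_mul {k : ℕ} {Y : Plane → ℝ} {y : ℝ → ℝ}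
    (hY : IsSolidHarmonic k Y y) {v : Plane → ℝ} (hv : MemLp v 2 volume) :
    ∀ᵐ ρ ∂(volume.restrict (Ioi (0 : ℝ))),
      Integrable (fun θ => v (polar (ρ, θ)) * y θ) angleMeasure ∧
      Integrable (fun θ => (v (polar (ρ, θ)) * y θ) ^ 2) angleMeasure ∧
      Integrable (fun θ => v (polar (ρ, θ)) ^ 2) angleMeasure := by
  have hv' := memLp_comp_polar hv
  filter_upwards [hv'.integrable_sq.prod_right_ae, hv'.aestronglyMeasurable.prodMk_left]
    with ρ h1 h2
  have h3 : MemLp (fun θ => v (polar (ρ, θ))) 2 angleMeasure :=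
    (memLp_two_iff_integrable_sq h2).2 h1
  have h4 : MemLp (fun θ => v (polar (ρ, θ)) * y θ) 2 angleMeasure := by
    refine h3.of_le (h2.mul hY.continuous_angular.aestronglyMeasurable) (ae_of_all _ fun θ => ?_)
    rw [norm_mul]
    exact mul_le_of_le_one_right (norm_nonneg _) (hY.abs_le_one θ)
  exact ⟨h4.integrable (by norm_num), h4.integrable_sq, h1⟩

/-- The angular moments of a square integrable function are square integrable. -/
theorem IsSolidHarmonic.integrableOn_moment_sq {k : ℕ} {Y : Plane → ℝ} {y : ℝ → ℝ}
    (hY : IsSolidHarmonic k Y y) {v : Plane → ℝ} (hv : MemLp v 2 volume) :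
    AEStronglyMeasurable (moment v y) (volume.restrict (Ioi 0)) ∧
    IntegrableOn (fun ρ => moment v y ρ ^ 2) (Ioi 0) := by
  have hv' := memLp_comp_polar hv
  have hmeas : AEStronglyMeasurable (moment v y) (volume.restrict (Ioi 0)) := by
    have h1 : AEStronglyMeasurable (fun z : ℝ × ℝ => v (polar z) * y z.2) polarMeasure :=
      hv'.aestronglyMeasurable.mul
        (hY.continuous_angular.comp continuous_snd).aestronglyMeasurable
    exact h1.integral_prod_right'
  refine ⟨hmeas, ?_⟩
  have hdom : Integrable (fun ρ => (2 * Real.pi) *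
      ∫ θ in Ioc (-Real.pi) Real.pi, v (polar (ρ, θ)) ^ 2) (volume.restrict (Ioi 0)) :=
    hv'.integrable_sq.integral_prod_left.const_mul _
  refine hdom.mono' (hmeas.pow 2) ?_
  filter_upwards [hY.integrable_polar_mul hv] with ρ h
  rw [Real.norm_of_nonneg (sq_nonneg _)]
  have h1 := sq_integral_le h.1 h.2.1
  have h2 : angleMeasure.real univ = 2 * Real.pi := by
    rw [measureReal_def, Measure.restrict_apply_univ, Real.volume_Ioc,
      ENNReal.toReal_ofReal (by linarith [Real.pi_pos])]
    ring
  rw [h2] at h1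
  refine h1.trans ?_
  have := Real.pi_pos
  refine mul_le_mul_of_nonneg_left (integral_mono h.2.1 h.2.2 fun θ => ?_) (by positivity)
  simp only [mul_pow]
  refine mul_le_of_le_one_right (sq_nonneg _) ?_
  rw [sq_le_one_iff_abs_le_one]
  exact hY.abs_le_one θ

/-- The weak equation for the angular moments. -/
theorem IsWeakSol.moment_eq {V : ℝ → ℝ} (hV : Continuous V) {v : Plane → ℝ}
    (hv : MemLp v 2 volume) (hw : IsWeakSol V v) {k : ℕ} {Y : Plane → ℝ} {y : ℝ → ℝ}
    (hY : IsSolidHarmonic k Y y) {ψ : ℝ → ℝ} (hψ : ContDiff ℝ ∞ ψ) (hψc : HasCompactSupport ψ) :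
    ∫ ρ in Ioi 0, (√ρ ^ k * moment v y ρ * (4 * ρ * deriv (deriv ψ) ρ + 4 * (k + 1) * deriv ψ ρ)
        + V ρ * (√ρ ^ k * moment v y ρ) * ψ ρ) = 0 := by
  set φ : Plane → ℝ := fun x => ψ (normSq x) * Y x with hφdef
  have hφ : ContDiff ℝ ∞ φ := (hψ.comp contDiff_normSq).mul hY.contDiff
  have hφc : HasCompactSupport φ := by
    obtain ⟨B, hB⟩ := hψc.isCompact.bddAbove
    refine HasCompactSupport.intro (isCompact_closedBall (0 : Plane) (√(max B 0)))
      fun x hx => ?_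
    have hx' : √(max B 0) < ‖x‖ := by simpa using hx
    have : ψ (normSq x) = 0 := by
      by_contra hne
      have h1 := hB (subset_tsupport _ hne)
      rw [normSq_eq] at h1
      have h2 := Real.le_sqrt_of_sq_le (h1.trans (le_max_left B 0))
      linarith
    simp [hφdef, this]
  have hcont : Continuous (fun x => lap φ x + V (normSq x) * φ x) :=
    (continuous_lap hφ).add ((hV.comp (contDiff_normSq (n := 1)).continuous).mul hφ.continuous)
  have hint := integrable_mul_test hv hcont ((hasCompactSupport_lap hφc).add hφc.mul_left)
  -- The test function is `ψ(|x|²) Y`. In polar coordinates `Y` contributes `√ρ ^ k` and its angular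
  -- part, so the angular integral leaves the moment.
  have h1 := integral_comp_polar hint
  rw [hw φ hφ hφc, mul_zero] at h1
  refine Eq.trans ?_ h1
  refine setIntegral_congr_fun (measurableSet_Ioi (a := (0 : ℝ))) fun ρ hρ => ?_
  have hρ : (0 : ℝ) < ρ := hρ
  simp only [hφdef, hY.lap_radial_mul hψ, normSq_polar hρ.le, hY.polar_eq]
  rw [moment]
  have : ∀ θ, v (polar (ρ, θ)) * (√ρ ^ k * y θ * (4 * ρ * deriv (deriv ψ) ρ
      + 4 * (k + 1) * deriv ψ ρ) + V ρ * (ψ ρ * (√ρ ^ k * y θ)))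
      = (v (polar (ρ, θ)) * y θ) * (√ρ ^ k * (4 * ρ * deriv (deriv ψ) ρ
      + 4 * (k + 1) * deriv ψ ρ) + V ρ * (ψ ρ * √ρ ^ k)) := fun θ => by ring
  simp only [this]
  rw [integral_mul_const]
  ring

/-! ### The angular modes as classical solutions -/

/-- The weak equation was solved by `w = √ρ ^ k` times the moment. Undoing this factor and setting
`ρ = r²` gives `u`, and the second function is `r u'`. -/
theorem isMode_of_moment {V w N : ℝ → ℝ} {k : ℕ}
    (hw : ∀ ρ, 0 < ρ → HasDerivAt w ((4 * k * w ρ - N ρ) / (4 * ρ)) ρ)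
    (hN : ∀ ρ, 0 < ρ → HasDerivAt N (V ρ * w ρ) ρ) :
    IsMode (fun r => k ^ 2 / r - r * V (r ^ 2)) (fun r => w (r ^ 2) / r ^ k)
      (fun r => (k * w (r ^ 2) - N (r ^ 2) / 2) / r ^ k) := by
  intro r hr
  have h0 : HasDerivAt (fun r : ℝ => r ^ 2) (2 * r) r := by simpa using hasDerivAt_pow 2 r
  have hw' : HasDerivAt (fun r => w (r ^ 2))
      ((4 * k * w (r ^ 2) - N (r ^ 2)) / (4 * r ^ 2) * (2 * r)) r :=
    (hw (r ^ 2) (by positivity)).comp r h0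
  have hN' : HasDerivAt (fun r => N (r ^ 2)) (V (r ^ 2) * w (r ^ 2) * (2 * r)) r :=
    (hN (r ^ 2) (by positivity)).comp r h0
  have hk : HasDerivAt (fun r : ℝ => r ^ k) (k * r ^ k / r) r := by
    convert! hasDerivAt_pow k r using 1
    rcases Nat.eq_zero_or_pos k with rfl | h
    · simp
    · have : r ^ k = r ^ (k - 1) * r := by rw [← pow_succ, Nat.sub_add_cancel h]
      rw [this]
      field_simp
  have hne : r ^ k ≠ 0 := (pow_pos hr k).ne'
  constructor
  · convert! hw'.div hk hne using 1
    field_simp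
    ring
  · convert! ((hw'.const_mul (k : ℝ)).sub (hN'.div_const 2)).div hk hne using 1
    simp only [Pi.sub_apply]
    field_simp
    ring

section Moments

variable {V : ℝ → ℝ} {C : ℝ} {v : Plane → ℝ} {k : ℕ} {Y : Plane → ℝ} {y : ℝ → ℝ}

theorem sqrt_pow_mul_integrableOn {μ : ℝ → ℝ}
    (hmeas : AEStronglyMeasurable μ (volume.restrict (Ioi 0)))
    (hsq : IntegrableOn (fun ρ => μ ρ ^ 2) (Ioi 0)) (k : ℕ) (R : ℝ) :
    IntegrableOn μ (Ioc 0 R) ∧ IntegrableOn (fun ρ => √ρ ^ k * μ ρ) (Ioc 0 R) := by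
  have h1 : IntegrableOn μ (Ioc 0 R) := by
    have : MemLp μ 2 (volume.restrict (Ioc 0 R)) :=
      ((memLp_two_iff_integrable_sq hmeas).2 hsq).mono_measure
        (Measure.restrict_mono Ioc_subset_Ioi_self le_rfl)
    exact this.integrable (by norm_num)
  refine ⟨h1, Integrable.bdd_mul (c := √R ^ k) h1 (by fun_prop) ?_⟩
  refine (ae_restrict_iff' measurableSet_Ioc).2 (ae_of_all _ fun ρ hρ => ?_)
  rw [Real.norm_of_nonneg (pow_nonneg (Real.sqrt_nonneg _) _)]
  gcongr
  exact hρ.2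

/-- The `L¹` norm of `μ` on `(0, r²)` is `o(r)` for square integrable `μ`. -/
theorem tendsto_integral_abs_div {μ : ℝ → ℝ}
    (hmeas : AEStronglyMeasurable μ (volume.restrict (Ioi 0)))
    (hsq : IntegrableOn (fun ρ => μ ρ ^ 2) (Ioi 0)) :
    Tendsto (fun r => (∫ t in Ioc 0 (r ^ 2), |μ t|) / r) (𝓝[>] 0) (𝓝 0) ∧
    ∃ G, ∀ r, 0 < r → (∫ t in Ioc 0 (r ^ 2), |μ t|) / r ≤ G := by
  have hI : ∀ r, 0 < r → (∫ t in Ioc 0 (r ^ 2), |μ t|) / r ≤ √(∫ t in Ioc 0 (r ^ 2), μ t ^ 2) := by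
    intro r hr
    have h1 := (sqrt_pow_mul_integrableOn hmeas hsq 0 (r ^ 2)).1.abs
    have h2 : IntegrableOn (fun t => |μ t| ^ 2) (Ioc 0 (r ^ 2)) := by
      simpa using hsq.mono_set Ioc_subset_Ioi_self
    -- Cauchy–Schwarz on an interval of length `r²`. The factor `r` it produces is the one divided
    -- out.
    have h3 := sq_integral_le h1 h2
    have h4 : (volume.restrict (Ioc 0 (r ^ 2))).real univ = r ^ 2 := by
      rw [measureReal_def, Measure.restrict_apply_univ, Real.volume_Ioc,
        sub_zero, ENNReal.toReal_ofReal (by positivity)]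
    rw [h4] at h3
    simp only [sq_abs] at h3
    rw [div_le_iff₀ hr]
    refine Real.le_sqrt_of_sq_le h3 |>.trans ?_
    rw [Real.sqrt_mul (by positivity), Real.sqrt_sq hr.le, mul_comm]
  constructor
  · have h1 : Tendsto (fun r : ℝ => ∫ t in Ioc 0 (r ^ 2), μ t ^ 2) (𝓝[>] 0) (𝓝 0) := by
      have hint : IntervalIntegrable (fun t => μ t ^ 2) volume 0 1 :=
        (intervalIntegrable_iff_integrableOn_Ioc_of_le zero_le_one).2
          (hsq.mono_set Ioc_subset_Ioi_self)
      have hc := (hint.absolutelyContinuousOnInterval_intervalIntegral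
        (c := 0) (by simp)).continuousOn 0 (by simp)
      rw [uIcc_of_le zero_le_one] at hc
      have hc' : Tendsto (fun x => ∫ t in (0 : ℝ)..x, μ t ^ 2) (𝓝[Icc 0 1] 0) (𝓝 0) := by
        simpa [ContinuousWithinAt] using hc
      have hp : Tendsto (fun r : ℝ => r ^ 2) (𝓝[>] 0) (𝓝[Icc 0 1] 0) := by
        refine tendsto_nhdsWithin_iff.2 ⟨?_, ?_⟩
        · exact ((continuous_pow 2).tendsto' (0 : ℝ) 0 (by simp)).mono_left nhdsWithin_le_nhds
        · filter_upwards [Ioc_mem_nhdsGT (zero_lt_one (α := ℝ))] with r hr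
          exact ⟨sq_nonneg r, pow_le_one₀ hr.1.le hr.2⟩
      refine (hc'.comp hp).congr fun r => ?_
      simp only [Function.comp_apply]
      rw [intervalIntegral.integral_of_le (sq_nonneg r)]
    have h2 := (Real.continuous_sqrt.tendsto 0).comp h1
    rw [Real.sqrt_zero] at h2
    refine squeeze_zero' ?_ ?_ h2
    · filter_upwards [self_mem_nhdsWithin] with r hr
      have : (0 : ℝ) < r := hr
      exact div_nonneg (setIntegral_nonneg measurableSet_Ioc fun t _ => abs_nonneg _) this.le
    · filter_upwards [self_mem_nhdsWithin] with r hr using hI r hr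
  · refine ⟨√(∫ t in Ioi 0, μ t ^ 2), fun r hr => (hI r hr).trans (Real.sqrt_le_sqrt ?_)⟩
    exact setIntegral_mono_set hsq (ae_of_all _ fun t => sq_nonneg _)
      (LE.le.eventuallyLE Ioc_subset_Ioi_self)

/-- The angular moment at angular momentum `k` of a square integrable weak solution of
`Δv + V(|x|²) v = 0` is, almost everywhere, a classical solution of the radial equation, with
controlled behaviour at the origin. -/
theorem IsWeakSol.exists_isMode (hV : Continuous V) (hVC : ∀ x, |V x| ≤ C)
    (hv : MemLp v 2 volume) (hw : IsWeakSol V v) (hY : IsSolidHarmonic k Y y) :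
    ∃ u z : ℝ → ℝ, IsMode (fun r => k ^ 2 / r - r * V (r ^ 2)) u z ∧
      (∀ᵐ ρ ∂(volume.restrict (Ioi (0 : ℝ))), moment v y ρ = u (√ρ)) ∧
      IntegrableOn (fun ρ => u (√ρ) ^ 2) (Ioi 0) ∧
      Tendsto (fun r => r * u r) (𝓝[>] 0) (𝓝 0) ∧ Tendsto (fun r => r * z r) (𝓝[>] 0) (𝓝 0) ∧
      (k = 0 → ∃ G, ∀ r, 0 < r → |z r| ≤ G * r) ∧
      (k = 0 → ∀ r, 0 < r → z r = -(∫ t in (0 : ℝ)..r ^ 2, V t * moment v y t) / 2) := by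
  obtain ⟨hmeas, hsq⟩ := hY.integrableOn_moment_sq hv
  set μ := moment v y with hμ
  have hint := sqrt_pow_mul_integrableOn hmeas hsq k
  have hC0 : 0 ≤ C := (abs_nonneg _).trans (hVC 0)
  obtain ⟨w, N, hae, hNdef, hwdef, hwd, hNd⟩ := exists_classical_of_weak hV hVC
    (fun R => (hint R).2) (fun ψ hψ hψc => hw.moment_eq hV hv hY hψ hψc)
  obtain ⟨hg0, G, hG⟩ := tendsto_integral_abs_div hmeas hsq
  set J : ℝ → ℝ := fun ρ => ∫ t in Ioc 0 ρ, |μ t| with hJ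
  have hJ0 : ∀ ρ, 0 ≤ J ρ := fun ρ => integral_nonneg fun t => abs_nonneg _
  have hJmono : ∀ s ρ, s ≤ ρ → J s ≤ J ρ := fun s ρ hsρ =>
    setIntegral_mono_set (hint ρ).1.abs (ae_of_all _ fun t => abs_nonneg _)
      (LE.le.eventuallyLE (Ioc_subset_Ioc_right hsρ))
  -- Since `√t ≤ √ρ` on the domain of integration, the factor `√ρ ^ k` comes out. It later cancels
  -- the division by `r ^ k`, leaving `J(r²) / r`, which tends to `0`.
  have hNb : ∀ ρ, 0 < ρ → |N ρ| ≤ C * √ρ ^ k * J ρ := by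
    intro ρ hρ
    rw [hNdef ρ hρ, intervalIntegral.integral_of_le hρ.le, hJ, ← integral_const_mul,
      ← Real.norm_eq_abs]
    refine norm_integral_le_of_norm_le (g := fun t => C * √ρ ^ k * |μ t|)
      ((hint ρ).1.abs.const_mul _) ?_
    refine (ae_restrict_iff' measurableSet_Ioc).2 (ae_of_all _ fun t ht => ?_)
    rw [Real.norm_eq_abs, abs_mul, abs_mul, abs_of_nonneg (by positivity : 0 ≤ √t ^ k), mul_assoc]
    gcongr
    · exact hVC t
    · exact ht.2
  have hwb : ∀ ρ, 0 < ρ → |4 * ρ * w ρ| ≤ (4 * (k + 1) + C * ρ) * √ρ ^ k * J ρ := by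
    intro ρ hρ
    rw [hwdef ρ hρ, intervalIntegral.integral_of_le hρ.le]
    have h1 : ∫ t in Ioc 0 ρ, (4 * (k + 1) * √ρ ^ k * |μ t| + C * √ρ ^ k * J ρ)
        = (4 * (k + 1) + C * ρ) * √ρ ^ k * J ρ := by
      rw [integral_add ((hint ρ).1.abs.const_mul _) (integrable_const _), integral_const_mul,
        setIntegral_const, measureReal_def, Real.volume_Ioc,
        ENNReal.toReal_ofReal (by linarith), smul_eq_mul]
      ring
    rw [← h1, ← Real.norm_eq_abs]
    refine norm_integral_le_of_norm_le
      (g := fun t => 4 * (k + 1) * √ρ ^ k * |μ t| + C * √ρ ^ k * J ρ)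
      (((hint ρ).1.abs.const_mul _).add (integrable_const _)) ?_
    refine (ae_restrict_iff' measurableSet_Ioc).2 (ae_of_all _ fun t ht => ?_)
    have ht0 : 0 < t := ht.1
    have hsq : √t ^ k ≤ √ρ ^ k := by
      gcongr
      exact ht.2
    refine (norm_sub_le _ _).trans (add_le_add ?_ ?_)
    · rw [Real.norm_eq_abs, abs_mul, abs_of_nonneg (by positivity : (0 : ℝ) ≤ 4 * (k + 1)), abs_mul,
        abs_of_nonneg (by positivity : 0 ≤ √t ^ k), ← mul_assoc]
      gcongr
    · refine (hNb t ht0).trans ?_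
      have := hJmono t ρ ht.2
      have := hJ0 t
      gcongr
  have hu : ∀ r, 0 < r → |r * (w (r ^ 2) / r ^ k)| ≤ (4 * (k + 1) + C * r ^ 2) * (J (r ^ 2) / r) := by
    intro r hr
    have h1 := hwb (r ^ 2) (by positivity)
    rw [Real.sqrt_sq hr.le, abs_mul, abs_of_pos (by positivity : 0 < 4 * r ^ 2)] at h1
    rw [abs_mul, abs_div, abs_of_pos hr, abs_of_pos (pow_pos hr k)]
    have h2 : r * (|w (r ^ 2)| / r ^ k) = (4 * r ^ 2 * |w (r ^ 2)|) / (4 * r * r ^ k) := by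
      field_simp
    rw [h2, div_le_iff₀ (by positivity)]
    refine h1.trans ?_
    have h3 : (4 * (k + 1) + C * r ^ 2) * (J (r ^ 2) / r) * (4 * r * r ^ k)
        = 4 * ((4 * (k + 1) + C * r ^ 2) * r ^ k * J (r ^ 2)) := by field_simp
    rw [h3]
    have : 0 ≤ (4 * (k + 1) + C * r ^ 2) * r ^ k * J (r ^ 2) := by
      have := hJ0 (r ^ 2)
      positivity
    linarith
  have hNr : ∀ r, 0 < r → |N (r ^ 2) / r ^ k| ≤ C * r * (J (r ^ 2) / r) := by
    intro r hr
    have h1 := hNb (r ^ 2) (by positivity)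
    rw [Real.sqrt_sq hr.le] at h1
    rw [abs_div, abs_of_pos (pow_pos hr k), div_le_iff₀ (pow_pos hr k)]
    refine h1.trans (le_of_eq ?_)
    field_simp
  have hid : Tendsto (fun r : ℝ => r) (𝓝[>] 0) (𝓝 0) := tendsto_id.mono_left nhdsWithin_le_nhds
  have hu0 : Tendsto (fun r => r * (w (r ^ 2) / r ^ k)) (𝓝[>] 0) (𝓝 0) := by
    have h1 := (((hid.pow 2).const_mul C).const_add (4 * ((k : ℝ) + 1))).mul hg0
    rw [mul_zero] at h1
    refine squeeze_zero_norm' ?_ h1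
    filter_upwards [self_mem_nhdsWithin] with r hr using hu r hr
  have hN0 : Tendsto (fun r => N (r ^ 2) / r ^ k) (𝓝[>] 0) (𝓝 0) := by
    have h1 := (hid.const_mul C).mul hg0
    rw [mul_zero] at h1
    refine squeeze_zero_norm' ?_ h1
    filter_upwards [self_mem_nhdsWithin] with r hr using hNr r hr
  have haeu : ∀ᵐ ρ ∂(volume.restrict (Ioi (0 : ℝ))), μ ρ = w (√ρ ^ 2) / √ρ ^ k := by
    filter_upwards [hae, ae_restrict_mem measurableSet_Ioi] with ρ h1 hρ
    have hρ : (0 : ℝ) < ρ := hρ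
    have : √ρ ^ k ≠ 0 := (pow_pos (Real.sqrt_pos.2 hρ) k).ne'
    rw [Real.sq_sqrt hρ.le, ← h1]
    field_simp
  refine ⟨fun r => w (r ^ 2) / r ^ k, fun r => (k * w (r ^ 2) - N (r ^ 2) / 2) / r ^ k,
    isMode_of_moment hwd hNd, haeu, ?_, hu0, ?_, ?_, ?_⟩
  · refine hsq.congr ?_
    filter_upwards [haeu] with ρ h
    rw [h]
  · have h1 := (hu0.const_mul (k : ℝ)).sub ((hid.mul hN0).div_const 2)
    simp only [mul_zero, zero_div, sub_zero] at h1
    refine h1.congr fun r => ?_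
    ring
  · rintro rfl
    refine ⟨C * G / 2, fun r hr => ?_⟩
    have h1 := hNr r hr
    have h2 := hG r hr
    simp only [pow_zero, div_one, Nat.cast_zero, zero_mul, zero_sub, abs_neg, abs_div] at h1 ⊢
    rw [abs_of_pos (by norm_num : (0 : ℝ) < 2)]
    have h3 : C * r * (J (r ^ 2) / r) ≤ C * r * G := by gcongr
    linarith
  · rintro rfl r hr
    simp only [pow_zero, div_one, Nat.cast_zero, zero_mul, zero_sub]
    rw [hNdef _ (by positivity)]
    simp only [pow_zero, one_mul]
    ring

/-- A regular radial solution either vanishes or has no zeros near the origin. -/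
theorem eq_zero_or_ne_zero_near_zero (hVC : ∀ x, |V x| ≤ C)
    {u z μ : ℝ → ℝ} {c : ℝ → ℝ} (hc : ContinuousOn c (Ioi 0)) (hm : IsMode c u z)
    (hμ : ∀ᵐ ρ ∂(volume.restrict (Ioi (0 : ℝ))), μ ρ = u (√ρ))
    {G : ℝ} (hG : ∀ r, 0 < r → |z r| ≤ G * r)
    (hz : ∀ r, 0 < r → z r = -(∫ t in (0 : ℝ)..r ^ 2, V t * μ t) / 2) :
    (∃ B, ∀ r, 0 < r → r ≤ 1 → |u r| ≤ B) ∧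
    ((∀ r, 0 < r → u r = 0) ∨ ∃ r₀, 0 < r₀ ∧ ∀ r, 0 < r → r ≤ r₀ → u r ≠ 0) := by
  have hC0 : 0 ≤ C := (abs_nonneg _).trans (hVC 0)
  have hmv {D r s : ℝ} (hr : 0 < r) (hrs : r ≤ s)
      (hD : ∀ x ∈ Icc r s, |z x / x| ≤ D) : |u s - u r| ≤ D * (s - r) := by
    have := (convex_Icc r s).norm_image_sub_le_of_norm_hasDerivWithin_le
      (f := u) (f' := fun x => z x / x) (C := D)
      (fun x hx => (hm x (hr.trans_le hx.1)).1.hasDerivWithinAt) (fun x hx => hD x hx)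
      (left_mem_Icc.2 hrs) (right_mem_Icc.2 hrs)
    rwa [Real.norm_eq_abs, Real.norm_eq_abs, abs_of_nonneg (sub_nonneg.2 hrs)] at this
  have hB : ∀ r, 0 < r → r ≤ 1 → |u r| ≤ |u 1| + |G| := by
    intro r hr hr1
    have h1 : |u 1 - u r| ≤ |G| * (1 - r) := hmv hr hr1 fun x hx => by
      have hx0 := hr.trans_le hx.1
      rw [abs_div, abs_of_pos hx0, div_le_iff₀ hx0]
      exact (hG x hx0).trans (by gcongr; exact le_abs_self G)
    have h2 : |G| * (1 - r) ≤ |G| := mul_le_of_le_one_right (abs_nonneg _) (by linarith)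
    have h3 := abs_sub_abs_le_abs_sub (u r) (u 1)
    rw [abs_sub_comm] at h3
    linarith
  refine ⟨⟨_, hB⟩, ?_⟩
  by_contra! hcon
  obtain ⟨⟨r', hr', hne⟩, hacc⟩ := hcon
  -- If zeros accumulate at the origin, take one at `s ≤ 1` with `C s ≤ 1`. A bound on `u` over `(0,
  -- s]` can then be halved again and again.
  obtain ⟨s, hs, hs1, hus⟩ := hacc (min 1 (1 / (C + 1))) (by positivity)
  have hsle1 : s ≤ 1 := hs1.trans (min_le_left _ _)
  have hCs : C * s ≤ 1 := by
    have := hs1.trans (min_le_right _ _)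
    rw [le_div_iff₀ (by positivity)] at this
    nlinarith
  have hstep : ∀ S, 0 ≤ S → (∀ r, 0 < r → r ≤ s → |u r| ≤ S) →
      ∀ r, 0 < r → r ≤ s → |u r| ≤ S / 2 := by
    intro S hS0 hS r hr hrs
    have hzS : ∀ x, 0 < x → x ≤ s → |z x| ≤ C * S * x ^ 2 / 2 := by
      intro x hx hxs
      rw [hz x hx, abs_div, abs_neg, abs_of_pos (by norm_num : (0 : ℝ) < 2)]
      have h1 : ‖∫ t in (0 : ℝ)..x ^ 2, V t * μ t‖ ≤ C * S * |x ^ 2 - 0| := by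
        refine intervalIntegral.norm_integral_le_of_norm_le_const_ae ?_
        filter_upwards [(ae_restrict_iff' measurableSet_Ioi).1 hμ] with t ht ht'
        rw [uIoc_of_le (sq_nonneg x)] at ht'
        rw [ht ht'.1, norm_mul]
        have : √t ≤ s := (Real.sqrt_le_iff.2 ⟨hx.le, ht'.2⟩).trans hxs
        gcongr
        · exact hVC t
        · exact hS _ (Real.sqrt_pos.2 ht'.1) this
      rw [sub_zero, abs_of_nonneg (sq_nonneg x), Real.norm_eq_abs] at h1
      gcongr
    -- Here `|u'| = |z / x| ≤ C S x / 2 ≤ S / 2`, and `u` vanishes at `s ≤ 1`.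
    have h1 := hmv hr hrs (D := S / 2) fun x hx => by
      have hx0 := hr.trans_le hx.1
      rw [abs_div, abs_of_pos hx0, div_le_iff₀ hx0]
      refine (hzS x hx0 hx.2).trans ?_
      have : C * x ≤ 1 := le_trans (by gcongr; exact hx.2) hCs
      nlinarith [mul_nonneg hS0 hx0.le]
    rw [hus, zero_sub, abs_neg] at h1
    refine h1.trans ?_
    exact mul_le_of_le_one_right (by positivity) (by linarith)
  have hall : ∀ n : ℕ, ∀ r, 0 < r → r ≤ s → |u r| ≤ (|u 1| + |G|) * (1 / 2) ^ n := by
    intro n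
    induction n with
    | zero => intro r hr hrs; simpa using hB r hr (hrs.trans hsle1)
    | succ n ih =>
      intro r hr hrs
      refine (hstep _ (by positivity) ih r hr hrs).trans (le_of_eq ?_)
      ring
  have hzero : ∀ r, 0 < r → r ≤ s → u r = 0 := by
    intro r hr hrs
    have h1 : Tendsto (fun n : ℕ => (|u 1| + |G|) * (1 / 2) ^ n) atTop (𝓝 0) := by
      simpa using (tendsto_pow_atTop_nhds_zero_of_lt_one (r := (1 / 2 : ℝ)) (by norm_num)
        (by norm_num)).const_mul (|u 1| + |G|)
    have := ge_of_tendsto' h1 fun n => hall n r hr hrs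
    exact abs_eq_zero.1 (le_antisymm this (abs_nonneg _))
  -- `u` vanishes on a whole interval, so its Cauchy data at the midpoint are zero and uniqueness
  -- gives `u = 0` on `(0, ∞)`.
  have hs2 : 0 < s / 2 := by positivity
  have hz0 : z (s / 2) = 0 := by
    have h1 : HasDerivAt u 0 (s / 2) := by
      refine (hasDerivAt_const (s / 2) (0 : ℝ)).congr_of_eventuallyEq ?_
      filter_upwards [Ioo_mem_nhds hs2 (by linarith : s / 2 < s)] with x hx
        using hzero x hx.1 hx.2.le
    have := (hm _ hs2).1.unique h1
    rwa [div_eq_zero_iff, or_iff_left hs2.ne'] at this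
  exact hne (hm.eq_zero hc hs2 (hzero _ hs2 (by linarith)) hz0 hr').1

end Moments

/-! ### The kernel among square integrable functions -/

section Kernel

variable {f f' q p : ℝ → ℝ} {a b : ℝ} {V : ℝ → ℝ} {C : ℝ} {v : Plane → ℝ} {k : ℕ} {Y : Plane → ℝ}
  {y : ℝ → ℝ}

/-- For `k ≥ 2` this is the Sturm comparison. For `k = 0` a nonzero mode would have no zeros near
the origin, which radial non-degeneracy excludes. -/
theorem IsProfile.moment_eq_zero (h : IsProfile f f' a b q p) (hV : Continuous V)
    (hVC : ∀ x, |V x| ≤ C) (hVq : ∀ r, 0 < r → V (r ^ 2) = f' (q r)) (hv : MemLp v 2 volume)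
    (hw : IsWeakSol V v) (hY : IsSolidHarmonic k Y y) (hk : k ≠ 1) :
    ∀ᵐ ρ ∂(volume.restrict (Ioi (0 : ℝ))), moment v y ρ = 0 := by
  obtain ⟨u, z, hm, hae, hint, hu0, hz0, hG, hz⟩ := hw.exists_isMode hV hVC hv hY
  replace hm : IsMode (modeCoeff f' q k) u z := fun r hr => by
    rw [modeCoeff, ← hVq r hr]; exact hm r hr
  have hu : ∀ r, 0 < r → u r = 0 := by
    rcases Nat.lt_or_ge k 2 with hlt | hge
    · obtain rfl : k = 0 := by omega
      obtain ⟨G, hG⟩ := hG rfl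
      obtain ⟨⟨B, hB⟩, h1 | ⟨r₀, hr₀, hne⟩⟩ := eq_zero_or_ne_zero_near_zero hVC
        (h.continuousOn_modeCoeff 0) hm hae hG (hz rfl)
      · exact h1
      · have hzlim : Tendsto z (𝓝[>] 0) (𝓝 0) := by
          have h1 : Tendsto (fun r => G * r) (𝓝[>] 0) (𝓝 0) :=
            ((continuous_const.mul continuous_id).tendsto' 0 0 (by simp)).mono_left
              nhdsWithin_le_nhds
          refine squeeze_zero_norm' ?_ h1
          filter_upwards [self_mem_nhdsWithin] with r hr using hG r hr
        exact (h.not_ne_zero_near_zero hm hint hB hzlim hr₀ hne).elim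
    · exact fun r hr => h.eq_zero_of_two_le hge hm hint hu0 hz0 hr
  filter_upwards [hae, ae_restrict_mem measurableSet_Ioi] with ρ h1 hρ
  rw [h1, hu _ (Real.sqrt_pos.2 hρ)]

theorem IsProfile.exists_moment_eq (h : IsProfile f f' a b q p) (hV : Continuous V)
    (hVC : ∀ x, |V x| ≤ C) (hVq : ∀ r, 0 < r → V (r ^ 2) = f' (q r)) (hv : MemLp v 2 volume)
    (hw : IsWeakSol V v) (hY : IsSolidHarmonic 1 Y y) :
    ∃ c, ∀ᵐ ρ ∂(volume.restrict (Ioi (0 : ℝ))), moment v y ρ = c * p (√ρ) := by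
  obtain ⟨u, z, hm, hae, hint, -⟩ := hw.exists_isMode hV hVC hv hY
  replace hm : IsMode (modeCoeff f' q 1) u z := fun r hr => by
    rw [modeCoeff, ← hVq r hr]; exact hm r hr
  obtain ⟨c, hc⟩ := h.exists_eq_mul hm hint
  refine ⟨c, ?_⟩
  filter_upwards [hae, ae_restrict_mem measurableSet_Ioi] with ρ h1 hρ
  rw [h1, hc _ (Real.sqrt_pos.2 hρ)]

theorem IsWeakSol.sub_smul {v d : Plane → ℝ} (hV : Continuous V) (hv : MemLp v 2 volume)
    (hd : MemLp d 2 volume) (h : IsWeakSol V v) (h' : IsWeakSol V d) (c : ℝ) :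
    IsWeakSol V (fun x => v x - c * d x) := by
  intro φ hφ hφc
  have hcont : Continuous (fun x => lap φ x + V (normSq x) * φ x) :=
    (continuous_lap hφ).add ((hV.comp (contDiff_normSq (n := 1)).continuous).mul hφ.continuous)
  have hcs : HasCompactSupport (fun x => lap φ x + V (normSq x) * φ x) :=
    (hasCompactSupport_lap hφc).add hφc.mul_left
  have e : ∀ x, (v x - c * d x) * (lap φ x + V (normSq x) * φ x)
      = v x * (lap φ x + V (normSq x) * φ x) - c * (d x * (lap φ x + V (normSq x) * φ x)) :=
    fun x => by ring
  simp only [e]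
  rw [integral_sub (integrable_mul_test hv hcont hcs)
    ((integrable_mul_test hd hcont hcs).const_mul c), integral_const_mul, h φ hφ hφc, h' φ hφ hφc]
  simp

theorem IsSolidHarmonic.moment_sub_smul (hY : IsSolidHarmonic k Y y) {v d : Plane → ℝ}
    (hv : MemLp v 2 volume) (hd : MemLp d 2 volume) (c : ℝ) :
    ∀ᵐ ρ ∂(volume.restrict (Ioi (0 : ℝ))),
      moment (fun x => v x - c * d x) y ρ = moment v y ρ - c * moment d y ρ := by
  filter_upwards [hY.integrable_polar_mul hv, hY.integrable_polar_mul hd] with ρ h1 h2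
  have e : ∀ θ, (v (polar (ρ, θ)) - c * d (polar (ρ, θ))) * y θ
      = v (polar (ρ, θ)) * y θ - c * (d (polar (ρ, θ)) * y θ) := fun θ => by ring
  simp only [moment, e]
  rw [integral_sub h1.1 (h2.1.const_mul c), integral_const_mul]

theorem integral_cos_mul_cos : ∫ θ in Ioc (-Real.pi) Real.pi, Real.cos θ * Real.cos θ = Real.pi := by
  rw [← intervalIntegral.integral_of_le (by linarith [Real.pi_pos])]
  have := integral_cos_sq (a := -Real.pi) (b := Real.pi)
  simp only [sq] at this
  rw [this]
  simp

theorem integral_sin_mul_sin : ∫ θ in Ioc (-Real.pi) Real.pi, Real.sin θ * Real.sin θ = Real.pi := by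
  rw [← intervalIntegral.integral_of_le (by linarith [Real.pi_pos])]
  have := integral_sin_sq (a := -Real.pi) (b := Real.pi)
  simp only [sq] at this
  rw [this]
  simp

theorem integral_sin_mul_cos : ∫ θ in Ioc (-Real.pi) Real.pi, Real.sin θ * Real.cos θ = 0 := by
  rw [← intervalIntegral.integral_of_le (by linarith [Real.pi_pos]), integral_sin_mul_cos₁]
  simp

/-- Every square integrable weak solution of the linearized equation is a linear combination of
`d₀ = q'(r) cos θ` and `d₁ = q'(r) sin θ`. -/
theorem IsProfile.exists_ae_eq (h : IsProfile f f' a b q p) (hV : Continuous V)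
    (hVC : ∀ x, |V x| ≤ C) (hVq : ∀ r, 0 < r → V (r ^ 2) = f' (q r)) {d₀ d₁ : Plane → ℝ}
    (hd₀ : MemLp d₀ 2 volume) (hd₁ : MemLp d₁ 2 volume)
    (hw₀ : IsWeakSol V d₀) (hw₁ : IsWeakSol V d₁)
    (hp₀ : ∀ ρ, 0 < ρ → ∀ θ, d₀ (polar (ρ, θ)) = p (√ρ) * Real.cos θ)
    (hp₁ : ∀ ρ, 0 < ρ → ∀ θ, d₁ (polar (ρ, θ)) = p (√ρ) * Real.sin θ)
    (hv : MemLp v 2 volume) (hw : IsWeakSol V v) :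
    ∃ c₀ c₁ : ℝ, ∀ᵐ x, v x = c₀ * d₀ x + c₁ * d₁ x := by
  have hpi := Real.pi_pos.ne'
  obtain ⟨Yc, hYc⟩ := exists_solidHarmonic_cos 1
  obtain ⟨Ys, hYs⟩ := exists_solidHarmonic_sin 1
  obtain ⟨c, hc⟩ := h.exists_moment_eq hV hVC hVq hv hw hYc
  obtain ⟨s, hs⟩ := h.exists_moment_eq hV hVC hVq hv hw hYs
  simp only [Nat.cast_one, one_mul] at hYc hYs hc hs
  have m0c : ∀ ρ, 0 < ρ → moment d₀ (fun θ => Real.cos θ) ρ = Real.pi * p (√ρ) := fun ρ hρ => by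
    simp only [moment, hp₀ ρ hρ, mul_assoc]
    rw [integral_const_mul, integral_cos_mul_cos, mul_comm]
  have m0s : ∀ ρ, 0 < ρ → moment d₀ (fun θ => Real.sin θ) ρ = 0 := fun ρ hρ => by
    simp only [moment, hp₀ ρ hρ, mul_assoc, mul_comm (Real.cos _)]
    rw [integral_const_mul, integral_sin_mul_cos, mul_zero]
  have m1c : ∀ ρ, 0 < ρ → moment d₁ (fun θ => Real.cos θ) ρ = 0 := fun ρ hρ => by
    simp only [moment, hp₁ ρ hρ, mul_assoc]
    rw [integral_const_mul, integral_sin_mul_cos, mul_zero]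
  have m1s : ∀ ρ, 0 < ρ → moment d₁ (fun θ => Real.sin θ) ρ = Real.pi * p (√ρ) := fun ρ hρ => by
    simp only [moment, hp₁ ρ hρ, mul_assoc]
    rw [integral_const_mul, integral_sin_mul_sin, mul_comm]
  -- The first moments of `v` are `c p` and `s p`, while those of `d₀` and `d₁` are `π p`, as `cos²`
  -- and `sin²` integrate to `π`. The subtraction removes the modes `k = 1`; all others vanish
  -- already.
  set w₀ : Plane → ℝ := fun x => v x - c / Real.pi * d₀ x with hw₀def
  have hw₀L : MemLp w₀ 2 volume := hv.sub (hd₀.const_mul _)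
  have hw₀W : IsWeakSol V w₀ := hw.sub_smul hV hv hd₀ hw₀ _
  set w : Plane → ℝ := fun x => w₀ x - s / Real.pi * d₁ x with hwdef
  have hwL : MemLp w 2 volume := hw₀L.sub (hd₁.const_mul _)
  have hwW : IsWeakSol V w := hw₀W.sub_smul hV hw₀L hd₁ hw₁ _
  have hzero : w =ᵐ[volume] 0 := by
    refine ae_eq_zero_of_angular hwL (fun k => ?_) (fun k => ?_)
    · obtain ⟨Y, hY⟩ := exists_solidHarmonic_cos k
      rcases eq_or_ne k 1 with rfl | hk
      · simp only [Nat.cast_one, one_mul]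
        filter_upwards [hc, hYc.moment_sub_smul hv hd₀ (c / Real.pi),
          hYc.moment_sub_smul hw₀L hd₁ (s / Real.pi), ae_restrict_mem measurableSet_Ioi]
          with ρ h1 h2 h3 hρ
        have h4 : moment w (fun θ => Real.cos θ) ρ = 0 := by
          rw [h3, h2, h1, m0c ρ hρ, m1c ρ hρ]
          field_simp
          ring
        exact h4
      · exact h.moment_eq_zero hV hVC hVq hwL hwW hY hk
    · obtain ⟨Y, hY⟩ := exists_solidHarmonic_sin k
      rcases eq_or_ne k 1 with rfl | hk
      · simp only [Nat.cast_one, one_mul]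
        filter_upwards [hs, hYs.moment_sub_smul hv hd₀ (c / Real.pi),
          hYs.moment_sub_smul hw₀L hd₁ (s / Real.pi), ae_restrict_mem measurableSet_Ioi]
          with ρ h1 h2 h3 hρ
        have h4 : moment w (fun θ => Real.sin θ) ρ = 0 := by
          rw [h3, h2, h1, m0s ρ hρ, m1s ρ hρ]
          field_simp
          ring
        exact h4
      · exact h.moment_eq_zero hV hVC hVq hwL hwW hY hk
  refine ⟨c / Real.pi, s / Real.pi, ?_⟩
  filter_upwards [hzero] with x hx
  simp only [hwdef, hw₀def, Pi.zero_apply] at hx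
  linarith

end Kernel

/-! ### Calculus of partial derivatives in the plane -/

theorem fderiv_apply_eq_pderiv (k : Plane → ℝ) (x v : Plane) :
    fderiv ℝ k x v = v 0 * pderiv 0 k x + v 1 * pderiv 1 k x := by
  have hv : v = v 0 • EuclideanSpace.single (0 : Fin 2) (1 : ℝ)
      + v 1 • EuclideanSpace.single (1 : Fin 2) (1 : ℝ) := by
    ext i; fin_cases i <;> simp
  conv_lhs => rw [hv]
  simp [pderiv]

theorem contDiff_one_of_pderiv {k : Plane → ℝ} {k' : Fin 2 → Plane → ℝ}
    (hk' : ∀ i, Continuous (k' i))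
    (h : ∀ x, HasFDerivAt k (k' 0 x • (EuclideanSpace.proj 0 : Plane →L[ℝ] ℝ)
      + k' 1 x • (EuclideanSpace.proj 1 : Plane →L[ℝ] ℝ)) x) : ContDiff ℝ 1 k := by
  rw [contDiff_one_iff_fderiv]
  refine ⟨fun x => (h x).differentiableAt, ?_⟩
  rw [funext fun x => (h x).fderiv]
  have h0 := hk' 0
  have h1 := hk' 1
  fun_prop

theorem continuous_pderiv_one {k : Plane → ℝ} (hk : ContDiff ℝ 1 k) (i : Fin 2) :
    Continuous (pderiv i k) := (contDiff_pderiv hk (m := 0) (by simp) i).continuous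

theorem laplacian_eq_lap {u : Plane → ℝ} (hu : ContDiff ℝ 2 u) (x : Plane) :
    Laplacian.laplacian u x = lap u x := by
  rw [laplacian_eq_iteratedFDeriv_orthonormalBasis u (EuclideanSpace.basisFun (Fin 2) ℝ), lap]
  refine Finset.sum_congr rfl fun i _ => ?_
  rw [iteratedFDeriv_two_apply]
  have h1 : DifferentiableAt ℝ (fderiv ℝ u) x :=
    (hu.fderiv_right (m := 1) (by norm_num)).differentiable (by simp) x
  have h2 := h1.hasFDerivAt.clm_apply
    (hasFDerivAt_const (EuclideanSpace.single i (1 : ℝ)) x)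
  have h3 : pderiv i (pderiv i u) x = fderiv ℝ (fun y => fderiv ℝ u y
    (EuclideanSpace.single i (1 : ℝ))) x (EuclideanSpace.single i (1 : ℝ)) := rfl
  rw [h3, h2.fderiv]
  simp

/-! ### Radial means -/

/-- `∫₀¹ tⁿ k(tx) dt`. -/
noncomputable def radialMean (n : ℕ) (k : Plane → ℝ) (x : Plane) : ℝ :=
  ∫ t in (0 : ℝ)..1, t ^ n * k (t • x)

theorem continuous_radialMean (n : ℕ) {k : Plane → ℝ} (hk : Continuous k) :
    Continuous (radialMean n k) := by
  unfold radialMean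
  exact intervalIntegral.continuous_parametric_intervalIntegral_of_continuous'
    (by fun_prop) 0 1

theorem radialMean_coord_mul (n : ℕ) (k : Plane → ℝ) (i : Fin 2) (x : Plane) :
    radialMean n (fun x => x i * k x) x = x i * radialMean (n + 1) k x := by
  rw [radialMean, radialMean, ← intervalIntegral.integral_const_mul]
  congr 1
  ext t
  rw [PiLp.smul_apply, smul_eq_mul]
  ring

/-- Differentiation under the integral sign; the chain rule for `k(t x)` supplies one more factor
`t`. -/
theorem hasFDerivAt_radialMean (n : ℕ) {k : Plane → ℝ} (hk : ContDiff ℝ 1 k) (x : Plane) :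
    HasFDerivAt (radialMean n k)
      (radialMean (n + 1) (pderiv 0 k) x • (EuclideanSpace.proj 0 : Plane →L[ℝ] ℝ)
        + radialMean (n + 1) (pderiv 1 k) x • (EuclideanSpace.proj 1 : Plane →L[ℝ] ℝ)) x := by
  set D : Plane → ℝ → Plane →L[ℝ] ℝ := fun x t => t ^ (n + 1) • fderiv ℝ k (t • x) with hD
  have hfc : Continuous (fderiv ℝ k) := hk.continuous_fderiv (by simp)
  have hkc := hk.continuous
  have hDc : Continuous (fun z : Plane × ℝ => D z.1 z.2) := by
    simp only [hD]; fun_prop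
  obtain ⟨M, hM⟩ := ((isCompact_closedBall x 1).prod (isCompact_Icc (a := (0 : ℝ)) (b := 1)))
    |>.exists_bound_of_continuousOn hDc.continuousOn
  have h := intervalIntegral.hasFDerivAt_integral_of_dominated_of_fderiv_le (𝕜 := ℝ) (μ := volume)
    (F := fun x t => t ^ n * k (t • x)) (F' := D) (x₀ := x) (a := 0) (b := 1)
    (bound := fun _ => M) (s := Metric.ball x 1) (Metric.ball_mem_nhds x one_pos)
    (Eventually.of_forall fun y => (by fun_prop : Continuous fun t : ℝ =>
      t ^ n * k (t • y)).aestronglyMeasurable)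
    ((by fun_prop : Continuous fun t : ℝ => t ^ n * k (t • x)).intervalIntegrable _ _)
    ((hDc.comp (Continuous.prodMk_right x)).aestronglyMeasurable)
    (Eventually.of_forall fun t ht y hy => hM (y, t) ⟨Metric.ball_subset_closedBall hy, by
      rw [uIoc_of_le zero_le_one] at ht; exact Ioc_subset_Icc_self ht⟩)
    (by simp)
    (Eventually.of_forall fun t ht y hy => by
      have h1 : HasFDerivAt (fun y : Plane => t • y) (t • ContinuousLinearMap.id ℝ Plane) y :=
        (hasFDerivAt_id y).const_smul t
      have h2 := (((hk.differentiable (by simp)) (t • y)).hasFDerivAt.comp y h1).const_mul (t ^ n)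
      refine h2.congr_fderiv ?_
      ext v
      simp only [hD]
      simp
      ring)
  refine h.congr_fderiv ?_
  ext v
  have hi : IntervalIntegrable (D x) volume 0 1 :=
    (hDc.comp (Continuous.prodMk_right x)).intervalIntegrable _ _
  rw [ContinuousLinearMap.intervalIntegral_apply hi]
  have h0 := continuous_pderiv_one hk 0
  have h1 := continuous_pderiv_one hk 1
  have e : (fun t => D x t v) = fun t => v 0 * (t ^ (n + 1) * pderiv 0 k (t • x))
      + v 1 * (t ^ (n + 1) * pderiv 1 k (t • x)) := by
    funext t
    simp only [hD, _root_.smul_apply, smul_eq_mul, fderiv_apply_eq_pderiv]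
    ring
  rw [e, intervalIntegral.integral_add ((by fun_prop : Continuous _).intervalIntegrable _ _)
    ((by fun_prop : Continuous _).intervalIntegrable _ _), intervalIntegral.integral_const_mul,
    intervalIntegral.integral_const_mul]
  simp [radialMean, mul_comm]

theorem contDiff_radialMean (n : ℕ) {k : Plane → ℝ} (hk : ContDiff ℝ 1 k) :
    ContDiff ℝ 1 (radialMean n k) :=
  contDiff_one_of_pderiv (k' := fun i => radialMean (n + 1) (pderiv i k))
    (fun i => continuous_radialMean _ (continuous_pderiv_one hk i)) (hasFDerivAt_radialMean n hk)

theorem pderiv_radialMean (n : ℕ) {k : Plane → ℝ} (hk : ContDiff ℝ 1 k) (i : Fin 2) (x : Plane) :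
    pderiv i (radialMean n k) x = radialMean (n + 1) (pderiv i k) x := by
  rw [pderiv, (hasFDerivAt_radialMean n hk x).fderiv]
  fin_cases i <;> simp

theorem hasDerivAt_ray {k : Plane → ℝ} (hk : Differentiable ℝ k) (x : Plane) (t : ℝ) :
    HasDerivAt (fun t : ℝ => k (t • x))
      (x 0 * pderiv 0 k (t • x) + x 1 * pderiv 1 k (t • x)) t := by
  have h1 : HasDerivAt (fun t : ℝ => t • x) x t := by
    simpa using (hasDerivAt_id t).smul_const x
  have h2 := (hk (t • x)).hasFDerivAt.comp_hasDerivAt t h1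
  rwa [fderiv_apply_eq_pderiv] at h2

/-- Integrate the derivative of `tⁿ⁺¹ k(t x)` over `[0, 1]`. -/
theorem euler_radialMean (n : ℕ) {k : Plane → ℝ} (hk : ContDiff ℝ 1 k) (x : Plane) :
    x 0 * pderiv 0 (radialMean n k) x + x 1 * pderiv 1 (radialMean n k) x
      = k x - (n + 1) * radialMean n k x := by
  have hc := hk.continuous
  have h0 := continuous_pderiv_one hk 0
  have h1 := continuous_pderiv_one hk 1
  have h := intervalIntegral.integral_eq_sub_of_hasDerivAt (a := 0) (b := 1)
    (f := fun t : ℝ => t ^ (n + 1) * k (t • x))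
    (f' := fun t => (n + 1) * (t ^ n * k (t • x)) + (x 0 * (t ^ (n + 1) * pderiv 0 k (t • x))
      + x 1 * (t ^ (n + 1) * pderiv 1 k (t • x))))
    (fun t _ => by
      convert! (hasDerivAt_pow (n + 1) t).mul (hasDerivAt_ray (hk.differentiable (by simp)) x t)
        using 1
      push_cast
      ring)
    ((by fun_prop : Continuous _).intervalIntegrable _ _)
  rw [intervalIntegral.integral_add ((by fun_prop : Continuous _).intervalIntegrable _ _)
    ((by fun_prop : Continuous _).intervalIntegrable _ _),
    intervalIntegral.integral_add ((by fun_prop : Continuous _).intervalIntegrable _ _)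
    ((by fun_prop : Continuous _).intervalIntegrable _ _),
    intervalIntegral.integral_const_mul, intervalIntegral.integral_const_mul,
    intervalIntegral.integral_const_mul] at h
  rw [pderiv_radialMean n hk, pderiv_radialMean n hk]
  simp only [radialMean]
  simp only [one_smul, one_pow, one_mul, ne_eq, Nat.add_eq_zero_iff, one_ne_zero, and_false,
    not_false_eq_true, zero_pow, zero_mul, sub_zero] at h
  linarith

/-! ### Regularity of radial solutions -/

/-- `Q` is a radially decreasing classical solution of `-ΔQ = f(Q)`. -/
structure IsRadialSol (f f' : ℝ → ℝ) (Q : Plane → ℝ) : Prop where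
  hasDerivAt : ∀ s, HasDerivAt f (f' s) s
  contDiff_deriv : ContDiff ℝ 1 f'
  contDiff : ContDiff ℝ 2 Q
  equation : ∀ x, lap Q x = -f (Q x)
  radial_decreasing : ∃ q : ℝ → ℝ, AntitoneOn q (Ici 0) ∧ ∀ x, Q x = q ‖x‖

/-- The function `P = Q'(r)/r`, so that `∇Q = P x`. -/
noncomputable def gradFactor (f : ℝ → ℝ) (Q : Plane → ℝ) (x : Plane) : ℝ :=
  -radialMean 1 (fun x => f (Q x)) x

/-- The function `S` for which `∇P = S x`, where `∇Q = P x`. -/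
noncomputable def hessFactor (f f' : ℝ → ℝ) (Q : Plane → ℝ) (x : Plane) : ℝ :=
  -radialMean 3 (fun x => f' (Q x) * gradFactor f Q x) x

section RadialSol

variable {f f' : ℝ → ℝ} {Q : Plane → ℝ}

theorem IsRadialSol.pderiv_zero (h : IsRadialSol f f' Q) (i : Fin 2) : pderiv i Q 0 = 0 := by
  obtain ⟨q, hq, hQ⟩ := h.radial_decreasing
  have : IsLocalMax Q 0 := Eventually.of_forall fun x => by
    rw [hQ x, hQ 0]
    exact hq (by simp) (norm_nonneg x) (by simp)
  simp [pderiv, this.fderiv_eq_zero]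

/-- The derivative of `Q` along rotations is zero. -/
theorem IsRadialSol.coord_mul_pderiv (h : IsRadialSol f f' Q) (x : Plane) :
    x 1 * pderiv 0 Q x = x 0 * pderiv 1 Q x := by
  obtain ⟨q, -, hQ⟩ := h.radial_decreasing
  set J : Plane := !₂[-x 1, x 0] with hJ
  have hc : HasDerivAt (fun θ : ℝ => Real.cos θ • x + Real.sin θ • J) J 0 := by
    have := ((Real.hasDerivAt_cos 0).smul_const x).add ((Real.hasDerivAt_sin 0).smul_const J)
    simpa using! this
  have hd : DifferentiableAt ℝ Q (Real.cos 0 • x + Real.sin 0 • J) :=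
    h.contDiff.differentiable (by simp) _
  have h1 := hd.hasFDerivAt.comp_hasDerivAt (0 : ℝ) hc
  have hconst : (Q ∘ fun θ : ℝ => Real.cos θ • x + Real.sin θ • J) = fun _ => q ‖x‖ := by
    funext θ
    rw [Function.comp, hQ]
    congr 1
    rw [← sq_eq_sq₀ (norm_nonneg _) (norm_nonneg _), plane_norm_sq, plane_norm_sq]
    simp [hJ]
    linear_combination (x 0 ^ 2 + x 1 ^ 2) * Real.sin_sq_add_cos_sq θ
  rw [hconst] at h1
  have h2 := h1.unique (hasDerivAt_const (0 : ℝ) (q ‖x‖))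
  rw [fderiv_apply_eq_pderiv] at h2
  simp [hJ] at h2
  linarith

theorem IsRadialSol.contDiff_f (h : IsRadialSol f f' Q) : ContDiff ℝ 1 f := by
  rw [contDiff_one_iff_deriv]
  refine ⟨fun s => (h.hasDerivAt s).differentiableAt, ?_⟩
  rw [funext fun s => (h.hasDerivAt s).deriv]
  exact h.contDiff_deriv.continuous

theorem IsRadialSol.contDiff_fQ (h : IsRadialSol f f' Q) : ContDiff ℝ 1 (fun x => f (Q x)) :=
  h.contDiff_f.comp (h.contDiff.of_le (by norm_num))

theorem IsRadialSol.contDiff_gradFactor (h : IsRadialSol f f' Q) :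
    ContDiff ℝ 1 (gradFactor f Q) := (contDiff_radialMean 1 h.contDiff_fQ).neg

theorem IsRadialSol.differentiable (h : IsRadialSol f f' Q) : Differentiable ℝ Q :=
  h.contDiff.differentiable (by simp)

theorem IsRadialSol.contDiff_pderiv_one (h : IsRadialSol f f' Q) (i : Fin 2) :
    ContDiff ℝ 1 (pderiv i Q) := contDiff_pderiv h.contDiff (by norm_num) i

/-- The Euler derivative `x · ∇Q`. -/
theorem IsRadialSol.euler_eq (h : IsRadialSol f f' Q) (x : Plane) :
    x 0 * pderiv 0 Q x + x 1 * pderiv 1 Q x = normSq x * gradFactor f Q x := by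
  set E : Plane → ℝ := fun x => x 0 * pderiv 0 Q x + x 1 * pderiv 1 Q x with hE
  have hC (i : Fin 2) : ContDiff ℝ 1 (pderiv i Q) := h.contDiff_pderiv_one i
  have hX (i : Fin 2) : Differentiable ℝ (pderiv i Q) := (hC i).differentiable (by simp)
  have hm (i j : Fin 2) : Differentiable ℝ (fun x : Plane => x i * pderiv j Q x) :=
    (differentiable_coord i).mul (hX j)
  have hEd : Differentiable ℝ E := (hm 0 0).add (hm 1 1)
  have hpm (i j k : Fin 2) (y : Plane) : pderiv k (fun x : Plane => x i * pderiv j Q x) y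
      = y i * pderiv k (pderiv j Q) y + (if k = i then 1 else 0) * pderiv j Q y := by
    rw [pderiv_mul (differentiable_coord i y) (hX j y), pderiv_coord]
  -- For rotation invariant functions `(x · ∇)² Q = |x|² ΔQ`. Derivatives of the rotation identity
  -- supply the missing second derivatives.
  have hEu (y : Plane) : y 0 * pderiv 0 E y + y 1 * pderiv 1 E y = normSq y * (-f (Q y)) := by
    have hrot : (fun x : Plane => x 1 * pderiv 0 Q x) = fun x => x 0 * pderiv 1 Q x :=
      funext h.coord_mul_pderiv
    have r0 := congrArg (fun k => pderiv 0 k y) hrot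
    have r1 := congrArg (fun k => pderiv 1 k y) hrot
    simp only [hpm] at r0 r1
    rw [← h.equation, hE, pderiv_add (hm 0 0 y) (hm 1 1 y), pderiv_add (hm 0 0 y) (hm 1 1 y),
      lap, Fin.sum_univ_two]
    simp only [hpm, normSq]
    simp at r0 r1 ⊢
    linear_combination (-y 1) * r0 + (y 0) * r1
  have hfc := h.contDiff_fQ.continuous
  have hEc : Continuous E := hEd.continuous
  have hft : Continuous fun t : ℝ => f (Q (t • x)) :=
    hfc.comp (continuous_id.smul continuous_const)
  -- Integrating `d/dt E(t x) = -|x|² t f(Q(t x))` is the formula `r Q' = -∫₀ʳ s f(Q) ds`, scaled to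
  -- `[0, 1]`.
  have := intervalIntegral.integral_eq_sub_of_hasDerivAt_of_le (a := 0) (b := 1) zero_le_one
    (f := fun t : ℝ => E (t • x)) (f' := fun t => -normSq x * (t ^ 1 * f (Q (t • x))))
    (by fun_prop)
    (fun t ht => by
      convert! hasDerivAt_ray hEd x t using 1
      have h1 := hEu (t • x)
      simp only [normSq, PiLp.smul_apply, smul_eq_mul] at h1 ⊢
      apply mul_left_cancel₀ ht.1.ne'
      linear_combination -h1)
    ((continuous_const.mul ((continuous_pow 1).mul hft)).intervalIntegrable _ _)
  rw [intervalIntegral.integral_const_mul] at this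
  have h0 : E 0 = 0 := by simp [hE]
  simp only [one_smul, zero_smul, h0, sub_zero] at this
  change E x = _
  rw [← this, gradFactor, radialMean]
  ring

/-- The radial and rotational derivatives determine the gradient. Regularity is gained here: the
right side involves only a mean of `f(Q)`, whose derivatives are again such means. -/
theorem IsRadialSol.pderiv_eq (h : IsRadialSol f f' Q) (i : Fin 2) :
    pderiv i Q = fun x => x i * gradFactor f Q x := by
  funext x
  rcases eq_or_ne x 0 with rfl | hx
  · simp [h.pderiv_zero]
  · have hn : normSq x ≠ 0 := by
      rw [normSq_eq]; exact pow_ne_zero 2 (norm_ne_zero_iff.2 hx)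
    have h1 := h.euler_eq x
    have h2 := h.coord_mul_pderiv x
    apply mul_left_cancel₀ hn
    have h3 : normSq x = x 0 ^ 2 + x 1 ^ 2 := rfl
    fin_cases i
    · simp only [Fin.zero_eta]
      linear_combination x 0 * h1 + x 1 * h2 + pderiv 0 Q x * h3
    · simp only [Fin.mk_one]
      linear_combination x 1 * h1 - x 0 * h2 + pderiv 1 Q x * h3

theorem IsRadialSol.contDiff_potential_mul (h : IsRadialSol f f' Q) :
    ContDiff ℝ 1 (fun x => f' (Q x) * gradFactor f Q x) :=
  (h.contDiff_deriv.comp (h.contDiff.of_le (by norm_num))).mul h.contDiff_gradFactor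

theorem IsRadialSol.contDiff_hessFactor (h : IsRadialSol f f' Q) :
    ContDiff ℝ 1 (hessFactor f f' Q) := (contDiff_radialMean 3 h.contDiff_potential_mul).neg

theorem IsRadialSol.pderiv_fQ (h : IsRadialSol f f' Q) (i : Fin 2) (x : Plane) :
    pderiv i (fun x => f (Q x)) x = x i * (f' (Q x) * gradFactor f Q x) := by
  rw [pderiv_comp (h.hasDerivAt _) (h.differentiable x), h.pderiv_eq]
  ring

/-- Differentiating the mean raises its exponent from `1` to `2`, and extracting the factor `x i` of
`∂ᵢ f(Q)` raises it to `3`, the exponent in `hessFactor`. -/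
theorem IsRadialSol.pderiv_gradFactor (h : IsRadialSol f f' Q) (i : Fin 2) (x : Plane) :
    pderiv i (gradFactor f Q) x = x i * hessFactor f f' Q x := by
  have : gradFactor f Q = fun x => -radialMean 1 (fun x => f (Q x)) x := rfl
  rw [this, pderiv_neg, pderiv_radialMean 1 h.contDiff_fQ, funext (h.pderiv_fQ i),
    radialMean_coord_mul, hessFactor]
  ring

/-- The equation `ΔQ = -f(Q)` in terms of `P` and `S`. Away from the origin it bounds `S` by `Q` and
`∇Q`. -/
theorem IsRadialSol.normSq_mul_hessFactor (h : IsRadialSol f f' Q) (x : Plane) :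
    normSq x * hessFactor f f' Q x = -f (Q x) - 2 * gradFactor f Q x := by
  have h1 := euler_radialMean 1 h.contDiff_fQ x
  have h2 (i : Fin 2) : pderiv i (radialMean 1 (fun x => f (Q x))) x
      = -(x i * hessFactor f f' Q x) := by
    rw [← h.pderiv_gradFactor]
    have : gradFactor f Q = fun x => -radialMean 1 (fun x => f (Q x)) x := rfl
    rw [this, pderiv_neg, neg_neg]
  rw [h2, h2] at h1
  rw [normSq, gradFactor]
  push_cast at h1
  linear_combination -h1

theorem IsRadialSol.euler_hessFactor (h : IsRadialSol f f' Q) (x : Plane) :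
    x 0 * pderiv 0 (hessFactor f f' Q) x + x 1 * pderiv 1 (hessFactor f f' Q) x
      = -(f' (Q x) * gradFactor f Q x) - 4 * hessFactor f f' Q x := by
  have h1 := euler_radialMean 3 h.contDiff_potential_mul x
  have : hessFactor f f' Q
    = fun x => -radialMean 3 (fun x => f' (Q x) * gradFactor f Q x) x := rfl
  rw [this]
  rw [pderiv_neg, pderiv_neg]
  push_cast at h1
  linear_combination -h1

/-- Differentiating the previous relation avoids any new mean and yields decay of `∇S`. -/
theorem IsRadialSol.normSq_mul_pderiv_hessFactor (h : IsRadialSol f f' Q) (i : Fin 2) (x : Plane) :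
    normSq x * pderiv i (hessFactor f f' Q) x
      = -(x i * (f' (Q x) * gradFactor f Q x + 4 * hessFactor f f' Q x)) := by
  have hS := h.contDiff_hessFactor.differentiable (by simp) x
  have hN : DifferentiableAt ℝ normSq x := (contDiff_normSq.differentiable (n := 1) (by simp)) x
  have hP := h.contDiff_gradFactor.differentiable (by simp) x
  have hfQ := h.contDiff_fQ.differentiable (by simp) x
  have h1 := congrArg (fun k => pderiv i k x) (funext h.normSq_mul_hessFactor)
  rw [pderiv_mul hN hS, pderiv_normSq] at h1
  have h2 : (fun x => -f (Q x) - 2 * gradFactor f Q x)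
      = fun x => (-1) * f (Q x) + (-2) * gradFactor f Q x := by funext x; ring
  rw [h2, pderiv_add (hfQ.const_mul _) (hP.const_mul _), pderiv_const_mul hfQ,
    pderiv_const_mul hP, h.pderiv_fQ, h.pderiv_gradFactor] at h1
  linear_combination h1

/-- The second partial derivatives of `Q`. -/
theorem IsRadialSol.pderiv_pderiv (h : IsRadialSol f f' Q) (i j : Fin 2) :
    pderiv j (pderiv i Q) = fun x =>
      x i * (x j * hessFactor f f' Q x) + (if j = i then 1 else 0) * gradFactor f Q x := by
  funext x
  rw [h.pderiv_eq i, pderiv_mul (differentiable_coord i x)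
    (h.contDiff_gradFactor.differentiable (by simp) x), h.pderiv_gradFactor, pderiv_coord]

/-- The third partial derivatives of `Q`. -/
theorem IsRadialSol.pderiv_pderiv_pderiv (h : IsRadialSol f f' Q) (i j k : Fin 2) :
    pderiv k (pderiv j (pderiv i Q)) = fun x =>
      x i * (x j * pderiv k (hessFactor f f' Q) x)
      + ((if k = j then 1 else 0) * x i + (if k = i then 1 else 0) * x j
        + (if j = i then 1 else 0) * x k) * hessFactor f f' Q x := by
  funext x
  have hS := h.contDiff_hessFactor.differentiable (by simp) x
  have hP := h.contDiff_gradFactor.differentiable (by simp) x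
  have hjS : DifferentiableAt ℝ (fun x : Plane => x j * hessFactor f f' Q x) x :=
    (differentiable_coord j x).mul hS
  have hijS : DifferentiableAt ℝ (fun x : Plane => x i * (x j * hessFactor f f' Q x)) x :=
    (differentiable_coord i x).mul hjS
  rw [h.pderiv_pderiv i j, pderiv_add hijS (hP.const_mul _),
    pderiv_mul (differentiable_coord i x) hjS,
    pderiv_mul (differentiable_coord j x) hS, pderiv_const_mul hP, h.pderiv_gradFactor,
    pderiv_coord, pderiv_coord]
  ring

theorem IsRadialSol.contDiff_pderiv_two (h : IsRadialSol f f' Q) (i : Fin 2) (j : Fin 2) :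
    ContDiff ℝ 1 (pderiv j (pderiv i Q)) := by
  rw [h.pderiv_pderiv]
  have h1 := h.contDiff_hessFactor
  have h2 := h.contDiff_gradFactor
  fun_prop

/-- The partial derivatives of `Q` solve the linearized equation. -/
theorem IsRadialSol.lap_pderiv (h : IsRadialSol f f' Q) (i : Fin 2) (x : Plane) :
    lap (pderiv i Q) x = -(f' (Q x) * pderiv i Q x) := by
  have h1 := h.euler_hessFactor x
  simp only [lap, Fin.sum_univ_two, h.pderiv_pderiv_pderiv]
  rw [h.pderiv_eq i]
  fin_cases i
  · simp
    linear_combination x 0 * h1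
  · simp
    linear_combination x 1 * h1

end RadialSol

/-! ### Classical and weak derivatives -/

theorem integral_pderiv_mul {φ k : Plane → ℝ} (hφ : ContDiff ℝ 1 φ) (hc : HasCompactSupport φ)
    (hk : ContDiff ℝ 1 k) (i : Fin 2) :
    ∫ x, pderiv i φ x * k x = -∫ x, φ x * pderiv i k x := by
  have hφi := continuous_pderiv_one hφ i
  have hki := continuous_pderiv_one hk i
  have hd : HasCompactSupport (pderiv i φ) := hasCompactSupport_pderiv hc i
  have h := integral_mul_fderiv_eq_neg_fderiv_mul_of_integrable (μ := (volume : Measure Plane))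
    (f := k) (g := φ) (v := EuclideanSpace.single i (1 : ℝ))
    ((hki.mul hφ.continuous).integrable_of_hasCompactSupport hc.mul_left)
    ((hk.continuous.mul hφi).integrable_of_hasCompactSupport hd.mul_left)
    ((hk.continuous.mul hφ.continuous).integrable_of_hasCompactSupport hc.mul_left)
    (fun x _ => hk.differentiable (by simp) x) (fun x _ => hφ.differentiable (by simp) x)
  simp only [mul_comm] at h ⊢
  simpa only [pderiv, mul_comm] using h

theorem integral_lap_mul {φ k : Plane → ℝ} (hφ : ContDiff ℝ ∞ φ) (hc : HasCompactSupport φ)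
    (hk : ContDiff ℝ 1 k) (hk2 : ∀ i, ContDiff ℝ 1 (pderiv i k)) :
    ∫ x, k x * lap φ x = ∫ x, φ x * lap k x := by
  have hφi (i : Fin 2) : ContDiff ℝ ∞ (pderiv i φ) := contDiff_pderiv hφ (by simp) i
  have hci (i : Fin 2) := hasCompactSupport_pderiv hc i
  have hcii (i : Fin 2) := hasCompactSupport_pderiv (hci i) i
  have e (i : Fin 2) : ∫ x, k x * pderiv i (pderiv i φ) x
      = ∫ x, φ x * pderiv i (pderiv i k) x := by
    have h1 := integral_pderiv_mul ((hφi i).of_le (by simp)) (hci i) hk i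
    have h2 := integral_pderiv_mul (hφ.of_le (by simp)) hc (hk2 i) i
    rw [h2, neg_neg] at h1
    simpa only [mul_comm] using h1
  simp only [lap, Fin.sum_univ_two, mul_add]
  have i1 (i : Fin 2) : Integrable (fun x => k x * pderiv i (pderiv i φ) x) :=
    (hk.continuous.mul (continuous_pderiv (hφi i) i)).integrable_of_hasCompactSupport
      (hcii i).mul_left
  have i2 (i : Fin 2) : Integrable (fun x => φ x * pderiv i (pderiv i k) x) :=
    (hφ.continuous.mul (continuous_pderiv_one (hk2 i) i)).integrable_of_hasCompactSupport
      hc.mul_right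
  rw [integral_add (i1 0) (i1 1), integral_add (i2 0) (i2 1), e, e]

theorem isWeakSol_of_lap {V : ℝ → ℝ} (hV : Continuous V) {k : Plane → ℝ} (hk : ContDiff ℝ 1 k)
    (hk2 : ∀ i, ContDiff ℝ 1 (pderiv i k)) (h : ∀ x, lap k x = -(V (normSq x) * k x)) :
    IsWeakSol V k := by
  intro φ hφ hc
  have hVn : Continuous fun x => V (normSq x) := hV.comp (contDiff_normSq (n := 1)).continuous
  have hi1 : Integrable fun x => k x * lap φ x :=
    (hk.continuous.mul (continuous_lap hφ)).integrable_of_hasCompactSupport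
      (hasCompactSupport_lap hc).mul_left
  have hi2 : Integrable fun x => k x * (V (normSq x) * φ x) :=
    (hk.continuous.mul (hVn.mul hφ.continuous)).integrable_of_hasCompactSupport
      hc.mul_left.mul_left
  simp only [mul_add]
  rw [integral_add hi1 hi2, integral_lap_mul hφ hc hk hk2, ← integral_add]
  · rw [integral_eq_zero_of_ae (ae_of_all _ fun x => ?_)]
    simp only [h, Pi.zero_apply]
    ring
  · simp only [h]
    exact ((hφ.continuous.mul (hVn.mul hk.continuous).neg)).integrable_of_hasCompactSupport
      hc.mul_right
  · exact hi2

/-! ### Real functions in `L²(ℝ²; 𝕜)`, and the kernel through test functions. -/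

section RCLike

variable {𝕜 : Type*} [RCLike 𝕜]

/-- The class in `L²(ℝ²; 𝕜)` of a real square integrable function. -/
noncomputable def realToL2 (𝕜 : Type*) [RCLike 𝕜] (k : Plane → ℝ) (hk : MemLp k 2 volume) : L2 𝕜 :=
  (hk.ofReal (K := 𝕜)).toLp _

theorem coeFn_realToL2 {k : Plane → ℝ} (hk : MemLp k 2 volume) :
    (realToL2 𝕜 k hk : Plane → 𝕜) =ᵐ[volume] fun x => ((k x : ℝ) : 𝕜) :=
  MemLp.coeFn_toLp _

theorem integral_smul_realToL2 (φ : Plane → ℝ) {k : Plane → ℝ} (hk : MemLp k 2 volume) :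
    ∫ x, φ x • realToL2 𝕜 k hk x = ((∫ x, φ x * k x : ℝ) : 𝕜) := by
  rw [← integral_ofReal]
  refine integral_congr_ae ?_
  filter_upwards [coeFn_realToL2 (𝕜 := 𝕜) hk] with x hx
  rw [hx, RCLike.real_smul_eq_coe_mul]
  push_cast
  rfl

theorem hasWeakPartial_realToL2 {k : Plane → ℝ} (hk : ContDiff ℝ 1 k) (hk2 : MemLp k 2 volume)
    (i : Fin 2) (hki : MemLp (pderiv i k) 2 volume) :
    HasWeakPartial i (realToL2 𝕜 k hk2) (realToL2 𝕜 (pderiv i k) hki) := by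
  intro φ hφ hc
  rw [integral_smul_realToL2, integral_smul_realToL2,
    integral_pderiv_mul (hφ.of_le (by simp)) hc hk]
  push_cast
  rfl

theorem weakPartial_eq {i : Fin 2} {f : H1 𝕜} {h : L2 𝕜} (H : HasWeakPartial i (f : L2 𝕜) h) :
    weakPartial i f = h := (weakPartial_spec i f).unique H

theorem realToL2_mem_H2 {k : Plane → ℝ} (hk : ContDiff ℝ 1 k)
    (hk' : ∀ i, ContDiff ℝ 1 (pderiv i k)) (hk2 : MemLp k 2 volume)
    (hki : ∀ i, MemLp (pderiv i k) 2 volume)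
    (hkij : ∀ i j, MemLp (pderiv j (pderiv i k)) 2 volume) : realToL2 𝕜 k hk2 ∈ H2 𝕜 := by
  have h1 : realToL2 𝕜 k hk2 ∈ H1 𝕜 := fun i => ⟨_, hasWeakPartial_realToL2 hk hk2 i (hki i)⟩
  refine ⟨h1, fun i => ?_⟩
  rw [weakPartial_eq (f := ⟨_, h1⟩) (hasWeakPartial_realToL2 hk hk2 i (hki i))]
  exact fun j => ⟨_, hasWeakPartial_realToL2 (hk' i) (hki i) j (hkij i j)⟩

theorem integral_smul_weakLaplacian (f : H2 𝕜) {φ : Plane → ℝ} (hφ : ContDiff ℝ ∞ φ)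
    (hc : HasCompactSupport φ) :
    ∫ x, φ x • (weakLaplacian f : L2 𝕜) x = ∫ x, lap φ x • (f : L2 𝕜) x := by
  have hφi (i : Fin 2) : ContDiff ℝ ∞ (pderiv i φ) := contDiff_pderiv hφ (by simp) i
  have hci (i : Fin 2) := hasCompactSupport_pderiv hc i
  have e (i : Fin 2) : ∫ x, φ x • (weakPartial i (weakPartial₂ i f) : L2 𝕜) x
      = ∫ x, pderiv i (pderiv i φ) x • (f : L2 𝕜) x := by
    have h1 := weakPartial_spec i (weakPartial₂ i f) φ hφ hc
    have h2 := weakPartial_spec i ⟨(f : L2 𝕜), f.2.1⟩ _ (hφi i) (hci i)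
    have h3 : ((weakPartial₂ i f : H1 𝕜) : L2 𝕜) = weakPartial i ⟨(f : L2 𝕜), f.2.1⟩ := rfl
    rw [h3] at h1
    rw [h2, h1, neg_neg]
  have hl : (weakLaplacian f : L2 𝕜)
      = weakPartial 0 (weakPartial₂ 0 f) + weakPartial 1 (weakPartial₂ 1 f) := by
    simp [weakLaplacian, Fin.sum_univ_two]
  have e1 : ∫ x, φ x • (weakLaplacian f : L2 𝕜) x
      = ∫ x, (φ x • (weakPartial 0 (weakPartial₂ 0 f) : L2 𝕜) x
        + φ x • (weakPartial 1 (weakPartial₂ 1 f) : L2 𝕜) x) := by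
    rw [hl]
    apply integral_congr_ae
    filter_upwards [Lp.coeFn_add (weakPartial 0 (weakPartial₂ 0 f))
      (weakPartial 1 (weakPartial₂ 1 f))] with x hx
    rw [hx, Pi.add_apply, smul_add]
  rw [e1, integral_add (integrable_test_smul hφ.continuous hc _)
    (integrable_test_smul hφ.continuous hc _), e, e, ← integral_add]
  · simp only [lap, Fin.sum_univ_two, add_smul]
  · exact integrable_test_smul (continuous_pderiv (hφi 0) 0) (hasCompactSupport_pderiv (hci 0) 0) _
  · exact integrable_test_smul (continuous_pderiv (hφi 1) 1) (hasCompactSupport_pderiv (hci 1) 1) _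

theorem coeFn_mulPotential {W : Plane → ℝ} (hW : MemLp W ∞ volume) (f : L2 𝕜) :
    (mulPotential W hW f : Plane → 𝕜) =ᵐ[volume] fun x => W x • f x := by
  have h0 : mulPotential W hW f = (hW.ofReal (K := 𝕜)).toLp _ • f := rfl
  rw [h0]
  filter_upwards [Lp.coeFn_lpSMul (r := 2) ((hW.ofReal (K := 𝕜)).toLp _) f,
    (hW.ofReal (K := 𝕜)).coeFn_toLp] with x h1 h2
  rw [h1, Pi.smul_apply', h2, RCLike.real_smul_eq_coe_mul, smul_eq_mul]

/-- The kernel of a Schrödinger operator in terms of test functions. -/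
theorem mem_ker_schrodinger_iff {W : Plane → ℝ} (hW : MemLp W ∞ volume) (hWc : Continuous W)
    (f : H2 𝕜) : f ∈ LinearMap.ker (schrodinger 𝕜 W hW) ↔
      ∀ φ : Plane → ℝ, ContDiff ℝ ∞ φ → HasCompactSupport φ →
        ∫ x, (lap φ x + W x * φ x) • (f : L2 𝕜) x = 0 := by
  have key {φ : Plane → ℝ} (hφ : ContDiff ℝ ∞ φ) (hc : HasCompactSupport φ) :
      ∫ x, (lap φ x + W x * φ x) • (f : L2 𝕜) x
        = (∫ x, φ x • (weakLaplacian f : L2 𝕜) x)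
          - ∫ x, φ x • (-mulPotential W hW (f : L2 𝕜) : L2 𝕜) x := by
    have e1 : ∫ x, φ x • (-mulPotential W hW (f : L2 𝕜) : L2 𝕜) x
        = -∫ x, (W x * φ x) • (f : L2 𝕜) x := by
      rw [← integral_neg]
      apply integral_congr_ae
      filter_upwards [coeFn_mulPotential hW (f : L2 𝕜),
        Lp.coeFn_neg (mulPotential W hW (f : L2 𝕜))] with x h1 h2
      rw [h2, Pi.neg_apply, h1, smul_neg, smul_smul, mul_comm]
    rw [e1, sub_neg_eq_add, integral_smul_weakLaplacian f hφ hc, ← integral_add]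
    · simp only [add_smul]
    · exact integrable_test_smul (continuous_lap hφ) (hasCompactSupport_lap hc) _
    · exact integrable_test_smul (hWc.mul hφ.continuous) hc.mul_left _
  have hS : f ∈ LinearMap.ker (schrodinger 𝕜 W hW)
      ↔ (weakLaplacian f : L2 𝕜) = -mulPotential W hW (f : L2 𝕜) := by
    rw [LinearMap.mem_ker]
    have : schrodinger 𝕜 W hW f = -weakLaplacian f - mulPotential W hW (f : L2 𝕜) := rfl
    rw [this, sub_eq_zero, neg_eq_iff_eq_neg]
  rw [hS]
  constructor
  · intro h φ hφ hc
    rw [key hφ hc, h, sub_self]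
  · intro h
    apply Lp.ext
    refine ae_eq_of_integral_contDiff_smul_eq ((Lp.memLp _).locallyIntegrable (by norm_num))
      ((Lp.memLp _).locallyIntegrable (by norm_num)) fun φ hφ hc => ?_
    have := h φ hφ hc
    rwa [key hφ hc, sub_eq_zero] at this

/-- If the real weak solutions of the linearized equation are spanned by `d₀` and `d₁`, so is
the kernel of the Schrödinger operator. -/
theorem ker_schrodinger_eq_span {V : ℝ → ℝ} (hV : Continuous V) {W : Plane → ℝ}
    (hW : MemLp W ∞ volume) (hVW : ∀ x, W x = V (normSq x)) {w : Fin 2 → Plane → ℝ}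
    (hw : ∀ i, IsWeakSol V (w i)) (d : Fin 2 → H2 𝕜)
    (hd : ∀ i, ((d i : L2 𝕜) : Plane → 𝕜) =ᵐ[volume] fun x => ((w i x : ℝ) : 𝕜))
    (huniq : ∀ v : Plane → ℝ, MemLp v 2 volume → IsWeakSol V v →
      ∃ c₀ c₁ : ℝ, ∀ᵐ x, v x = c₀ * w 0 x + c₁ * w 1 x) :
    LinearMap.ker (schrodinger 𝕜 W hW) = Submodule.span 𝕜 {d 0, d 1} := by
  have hWc : Continuous W := by
    rw [funext hVW]; exact hV.comp (contDiff_normSq (n := 1)).continuous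
  apply le_antisymm
  · intro f hf
    rw [mem_ker_schrodinger_iff hW hWc] at hf
    have hfm := Lp.memLp (f : L2 𝕜)
    have hint {φ : Plane → ℝ} (hφ : ContDiff ℝ ∞ φ) (hc : HasCompactSupport φ) :
        Integrable fun x => (lap φ x + W x * φ x) • (f : L2 𝕜) x :=
      integrable_test_smul ((continuous_lap hφ).add (hWc.mul hφ.continuous))
        ((hasCompactSupport_lap hc).add hc.mul_left) _
    obtain ⟨a₀, a₁, ha⟩ := huniq (fun x => RCLike.re ((f : L2 𝕜) x)) hfm.re
      -- The potential and the test functions are real, so real and imaginary parts of a kernel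
      -- element are weak solutions separately.
      fun φ hφ hc => by
        have h1 := integral_re (𝕜 := 𝕜) (hint hφ hc)
        rw [hf φ hφ hc, map_zero] at h1
        refine Eq.trans (integral_congr_ae (ae_of_all _ fun x => ?_)) h1
        simp only [hVW, RCLike.smul_re]
        ring
    obtain ⟨b₀, b₁, hb⟩ := huniq (fun x => RCLike.im ((f : L2 𝕜) x)) hfm.im
      fun φ hφ hc => by
        have h1 := integral_im (𝕜 := 𝕜) (hint hφ hc)
        rw [hf φ hφ hc, map_zero] at h1
        refine Eq.trans (integral_congr_ae (ae_of_all _ fun x => ?_)) h1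
        simp only [hVW, RCLike.smul_im]
        ring
    refine Submodule.mem_span_pair.2 ⟨a₀ + b₀ * RCLike.I, a₁ + b₁ * RCLike.I, ?_⟩
    apply Subtype.ext
    apply Lp.ext
    rw [Submodule.coe_add, Submodule.coe_smul, Submodule.coe_smul]
    filter_upwards [ha, hb, hd 0, hd 1,
      Lp.coeFn_add (((a₀ : 𝕜) + b₀ * RCLike.I) • (d 0 : L2 𝕜))
        (((a₁ : 𝕜) + b₁ * RCLike.I) • (d 1 : L2 𝕜)),
      Lp.coeFn_smul ((a₀ : 𝕜) + b₀ * RCLike.I) (d 0 : L2 𝕜),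
      Lp.coeFn_smul ((a₁ : 𝕜) + b₁ * RCLike.I) (d 1 : L2 𝕜)] with x h1 h2 h3 h4 h5 h6 h7
    rw [h5, Pi.add_apply, h6, h7, Pi.smul_apply, Pi.smul_apply, h3, h4,
      ← RCLike.re_add_im ((f : L2 𝕜) x), h1, h2]
    simp only [smul_eq_mul]
    push_cast
    ring
  · rw [Submodule.span_le]
    have hmem (i : Fin 2) : d i ∈ LinearMap.ker (schrodinger 𝕜 W hW) := by
      rw [mem_ker_schrodinger_iff hW hWc]
      intro φ hφ hc
      have h1 := hw i φ hφ hc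
      have h2 : ∫ x, (lap φ x + W x * φ x) • (d i : L2 𝕜) x
          = ((∫ x, w i x * (lap φ x + V (normSq x) * φ x) : ℝ) : 𝕜) := by
        rw [← integral_ofReal]
        apply integral_congr_ae
        filter_upwards [hd i] with x hx
        rw [hx, hVW, RCLike.real_smul_eq_coe_mul]
        push_cast
        ring
      rw [h2, h1, RCLike.ofReal_zero]
    rintro _ (rfl | rfl)
    · exact hmem 0
    · exact hmem 1

end RCLike

/-! ### Square integrability of the derivatives of a ground state -/

/-- Integration by parts shows that the classical derivative agrees almost everywhere with the weak
one, which is square integrable by hypothesis. -/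
theorem memLp_pderiv_of_mem_H1 {Q : Plane → ℝ} (hQ : ContDiff ℝ 1 Q) (hQ2 : MemLp Q 2 volume)
    (h : hQ2.toLp Q ∈ H1 ℝ) (i : Fin 2) : MemLp (pderiv i Q) 2 volume := by
  obtain ⟨k, hk⟩ := h i
  refine (Lp.memLp k).ae_eq ?_
  refine ae_eq_of_integral_contDiff_smul_eq ((Lp.memLp k).locallyIntegrable (by norm_num))
    (continuous_pderiv_one hQ i).locallyIntegrable fun φ hφ hc => ?_
  have h1 := hk φ hφ hc
  have h2 : ∫ x, pderiv i φ x • hQ2.toLp Q x = ∫ x, pderiv i φ x * Q x := by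
    apply integral_congr_ae
    filter_upwards [hQ2.coeFn_toLp] with x hx
    rw [hx, smul_eq_mul]
  rw [h2, integral_pderiv_mul (hφ.of_le (by simp)) hc hQ] at h1
  exact (neg_injective h1).symm

/-- Continuity handles the unit ball, where `G` is bounded on a set of finite measure. -/
theorem memLp_of_abs_le_outside_ball {G B : Plane → ℝ} (hG : Continuous G)
    (hB : MemLp B 2 volume) {C : ℝ} (h : ∀ x, 1 ≤ ‖x‖ → |G x| ≤ C * |B x|) :
    MemLp G 2 volume := by
  obtain ⟨M, hM⟩ := (isCompact_closedBall (0 : Plane) 1).exists_bound_of_continuousOn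
    hG.continuousOn
  have h1 : MemLp (fun x => |C| * ‖B x‖ + (Metric.closedBall (0 : Plane) 1).indicator
      (fun _ => |M|) x) 2 volume :=
    (hB.norm.const_mul _).add (memLp_indicator_const 2 measurableSet_closedBall _
      (Or.inr measure_closedBall_lt_top.ne))
  refine h1.of_le hG.aestronglyMeasurable (ae_of_all _ fun x => ?_)
  have h2 : 0 ≤ |C| * ‖B x‖ := by positivity
  refine le_trans ?_ (Real.le_norm_self _)
  by_cases hx : x ∈ Metric.closedBall (0 : Plane) 1
  · rw [indicator_of_mem hx]
    linarith [hM x hx, le_abs_self M]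
  · rw [indicator_of_notMem hx, add_zero]
    have hx' : 1 ≤ ‖x‖ := by
      rw [mem_closedBall_zero_iff, not_le] at hx; exact hx.le
    exact (h x hx').trans (mul_le_mul_of_nonneg_right (le_abs_self C) (abs_nonneg _))

theorem abs_coord_le (x : Plane) (i : Fin 2) : |x i| ≤ ‖x‖ := PiLp.norm_apply_le x i

section RadialSol

variable {f f' : ℝ → ℝ} {Q : Plane → ℝ} {a b : ℝ}

theorem Bistable.exists_bound (hb : Bistable f f' a b) :
    ∃ C, 0 ≤ C ∧ ∀ s ∈ Icc 0 a, |f' s| ≤ C ∧ |f s| ≤ C * s := by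
  obtain ⟨C, hC⟩ := (isCompact_Icc (a := (0 : ℝ)) (b := a)).exists_bound_of_continuousOn
    hb.continuous_deriv.continuousOn
  have h0 : (0 : ℝ) ∈ Icc 0 a := ⟨le_rfl, (hb.b_pos.trans hb.b_lt).le⟩
  refine ⟨C, (norm_nonneg _).trans (hC 0 h0), fun s hs => ⟨hC s hs, ?_⟩⟩
  have := (convex_Icc (0 : ℝ) a).norm_image_sub_le_of_norm_hasDerivWithin_le
    (fun x _ => (hb.hasDerivAt x).hasDerivWithinAt) hC h0 hs
  simpa [hb.map_zero, abs_of_nonneg hs.1] using this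

/-- Away from the origin, the derivatives of `∂ᵢQ` up to order two are bounded by `Q` and `∇Q`. -/
theorem IsRadialSol.abs_derivs_le (h : IsRadialSol f f' Q) (hb : Bistable f f' a b)
    (hr : ∀ x, Q x ∈ Ioo 0 a) : ∃ C, ∀ i j k x, 1 ≤ ‖x‖ →
      |pderiv j (pderiv i Q) x| ≤ C * |(|Q x| + (|pderiv 0 Q x| + |pderiv 1 Q x|))| ∧
      |pderiv k (pderiv j (pderiv i Q)) x|
        ≤ C * |(|Q x| + (|pderiv 0 Q x| + |pderiv 1 Q x|))| := by
  obtain ⟨C, hC0, hC⟩ := hb.exists_bound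
  -- With `m = |∂₀Q| + |∂₁Q|`, the estimates below bound third derivatives by `7 C |Q| + (C + 14)
  -- m`, and second derivatives by less.
  refine ⟨C + 7 * (C + 2), fun i j k x hx => ?_⟩
  set m := |pderiv 0 Q x| + |pderiv 1 Q x| with hm
  set P := gradFactor f Q x with hP
  set S := hessFactor f f' Q x with hS
  set r := ‖x‖ with hrdef
  have hm0 : 0 ≤ m := by positivity
  have hQ0 : 0 ≤ |Q x| := abs_nonneg _
  have hN : normSq x = r ^ 2 := normSq_eq x
  rw [abs_of_nonneg (add_nonneg hQ0 hm0)]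
  have hrP : r * |P| ≤ m := by
    apply le_of_sq_le_sq ?_ hm0
    have h1 : pderiv 0 Q x ^ 2 + pderiv 1 Q x ^ 2 = r ^ 2 * P ^ 2 := by
      rw [← hN, h.pderiv_eq 0, h.pderiv_eq 1, normSq]; ring
    rw [mul_pow, sq_abs, ← h1, hm, ← sq_abs (pderiv 0 Q x), ← sq_abs (pderiv 1 Q x)]
    nlinarith [mul_nonneg (abs_nonneg (pderiv 0 Q x)) (abs_nonneg (pderiv 1 Q x))]
  have hPm : |P| ≤ m := (le_mul_of_one_le_left (abs_nonneg P) hx).trans hrP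
  obtain ⟨hC1, hC2⟩ := hC (Q x) (Ioo_subset_Icc_self (hr x))
  have hQabs : |Q x| = Q x := abs_of_pos (hr x).1
  have hr2S : r ^ 2 * |S| ≤ C * |Q x| + 2 * m := by
    have h1 := h.normSq_mul_hessFactor x
    rw [hN] at h1
    have h2 : r ^ 2 * |S| = |-f (Q x) - 2 * P| := by
      rw [← h1, abs_mul, abs_of_nonneg (sq_nonneg r)]
    rw [h2, hQabs]
    calc |-f (Q x) - 2 * P| ≤ |-f (Q x)| + |2 * P| := abs_sub _ _
      _ = |f (Q x)| + 2 * |P| := by rw [abs_neg, abs_mul, abs_two]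
      _ ≤ _ := by linarith
  have hrS : r * |S| ≤ C * |Q x| + 2 * m := by
    refine le_trans ?_ hr2S
    exact mul_le_mul_of_nonneg_right (by nlinarith) (abs_nonneg S)
  have hS1 : |S| ≤ C * |Q x| + 2 * m := (le_mul_of_one_le_left (abs_nonneg S) hx).trans hrS
  have hr2D (k : Fin 2) : r ^ 2 * |pderiv k (hessFactor f f' Q) x|
      ≤ C * m + 4 * (C * |Q x| + 2 * m) := by
    have h1 := congrArg abs (h.normSq_mul_pderiv_hessFactor k x)
    rw [hN, abs_mul, abs_neg, abs_mul, abs_of_nonneg (sq_nonneg r)] at h1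
    rw [h1]
    calc |x k| * |f' (Q x) * P + 4 * S| ≤ r * (|f' (Q x)| * |P| + 4 * |S|) := by
          refine mul_le_mul (abs_coord_le x k) ?_ (abs_nonneg _) (norm_nonneg x)
          refine (abs_add_le _ _).trans_eq ?_
          rw [abs_mul, abs_mul]
          norm_num
      _ = |f' (Q x)| * (r * |P|) + 4 * (r * |S|) := by ring
      _ ≤ _ := by
          have : |f' (Q x)| * (r * |P|) ≤ C * m :=
            mul_le_mul hC1 hrP (by positivity) hC0
          linarith
  have hij (T : ℝ) (i j : Fin 2) : |x i * (x j * T)| ≤ r ^ 2 * |T| := by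
    rw [abs_mul, abs_mul, ← mul_assoc, sq]
    exact mul_le_mul_of_nonneg_right (mul_le_mul (abs_coord_le x i) (abs_coord_le x j)
      (abs_nonneg _) (norm_nonneg x)) (abs_nonneg T)
  have hδ (p : Prop) [Decidable p] (y : ℝ) : |(if p then 1 else 0) * y| ≤ |y| := by
    split_ifs <;> simp
  have hCQ : 0 ≤ C * |Q x| := by positivity
  have hCm : 0 ≤ C * m := by positivity
  constructor
  · rw [h.pderiv_pderiv]
    have h1 := hij S i j
    have h2 := hδ (j = i) P
    have h3 := abs_add_le (x i * (x j * S)) ((if j = i then 1 else 0) * P)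
    simp only
    nlinarith
  · rw [h.pderiv_pderiv_pderiv]
    have h1 := hij (pderiv k (hessFactor f f' Q) x) i j
    have h2 := hr2D k
    have h3 : |((if k = j then 1 else 0) * x i + (if k = i then 1 else 0) * x j
        + (if j = i then 1 else 0) * x k) * S| ≤ 3 * (r * |S|) := by
      rw [abs_mul]
      have h4 := abs_add_three ((if k = j then 1 else 0) * x i) ((if k = i then 1 else 0) * x j)
        ((if j = i then 1 else 0) * x k)
      have h5 : |(if k = j then 1 else 0) * x i + (if k = i then 1 else 0) * x j
        + (if j = i then 1 else 0) * x k| ≤ 3 * r := by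
        linarith [hδ (k = j) (x i), hδ (k = i) (x j), hδ (j = i) (x k), abs_coord_le x i,
          abs_coord_le x j, abs_coord_le x k]
      rw [← mul_assoc]
      exact mul_le_mul_of_nonneg_right h5 (abs_nonneg S)
    refine (abs_add_le _ _).trans ?_
    nlinarith

theorem IsRadialSol.memLp_derivs (h : IsRadialSol f f' Q) (hb : Bistable f f' a b)
    (hr : ∀ x, Q x ∈ Ioo 0 a) (hQ2 : MemLp Q 2 volume) (hQi : ∀ i, MemLp (pderiv i Q) 2 volume)
    (i j k : Fin 2) : MemLp (pderiv j (pderiv i Q)) 2 volume ∧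
      MemLp (pderiv k (pderiv j (pderiv i Q))) 2 volume := by
  obtain ⟨C, hC⟩ := h.abs_derivs_le hb hr
  have hB : MemLp (fun x => |Q x| + (|pderiv 0 Q x| + |pderiv 1 Q x|)) 2 volume :=
    hQ2.norm.add ((hQi 0).norm.add (hQi 1).norm)
  exact ⟨memLp_of_abs_le_outside_ball (h.contDiff_pderiv_two i j).continuous hB
      fun x hx => (hC i j k x hx).1,
    memLp_of_abs_le_outside_ball (continuous_pderiv_one (h.contDiff_pderiv_two i j) k) hB
      fun x hx => (hC i j k x hx).2⟩

/-! ### The profile of a ground state -/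

/-- The point `(r, 0)`. -/
noncomputable def axis (r : ℝ) : Plane := r • EuclideanSpace.single (0 : Fin 2) (1 : ℝ)

theorem axis_zero_coord (r : ℝ) : axis r 0 = r := by simp [axis]

theorem axis_one_coord (r : ℝ) : axis r 1 = 0 := by simp [axis]

theorem norm_axis (r : ℝ) : ‖axis r‖ = |r| := by simp [axis, norm_smul]

theorem continuous_axis : Continuous axis := by unfold axis; fun_prop

theorem IsRadialSol.eq_of_norm_eq (h : IsRadialSol f f' Q) {x y : Plane} (hxy : ‖x‖ = ‖y‖) :
    Q x = Q y := by
  obtain ⟨q, -, hq⟩ := h.radial_decreasing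
  rw [hq, hq, hxy]

theorem IsRadialSol.gradFactor_eq_of_norm_eq (h : IsRadialSol f f' Q) {x y : Plane}
    (hxy : ‖x‖ = ‖y‖) : gradFactor f Q x = gradFactor f Q y := by
  have (t : ℝ) : Q (t • x) = Q (t • y) := h.eq_of_norm_eq (by rw [norm_smul, norm_smul, hxy])
  simp only [gradFactor, radialMean, this]

theorem IsRadialSol.isProfile (h : IsRadialSol f f' Q) (hb : Bistable f f' a b)
    (hr : ∀ x, Q x ∈ Ioo 0 a) (hQ2 : MemLp Q 2 volume) :
    IsProfile f f' a b (fun r => Q (axis r)) (fun r => r * gradFactor f Q (axis r)) := by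
  have hq (r : ℝ) : HasDerivAt (fun r => Q (axis r)) (r * gradFactor f Q (axis r)) r := by
    convert! hasDerivAt_ray h.differentiable (EuclideanSpace.single (0 : Fin 2) (1 : ℝ)) r using 1
    rw [h.pderiv_eq]
    simp [axis]
  refine ⟨hb, fun r _ => hr _, fun r _ => hq r, fun r hr0 => ?_, fun r hr0 => ?_, ?_, ?_⟩
  · have h1 := hasDerivAt_ray (h.contDiff_gradFactor.differentiable (by simp))
      (EuclideanSpace.single (0 : Fin 2) (1 : ℝ)) r
    have h2 : HasDerivAt (fun r => gradFactor f Q (axis r)) (r * hessFactor f f' Q (axis r)) r := by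
      convert! h1 using 1
      rw [h.pderiv_gradFactor]
      simp [axis]
    convert! (hasDerivAt_id r).mul h2 using 1
    have h3 := h.normSq_mul_hessFactor (axis r)
    rw [normSq, axis_zero_coord, axis_one_coord] at h3
    field_simp
    simp only [id]
    linear_combination -h3
  · obtain ⟨q, hqa, hqQ⟩ := h.radial_decreasing
    have hanti : AntitoneOn (fun r => Q (axis r)) (Ici 0) := fun s hs t ht hst => by
      simp only [hqQ, norm_axis, abs_of_nonneg (mem_Ici.1 hs), abs_of_nonneg (mem_Ici.1 ht)]
      exact hqa hs ht hst
    have h1 := hanti.derivWithin_nonpos (x := r)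
    rwa [(hq r).hasDerivWithinAt.derivWithin (uniqueDiffOn_Ici 0 r (le_of_lt hr0))] at h1
  · have hc : Continuous fun r => gradFactor f Q (axis r) :=
      h.contDiff_gradFactor.continuous.comp continuous_axis
    obtain ⟨C, hC⟩ := (isCompact_Icc (a := (0 : ℝ)) (b := 1)).exists_bound_of_continuousOn
      hc.continuousOn
    refine ⟨C, fun r h0 h1 => ?_⟩
    rw [abs_mul, abs_of_pos h0, mul_comm]
    exact mul_le_mul_of_nonneg_right (hC r ⟨h0.le, h1⟩) h0.le
  · have h1 := (memLp_comp_polar hQ2).integrable_sq.prod_left_ae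
    have : (ae angleMeasure).NeBot := by
      rw [ae_neBot, Ne, Measure.restrict_eq_zero, Real.volume_Ioc, ENNReal.ofReal_eq_zero]
      linarith [Real.pi_pos]
    obtain ⟨θ, hθ⟩ := h1.exists
    refine IntegrableOn.congr_fun hθ (fun ρ hρ => ?_) measurableSet_Ioi
    have hρ : 0 < ρ := hρ
    rw [h.eq_of_norm_eq (y := axis √ρ)]
    rw [norm_polar hρ.le, norm_axis, abs_of_nonneg (Real.sqrt_nonneg ρ)]

/-- Non-degeneracy of ground states. -/
theorem IsRadialSol.kernelIsSpanOfPartials (𝕜 : Type*) [RCLike 𝕜] (h : IsRadialSol f f' Q)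
    (hb : Bistable f f' a b) (hr : ∀ x, Q x ∈ Ioo 0 a) (hQ2 : MemLp Q 2 volume)
    (hQi : ∀ i, MemLp (pderiv i Q) 2 volume) {W : Plane → ℝ} (hW : MemLp W ∞ volume)
    (hWQ : ∀ x, W x = f' (Q x)) : KernelIsSpanOfPartials (schrodinger 𝕜 W hW) Q := by
  -- The potential as a function of `ρ = |x|²`. For `ρ < 0` the square root is `0`, so `V` is
  -- constant there and remains continuous and bounded on all of `ℝ`.
  set V : ℝ → ℝ := fun ρ => f' (Q (axis √ρ)) with hVdef
  obtain ⟨C, -, hC⟩ := hb.exists_bound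
  have hV : Continuous V :=
    hb.continuous_deriv.comp (h.contDiff.continuous.comp (continuous_axis.comp Real.continuous_sqrt))
  have hVQ (x : Plane) : V (normSq x) = f' (Q x) := by
    simp only [hVdef]
    rw [normSq_eq, Real.sqrt_sq (norm_nonneg x), h.eq_of_norm_eq (y := x)]
    rw [norm_axis, abs_norm]
  have hw (i : Fin 2) : IsWeakSol V (pderiv i Q) :=
    isWeakSol_of_lap hV (h.contDiff_pderiv_one i) (h.contDiff_pderiv_two i) fun x => by
      rw [h.lap_pderiv, hVQ]
  have hpol (i : Fin 2) {ρ : ℝ} (hρ : 0 < ρ) (θ : ℝ) : pderiv i Q (polar (ρ, θ))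
      = polar (ρ, θ) i * gradFactor f Q (axis √ρ) := by
    simp only [h.pderiv_eq]
    rw [h.gradFactor_eq_of_norm_eq (y := axis √ρ)]
    rw [norm_polar hρ.le, norm_axis, abs_of_nonneg (Real.sqrt_nonneg ρ)]
  have hmem (i : Fin 2) : realToL2 𝕜 (pderiv i Q) (hQi i) ∈ H2 𝕜 :=
    realToL2_mem_H2 (h.contDiff_pderiv_one i) (h.contDiff_pderiv_two i) (hQi i)
      (fun j => (h.memLp_derivs hb hr hQ2 hQi i j 0).1)
      (fun j k => (h.memLp_derivs hb hr hQ2 hQi i j k).2)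
  have hp₀ (ρ : ℝ) (hρ : 0 < ρ) (θ : ℝ) : pderiv 0 Q (polar (ρ, θ))
      = √ρ * gradFactor f Q (axis √ρ) * Real.cos θ := by
    rw [hpol 0 hρ, polar_apply_zero]; ring
  have hp₁ (ρ : ℝ) (hρ : 0 < ρ) (θ : ℝ) : pderiv 1 Q (polar (ρ, θ))
      = √ρ * gradFactor f Q (axis √ρ) * Real.sin θ := by
    rw [hpol 1 hρ, polar_apply_one]; ring
  have huniq (v : Plane → ℝ) (hv : MemLp v 2 volume) (hvw : IsWeakSol V v) :
      ∃ c₀ c₁ : ℝ, ∀ᵐ x, v x = c₀ * pderiv 0 Q x + c₁ * pderiv 1 Q x :=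
    (h.isProfile hb hr hQ2).exists_ae_eq hV
      (fun ρ => (hC _ (Ioo_subset_Icc_self (hr (axis √ρ)))).1)
      (fun r hr0 => by simp only [hVdef, Real.sqrt_sq hr0.le]) (hQi 0) (hQi 1) (hw 0) (hw 1)
      hp₀ hp₁ hv hvw
  let d : Fin 2 → H2 𝕜 := fun i => ⟨realToL2 𝕜 (pderiv i Q) (hQi i), hmem i⟩
  have hd (i : Fin 2) : ((d i : L2 𝕜) : Plane → 𝕜) =ᵐ[volume] fun x => ((pderiv i Q x : ℝ) : 𝕜) :=
    coeFn_realToL2 (hQi i)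
  exact ⟨d, hd, ker_schrodinger_eq_span hV hW (fun x => by rw [hWQ, hVQ])
    (w := fun i => pderiv i Q) hw d hd huniq⟩

end RadialSol

/-! ### From the ground state to the bubble. -/

theorem KernelIsSpanOfPartials.neg {𝕜 : Type*} [RCLike 𝕜] {L : H2 𝕜 →ₗ[𝕜] L2 𝕜}
    {u u' : Plane → ℝ} (h : KernelIsSpanOfPartials L u)
    (hu : ∀ i x, pderiv i u' x = -pderiv i u x) : KernelIsSpanOfPartials L u' := by
  obtain ⟨d, hd, hL⟩ := h
  refine ⟨fun i => -d i, fun i => ?_, ?_⟩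
  · rw [Submodule.coe_neg]
    filter_upwards [hd i, Lp.coeFn_neg (d i : L2 𝕜)] with x h1 h2
    rw [h2, Pi.neg_apply, h1, hu]
    push_cast
    rfl
  · rw [hL, ← Submodule.span_neg]
    simp

theorem IsGroundState.isRadialSol {α₁ α₃ α₅ b : ℝ} {Q : Plane → ℝ}
    (hQ : IsGroundState α₁ α₃ α₅ Q) (hg : ∀ s ∈ Ioo 0 (√(rho0 α₁ α₃ α₅)),
      g α₁ α₃ α₅ s = quintic α₅ (√(rho0 α₁ α₃ α₅)) b s) :
    IsRadialSol (quintic α₅ (√(rho0 α₁ α₃ α₅)) b) (quinticDeriv α₅ (√(rho0 α₁ α₃ α₅)) b) Q where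
  hasDerivAt := hasDerivAt_quintic _ _ _
  contDiff_deriv := by unfold quinticDeriv; fun_prop
  contDiff := hQ.contDiff
  equation x := by
    rw [← hg _ (hQ.range x), ← hQ.equation x, laplacian_eq_lap hQ.contDiff, neg_neg]
  radial_decreasing := hQ.radial_decreasing

theorem bubbleOperator_eq_L0 {𝕜 : Type*} [RCLike 𝕜] {α₁ α₃ α₅ : ℝ} {Q : Plane → ℝ}
    (hQ : IsGroundState α₁ α₃ α₅ Q) : bubbleOperator 𝕜 hQ = L0 𝕜 hQ := by
  unfold bubbleOperator L0
  congr 1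
  exact funext (bubble_potential_eq hQ)

end CubicQuintic

theorem mainTheorem12 (𝕜 : Type*) [RCLike 𝕜] (α₁ α₃ α₅ : ℝ)
    (hα₁ : 0 < α₁) (hα₃ : 0 < α₃) (hα₅ : 0 < α₅)
    (hα : α₁ * α₅ / α₃ ^ 2 ∈ Set.Ioo (3 / 16 : ℝ) (1 / 4))
    (Q : CubicQuintic.Plane → ℝ) (hQ : CubicQuintic.IsGroundState α₁ α₃ α₅ Q) :
    CubicQuintic.KernelIsSpanOfPartials (CubicQuintic.L0 𝕜 hQ) Q ∧
    CubicQuintic.KernelIsSpanOfPartials (CubicQuintic.bubbleOperator 𝕜 hQ)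
      (CubicQuintic.bubble α₁ α₃ α₅ Q) := by
  obtain ⟨b, hb, hba, hg⟩ := CubicQuintic.exists_g_eq_quintic hα₁ hα₃ hα₅ hα.2
  obtain ⟨hQ2, hQ1⟩ := hQ.mem_H1
  have h : CubicQuintic.KernelIsSpanOfPartials (CubicQuintic.L0 𝕜 hQ) Q :=
    (hQ.isRadialSol hg).kernelIsSpanOfPartials 𝕜 (CubicQuintic.bistable_quintic hα₅ hb hba)
      hQ.range hQ2 (CubicQuintic.memLp_pderiv_of_mem_H1 (hQ.contDiff.of_le (by norm_num)) hQ2 hQ1)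
      hQ.memLp_deriv_g fun x => CubicQuintic.deriv_g_eq_quinticDeriv hg (hQ.range x)
  refine ⟨h, ?_⟩
  rw [CubicQuintic.bubbleOperator_eq_L0]
  refine h.neg fun i x => ?_
  simp only [CubicQuintic.pderiv]
  have : CubicQuintic.bubble α₁ α₃ α₅ Q
      = fun x => √(CubicQuintic.rho0 α₁ α₃ α₅) - Q x := rfl
  rw [this, fderiv_const_sub]
  rfl
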